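/- **Setting.** For $F\in\mathbb M^{3\times3}$ let $\Phi(F)=(F,\operatorname{cof}F,\det F)\in\mathbb M^{3\times3}\times\mathbb M^{3\times3}\times\mathbb R\simeq\mathbb R^{19}$, and write $\xi=(F,\zeta,w)$ for points of $\mathbb R^{19}$. Let $\hat\psi=\hat\psi(\xi,\theta)$ be a $C^3$ function on $\mathbb R^{19}\times(0,\infty)$, and put $$\hat\eta=-\partial_\theta\hat\psi,\qquad \hat e=\hat\psi+\theta\hat\eta,\qquad \Sigma_{i\alpha}=\frac{\partial\hat\psi}{\partial\xi^B}(\xi,\theta)\,\frac{\partial\Phi^B}{\partial F_{i\alpha}}(F).$$ Assume that $\nabla^2_\xi\hat\psi(\xi,\theta)>0$ (positive definite) and $\hat\eta_\theta(\xi,\theta)>0$ everywhere and that, for some $p\ge4$ and $q,r,\ell>1$, with $W(\xi,\theta)=|F|^p+|\zeta|^q+|w|^r+\theta^\ell$, there are constants $c_1,c_2>0$ such that $$c_1W-c_2\le\hat e\le c_2W+c_2,\qquad \lim_{W\to\infty}\frac{|\partial_F\hat\psi|+|\partial_\zeta\hat\psi|^{\frac p{p-1}}+|\partial_w\hat\psi|^{\frac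 p{p-2}}}{W}=0,\qquad \lim_{W\to\infty}\frac{|\partial_\theta\hat\psi|}{W}=0 .$$ For a viscosity $\mu(F,\theta)\ge 0$ and a conductivity $k(F,\theta)>0$ consider on $\mathbb T^3\times[0,T]$, $0<T<\infty$, for $U=(\xi,v,\theta)$ with $\theta>0$, the system $$\partial_t\xi^B-\partial_\alpha\Big(\frac{\partial\Phi^B}{\partial F_{i\alpha}}(F)v_i\Big)=0,\qquad \partial_tv_i-\partial_\alpha\Sigma_{i\alpha}=\partial_\alpha(\mu\,\partial_\alpha v_i),$$ $$\partial_t\big(\tfrac12|v|^2+\hat e\big)-\partial_\alpha(\Sigma_{i\alpha}v_i)=\partial_\alpha(\mu v_i\,\partial_\alpha v_i)+\partial_\alpha(k\,\partial_\alpha\theta),\qquad \partial_\alpha F_{i\beta}=\partial_\beta F_{i\alpha}. \tag{S}$$ A strong solution is a field $U$ of class $C^1$ on $\mathbb T^3\times[0,T]$ whose fluxes $\mu\nabla v$ and $k\nabla\theta$ are differentiable in $x$ with spatial derivatives continuous on $\mathbb T^3\times[0,T]$, and which satisfies (S) pointwise. For two states set $$I(U|\bar U)=\hat\psi-\bar{\hat\psi}-\frac{\partial\hat\psi}{\partial\xi^B}(\bar\xi,\bar\theta)(\xi^B-\bar\xi^B)+\bar{\hat\eta}(\theta-\bar\theta)+\tfrac12|v-\bar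 v|^2+(\hat\eta-\bar{\hat\eta})(\theta-\bar\theta),$$ where bars denote evaluation at $\bar U$, and for $M,\delta>0$ let $$\Gamma_{M,\delta}=\{(\xi,v,\theta):|F|,|\zeta|,|w|,|v|\le M,\ \delta\le\theta\le M\}.$$ **Theorem 5.1.** Fix a $C^1$ function $k(F,\theta)>0$ on $\mathbb M^{3\times3}\times(0,\infty)$ and constants $\underline\delta,C_0>0$. Let $\bar U_k=(\bar\xi,\bar v,\bar\theta)$ be a strong solution on $\mathbb T^3\times[0,T]$ of (S) with zero viscosity and heat flux $\bar k\nabla\bar\theta$, $\bar k=k(\bar F,\bar\theta)$, such that $\bar U_k(x,t)\in\Gamma_{M,\delta}$ for all $(x,t)$ and some $M,\delta>0$. (i) There is a constant $C>0$ (depending on $\hat\psi,p,q,r,\ell,k,T,M,\delta,\underline\delta,C_0$ and $\bar U_k$, but not on $\mu$ or $U_{\mu,k}$) such that, for every continuous viscosity $\mu(F,\theta)>0$ on $\mathbb M^{3\times3}\times(0,\infty)$ and every strong solution $U_{\mu,k}=(\xi,v,\theta)$ of (S) on $\mathbb T^3\times[0,T]$ which satisfies for all $(x,t)$ $$\underline\delta\le\theta(x,t),\qquad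 k(F,\theta)+\frac{\theta^2}{k(F,\theta)}\le C_0\,\hat e(\xi,\theta),$$ one has for all $t\in[0,T]$ $$\int_{\mathbb T^3} I(U_{\mu,k}(t)|\bar U_k(t))\,dx\le C\left(\int_{\mathbb T^3} I(U_{\mu,k}(0)|\bar U_k(0))\,dx+\int_0^T\!\!\int_{\mathbb T^3}\mu(F,\theta)\,\theta\,\frac{|\nabla\bar v|^2}{\bar\theta}\,dx\,ds\right).$$ (ii) Let $\mu=\mu(F,\theta;\mu_0)$, $\mu_0>0$, be a family of such viscosities and let $U_{\mu,k}$ be corresponding strong solutions as in (i) which satisfy in addition $|\mu(F,\theta;\mu_0)\,\theta|\le C_0\,\mu_0\,|\hat e(\xi,\theta)|$ for all $(x,t)$, where $\underline\delta$ and $C_0$ do not depend on $\mu_0$; it suffices that all this holds for all sufficiently small $\mu_0>0$. If $\lim_{\mu_0\to0^+}\int_{\mathbb T^3} I(U_{\mu,k}(0)|\bar U_k(0))\,dx=0$, then $$\sup_{t\in[0,T)}\int_{\mathbb T^3} I(U_{\mu,k}(t)|\bar U_k(t))\,dx\to0\qquad\text{as }\mu_0\to0^+ .$$ -/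

import Mathlib

open Set Filter Topology MeasureTheory

noncomputable section

namespace Thermo

/-! ### Kinematics: deformation gradients, null Lagrangians, extended states -/

/-- Space variable. Functions on the torus `𝕋³ = ℝ³ / ℤ³` are functions on `ℝ³` of period one in
each coordinate; the choice of norm on this copy of `ℝ³` plays no role. -/
abbrev Pt := Fin 3 → ℝ

/-- Real `3 × 3` matrices with the Euclidean (Frobenius) norm; `F (i, α)` is the entry `F_{iα}`. -/
abbrev Mat3 := EuclideanSpace ℝ (Fin 3 × Fin 3)

/-- Vectors of `ℝ³` with the Euclidean norm. -/
abbrev Vec3 := EuclideanSpace ℝ (Fin 3)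

/-- The extended variable `ξ = (F, ζ, w) ∈ 𝕄³ˣ³ × 𝕄³ˣ³ × ℝ ≃ ℝ¹⁹`. -/
abbrev Ext := Mat3 × Mat3 × ℝ

/-- The state `U = (ξ, v, θ)`. -/
abbrev State := Ext × Vec3 × ℝ

/-- The deformation gradient `F` (first block of `ξ`) of a state. -/
def State.F (u : State) : Mat3 := u.1.1

/-- The extended variable `ξ` of a state. -/
def State.xi (u : State) : Ext := u.1

/-- The velocity of a state. -/
def State.v (u : State) : Vec3 := u.2.1

/-- The temperature of a state. -/
def State.th (u : State) : ℝ := u.2.2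

/-- `F` as a Mathlib matrix. -/
def toMatrix (F : Mat3) : Matrix (Fin 3) (Fin 3) ℝ := Matrix.of fun i α => F (i, α)

/-- The cofactor matrix, i.e. the transpose of the adjugate. -/
def cof (F : Mat3) : Mat3 := WithLp.toLp 2 fun b => (toMatrix F).adjugate b.2 b.1

/-- The null Lagrangians `Φ(F) = (F, cof F, det F)`. -/
def Phi (F : Mat3) : Ext := (F, cof F, (toMatrix F).det)

/-- The vector `∂Φ/∂F_{iα}(F)`, with components `∂Φ^B/∂F_{iα}(F)`, `B = 1, …, 19`. -/
def dPhi (i α : Fin 3) (F : Mat3) : Ext := fderiv ℝ Phi F (EuclideanSpace.single (i, α) 1)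

/-! ### Constitutive theory generated by the free energy `ψ̂(ξ, θ)`, `θ > 0` -/

/-- The differential `∂ψ̂/∂ξ (ξ, θ)`, so that `∂ψ̂/∂ξ^B · h^B = psiXi ψ ξ θ h`. -/
def psiXi (ψ : Ext → ℝ → ℝ) (ξ : Ext) (θ : ℝ) : Ext →L[ℝ] ℝ := fderiv ℝ (fun z => ψ z θ) ξ

/-- The entropy `η̂ = -∂ψ̂/∂θ`. -/
def eta (ψ : Ext → ℝ → ℝ) (ξ : Ext) (θ : ℝ) : ℝ := -deriv (fun s => ψ ξ s) θ

/-- The internal energy `ê = ψ̂ + θ η̂ = ψ̂ - θ ∂ψ̂/∂θ`. -/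
def energy (ψ : Ext → ℝ → ℝ) (ξ : Ext) (θ : ℝ) : ℝ := ψ ξ θ + θ * eta ψ ξ θ

/-- The elastic stress `Σ_{iα} = ∂ψ̂/∂ξ^B (ξ, θ) · ∂Φ^B/∂F_{iα}(F)`. -/
def stress (ψ : Ext → ℝ → ℝ) (u : State) (i α : Fin 3) : ℝ :=
  psiXi ψ u.xi u.th (dPhi i α u.F)

/-- `I(ξ,v,θ | ξ̄,v̄,θ̄) = ψ̂(ξ,θ|ξ̄,θ̄) + ½|v - v̄|² + (η̂ - η̂bar)(θ - θ̄)`, where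
`ψ̂(ξ,θ|ξ̄,θ̄) = ψ̂ - ψ̂bar - ∂ψ̂/∂ξ^B(ξ̄,θ̄)(ξ^B - ξ̄^B) + η̂bar (θ - θ̄)`. -/
def relI (ψ : Ext → ℝ → ℝ) (u ub : State) : ℝ :=
  (ψ u.xi u.th - ψ ub.xi ub.th - psiXi ψ ub.xi ub.th (u.xi - ub.xi)
      + eta ψ ub.xi ub.th * (u.th - ub.th))
    + 1 / 2 * ‖u.v - ub.v‖ ^ 2
    + (eta ψ u.xi u.th - eta ψ ub.xi ub.th) * (u.th - ub.th)

/-- `ψ̂` is `C³` on `ℝ¹⁹ × (0, ∞)`, `∇²_ξ ψ̂ > 0` (positive definite) and `η̂_θ > 0`. -/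
structure StableFreeEnergy (ψ : Ext → ℝ → ℝ) : Prop where
  smooth : ContDiffOn ℝ 3 (fun z : Ext × ℝ => ψ z.1 z.2) (univ ×ˢ Ioi 0)
  hess_pos : ∀ (ξ : Ext) (θ : ℝ), 0 < θ → ∀ h : Ext, h ≠ 0 →
    0 < fderiv ℝ (fun z => psiXi ψ z θ) ξ h h
  eta_deriv_pos : ∀ (ξ : Ext) (θ : ℝ), 0 < θ → 0 < deriv (fun s => eta ψ ξ s) θ

/-- `|ξ|_{p,q,r} + θ^ℓ = |F|^p + |ζ|^q + |w|^r + θ^ℓ`. -/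
def weight (p q r l : ℝ) (ξ : Ext) (θ : ℝ) : ℝ :=
  ‖ξ.1‖ ^ p + ‖ξ.2.1‖ ^ q + |ξ.2.2| ^ r + θ ^ l

/-- `|ξ|_{p,q,r} + θ^ℓ → ∞` within `ℝ¹⁹ × (0, ∞)`. -/
def weightAtTop (p q r l : ℝ) : Filter (Ext × ℝ) :=
  comap (fun z => weight p q r l z.1 z.2) atTop ⊓ 𝓟 {z | 0 < z.2}

/-- The growth conditions on `ê`, on `∂_F ψ̂`, `∂_ζ ψ̂`, `∂_w ψ̂`, and on `∂_θ ψ̂`. -/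
structure GrowthConditions (ψ : Ext → ℝ → ℝ) (p q r l : ℝ) : Prop where
  energy_growth : ∃ c₁ c₂ : ℝ, 0 < c₁ ∧ 0 < c₂ ∧ ∀ (ξ : Ext) (θ : ℝ), 0 < θ →
    c₁ * weight p q r l ξ θ - c₂ ≤ energy ψ ξ θ ∧
    energy ψ ξ θ ≤ c₂ * weight p q r l ξ θ + c₂
  psi_xi_growth : Tendsto (fun z : Ext × ℝ =>
      (‖fderiv ℝ (fun F : Mat3 => ψ (F, z.1.2.1, z.1.2.2) z.2) z.1.1‖
        + ‖fderiv ℝ (fun ζ : Mat3 => ψ (z.1.1, ζ, z.1.2.2) z.2) z.1.2.1‖ ^ (p / (p - 1))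
        + |deriv (fun w : ℝ => ψ (z.1.1, z.1.2.1, w) z.2) z.1.2.2| ^ (p / (p - 2)))
      / weight p q r l z.1 z.2) (weightAtTop p q r l) (𝓝 0)
  psi_theta_growth : Tendsto (fun z : Ext × ℝ =>
      |deriv (fun s => ψ z.1 s) z.2| / weight p q r l z.1 z.2) (weightAtTop p q r l) (𝓝 0)

/-- The set `Γ_{M,δ}`. -/
def Gam (M δ : ℝ) : Set State :=
  {u | ‖u.1.1‖ ≤ M ∧ ‖u.1.2.1‖ ≤ M ∧ |u.1.2.2| ≤ M ∧ ‖u.v‖ ≤ M ∧ δ ≤ u.th ∧ u.th ≤ M}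

/-! ### The augmented system of thermoviscoelasticity on `𝕋³ × [0, T]` -/

/-- The partial derivative `∂_α` in space. -/
def pd {E : Type*} [NormedAddCommGroup E] [NormedSpace ℝ E] (α : Fin 3) (f : Pt → E) (x : Pt) : E :=
  fderiv ℝ f x (Pi.single α 1)

/-- The partial derivative in time on `[0, T]` (one-sided at the end points). -/
def pdt {E : Type*} [NormedAddCommGroup E] [NormedSpace ℝ E] (T : ℝ) (f : ℝ → E) (t : ℝ) : E :=
  derivWithin f (Icc 0 T) t

/-- The Newtonian viscous stress `Z_{iα} = μ(F, θ) ∂_α v_i`. -/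
def viscousStress (μ : Mat3 → ℝ → ℝ) (U : ℝ → Pt → State) (i α : Fin 3) (t : ℝ) (x : Pt) : ℝ :=
  μ (U t x).F (U t x).th * pd α (fun y => (U t y).v i) x

/-- The Fourier heat flux `Q_α = k(F, θ) ∂_α θ`. -/
def heatFlux (k : Mat3 → ℝ → ℝ) (U : ℝ → Pt → State) (α : Fin 3) (t : ℝ) (x : Pt) : ℝ :=
  k (U t x).F (U t x).th * pd α (fun y => (U t y).th) x

/-- `|∇v|² = ∑_{i,α} (∂_α v_i)²`. -/
def gradVelSq (U : ℝ → Pt → State) (t : ℝ) (x : Pt) : ℝ :=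
  ∑ i : Fin 3, ∑ α : Fin 3, (pd α (fun y => (U t y).v i) x) ^ 2

/-- `g` is differentiable in `x`, with `∇_x g` continuous on `[0, T] × ℝ³`. -/
def SpaceC1 (T : ℝ) (g : ℝ → Pt → ℝ) : Prop :=
  (∀ t ∈ Icc 0 T, Differentiable ℝ (g t)) ∧
    ContinuousOn (fun z : ℝ × Pt => fderiv ℝ (g z.1) z.2) (Icc 0 T ×ˢ univ)

/-- `U = (ξ, v, θ)` is a strong (classical) solution on `𝕋³ × [0, T]` of the augmented system with
free energy `ψ̂`, viscous stress `Z = μ ∇v`, heat flux `Q = k ∇θ` and no heat supply: `U` is `C¹` on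
`[0, T] × 𝕋³`, the fluxes `Z` and `Q` are `C¹` in space, and the equations hold pointwise.
Taking `μ = 0` gives the augmented system of (heat conducting) thermoelasticity. -/
structure IsStrongSolution (ψ : Ext → ℝ → ℝ) (μ k : Mat3 → ℝ → ℝ) (T : ℝ)
    (U : ℝ → Pt → State) : Prop where
  regular : ContDiffOn ℝ 1 (fun z : ℝ × Pt => U z.1 z.2) (Icc 0 T ×ˢ univ)
  periodic : ∀ t ∈ Icc 0 T, ∀ (x : Pt) (j : Fin 3), U t (x + Pi.single j 1) = U t x
  temp_pos : ∀ t ∈ Icc 0 T, ∀ x, 0 < (U t x).th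
  viscous_regular : ∀ i α, SpaceC1 T (viscousStress μ U i α)
  heat_regular : ∀ α, SpaceC1 T (heatFlux k U α)
  /-- `∂_t ξ^B - ∂_α (∂Φ^B/∂F_{iα}(F) v_i) = 0` -/
  kinematics : ∀ t ∈ Icc 0 T, ∀ x,
    pdt T (fun s => (U s x).xi) t
      - ∑ α, pd α (fun y => ∑ i, (U t y).v i • dPhi i α (U t y).F) x = 0
  /-- `∂_t v_i - ∂_α Σ_{iα} = ∂_α Z_{iα}` -/
  momentum : ∀ t ∈ Icc 0 T, ∀ x, ∀ i,
    pdt T (fun s => (U s x).v i) t - ∑ α, pd α (fun y => stress ψ (U t y) i α) x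
      = ∑ α, pd α (viscousStress μ U i α t) x
  /-- `∂_t (½|v|² + ê) - ∂_α (Σ_{iα} v_i) = ∂_α (Z_{iα} v_i) + ∂_α Q_α` -/
  energy_balance : ∀ t ∈ Icc 0 T, ∀ x,
    pdt T (fun s => 1 / 2 * ‖(U s x).v‖ ^ 2 + energy ψ (U s x).xi (U s x).th) t
        - ∑ α, pd α (fun y => ∑ i, stress ψ (U t y) i α * (U t y).v i) x
      = ∑ α, pd α (fun y => ∑ i, viscousStress μ U i α t y * (U t y).v i) x
        + ∑ α, pd α (heatFlux k U α t) x
  /-- `∂_α F_{iβ} = ∂_β F_{iα}` -/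
  compatibility : ∀ t ∈ Icc 0 T, ∀ x, ∀ i α β,
    pd α (fun y => (U t y).F (i, β)) x = pd β (fun y => (U t y).F (i, α)) x

/-- `∫_{𝕋³} I(U(t) | Ū(t)) dx`, computed on the period cell `[0,1]³`. -/
def totalRelI (ψ : Ext → ℝ → ℝ) (U Ub : ℝ → Pt → State) (t : ℝ) : ℝ :=
  ∫ x in Icc (0 : Pt) 1, relI ψ (U t x) (Ub t x)

/-- `∫₀ᵀ ∫_{𝕋³} μ(F,θ) θ |∇v̄|² / θ̄ dx dt`. -/
def viscousError (μ : Mat3 → ℝ → ℝ) (T : ℝ) (U Ub : ℝ → Pt → State) : ℝ :=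
  ∫ t in (0 : ℝ)..T, ∫ x in Icc (0 : Pt) 1,
    μ (U t x).F (U t x).th * (U t x).th * (gradVelSq Ub t x / (Ub t x).th)

/-- A viscosity coefficient `μ(F, θ) > 0`, continuous on `𝕄³ˣ³ × (0, ∞)`. -/
def IsViscosity (μ : Mat3 → ℝ → ℝ) : Prop :=
  ContinuousOn (fun z : Mat3 × ℝ => μ z.1 z.2) (univ ×ˢ Ioi 0) ∧ ∀ F θ, 0 < θ → 0 < μ F θ

/-- A heat conductivity `k(F, θ) > 0`, continuously differentiable on `𝕄³ˣ³ × (0, ∞)`. -/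
def IsConductivity (k : Mat3 → ℝ → ℝ) : Prop :=
  ContDiffOn ℝ 1 (fun z : Mat3 × ℝ => k z.1 z.2) (univ ×ˢ Ioi 0) ∧ ∀ F θ, 0 < θ → 0 < k F θ

/-- Along `U` one has `θ ≥ δ₀` and `k(F,θ) + θ²/k(F,θ) ≤ C₀ ê(ξ,θ)`. -/
def ThermalBounds (ψ : Ext → ℝ → ℝ) (k : Mat3 → ℝ → ℝ) (T δ₀ C₀ : ℝ)
    (U : ℝ → Pt → State) : Prop :=
  ∀ t ∈ Icc 0 T, ∀ x, δ₀ ≤ (U t x).th ∧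
    k (U t x).F (U t x).th + (U t x).th ^ 2 / k (U t x).F (U t x).th
      ≤ C₀ * energy ψ (U t x).xi (U t x).th

/-- Along `U` one has `|μ(F,θ) θ| ≤ C₀ μ₀ |ê(ξ,θ)|`. -/
def ViscosityBound (ψ : Ext → ℝ → ℝ) (μ : Mat3 → ℝ → ℝ) (T C₀ μ₀ : ℝ)
    (U : ℝ → Pt → State) : Prop :=
  ∀ t ∈ Icc 0 T, ∀ x,
    |μ (U t x).F (U t x).th * (U t x).th| ≤ C₀ * μ₀ * |energy ψ (U t x).xi (U t x).th|

end Thermo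

end

namespace Thermo

/-! ### Null Lagrangians -/

/-! The relative energy I behaves like a squared distance. Strict convexity of ψ̂ in ξ and strict
concavity in θ (η̂_θ > 0) suggest passing from Ū to U through the state (ξ, θ̄): the thermal part of
I is then a convexity defect plus a concavity defect. On compact sets it dominates |z - z̄|²
(`exists_relPsi_ge`). At infinity it dominates the weight W, because it equals ê(U) up to terms
o(W), uniformly for bounded reference states (`exists_relPsi_ge_weight`). Hence a quantity that is
quadratically small near the reference state and O(W) at infinity is at most C·I
(`exists_le_relPsi`).

Along two solutions, the Piola identity ∂_α(∂Φ^B/∂F_{iα}) = 0 and the entropy form of the energy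
balance turn ∂_t I into a divergence plus a production in which derivatives of U enter only together
with a dissipative square (`hasDerivAt_relI_solution`). The elastic production consists of quadratic
terms: the Taylor remainder of ∇ψ̂, the difference of ∇ψ̂ times the difference of ∂Φ, and v - v̄
times the difference of ∂Φ. They are O(W) or controlled by |v - v̄|²: the blocks of ∂Φ have degree
0, 1, 2 in F, which Young's inequality matches with the exponents p/(p-1) and p/(p-2), while |∂Φ|²
grows like |F|⁴, whence p ≥ 4.

In the viscous production the term -μ(θ̄/θ)|∇v|² absorbs ∇v and leaves at most μθ|∇v̄|²/θ̄. In the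
heat production, completing the square in ∇log θ - ∇log θ̄ leaves a multiple of (θk̄ - θ̄k)²/k,
which is at most C·I thanks to k + θ²/k ≤ C₀ê. Integration over the cell removes the divergence, and
Grönwall's inequality gives (i). For (ii), μθ ≤ C₀μ₀|ê| and |ê| ≤ C(1 + I) bound the viscous error
density by Aμ₀(1 + I): the part with I enters the Grönwall rate, the rest is O(μ₀). -/

theorem cof_apply (F : Mat3) (i α : Fin 3) :
    cof F (i, α) = F (i + 1, α + 1) * F (i + 2, α + 2) - F (i + 1, α + 2) * F (i + 2, α + 1) := by
  -- Indices are added modulo 3, and the cyclic order absorbs the cofactor signs.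
  fin_cases i <;> fin_cases α <;>
    simp [cof, toMatrix, Matrix.adjugate_fin_three] <;> ring

theorem det_toMatrix (F : Mat3) :
    (toMatrix F).det = ∑ α, F (0, α) * cof F (0, α) := by
  simp only [cof_apply, Fin.sum_univ_three, Matrix.det_fin_three, toMatrix, Matrix.of_apply]
  simp
  ring

/-- The differential of `cof` at `F` in the direction `G`. -/
noncomputable def dcof (F G : Mat3) : Mat3 := WithLp.toLp 2 fun b =>
  F (b.1 + 1, b.2 + 1) * G (b.1 + 2, b.2 + 2) + G (b.1 + 1, b.2 + 1) * F (b.1 + 2, b.2 + 2)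
    - (F (b.1 + 1, b.2 + 2) * G (b.1 + 2, b.2 + 1) + G (b.1 + 1, b.2 + 2) * F (b.1 + 2, b.2 + 1))

theorem contDiff_cof : ContDiff ℝ ⊤ cof := by
  rw [contDiff_piLp]
  rintro ⟨i, α⟩
  simp only [cof_apply]
  fun_prop

theorem contDiff_det : ContDiff ℝ ⊤ (fun F : Mat3 => (toMatrix F).det) := by
  simp only [det_toMatrix, cof_apply]
  fun_prop

theorem contDiff_Phi : ContDiff ℝ ⊤ Phi :=
  contDiff_id.prodMk (contDiff_cof.prodMk contDiff_det)

theorem contDiff_dPhi (i α : Fin 3) : ContDiff ℝ ⊤ (dPhi i α) :=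
  (contDiff_Phi.fderiv_right (m := ⊤) (by simp)).clm_apply contDiff_const

theorem hasDerivAt_euclidean {ι : Type*} [Fintype ι] {f : ℝ → EuclideanSpace ℝ ι}
    {f' : EuclideanSpace ℝ ι} {t : ℝ} (h : ∀ i, HasDerivAt (fun s => f s i) (f' i) t) :
    HasDerivAt f f' t := by
  have h' := hasDerivAt_pi.2 h
  exact ((PiLp.continuousLinearEquiv 2 ℝ (fun _ : ι => ℝ)).symm.hasFDerivAt.comp_hasDerivAt t h')

theorem hasDerivAt_coord_line (F G : Mat3) (b : Fin 3 × Fin 3) :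
    HasDerivAt (fun s : ℝ => (F + s • G) b) (G b) 0 := by
  simpa using ((hasDerivAt_id (0 : ℝ)).mul_const (G b)).const_add (F b)

theorem hasDerivAt_cof_line (F G : Mat3) (b : Fin 3 × Fin 3) :
    HasDerivAt (fun s : ℝ => cof (F + s • G) b) (dcof F G b) 0 := by
  obtain ⟨i, α⟩ := b
  simp only [cof_apply]
  have h := (((hasDerivAt_coord_line F G (i + 1, α + 1)).mul
    (hasDerivAt_coord_line F G (i + 2, α + 2))).sub
    ((hasDerivAt_coord_line F G (i + 1, α + 2)).mul
    (hasDerivAt_coord_line F G (i + 2, α + 1))))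
  refine h.congr_deriv ?_
  simp [dcof]
  ring

/-- Smoothness of a polynomial map is known beforehand, so its differential can be read off from
derivatives along lines. The differentials of `det` and `dPhi` are found in the same way. -/
theorem fderiv_cof (F G : Mat3) : fderiv ℝ cof F G = dcof F G := by
  have hd : DifferentiableAt ℝ cof F := contDiff_cof.differentiable (by simp) F
  rw [← hd.lineDeriv_eq_fderiv]
  refine HasDerivAt.deriv ?_
  exact hasDerivAt_euclidean fun b => hasDerivAt_cof_line F G b

theorem fderiv_det (F : Mat3) (i α : Fin 3) :
    fderiv ℝ (fun F : Mat3 => (toMatrix F).det) F (EuclideanSpace.single (i, α) 1)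
      = cof F (i, α) := by
  have hd : DifferentiableAt ℝ (fun F : Mat3 => (toMatrix F).det) F :=
    contDiff_det.differentiable (by simp) F
  rw [← hd.lineDeriv_eq_fderiv]
  refine HasDerivAt.deriv ?_
  simp only [det_toMatrix, Fin.sum_univ_three]
  set G : Mat3 := EuclideanSpace.single (i, α) 1 with hG
  have h := fun β : Fin 3 => (hasDerivAt_coord_line F G (0, β)).mul
    (hasDerivAt_cof_line F G (0, β))
  refine (((h 0).add (h 1)).add (h 2)).congr_deriv ?_
  fin_cases i <;> fin_cases α <;> simp [hG, dcof, cof_apply] <;> ring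

theorem dPhi_eq (i α : Fin 3) (F : Mat3) :
    dPhi i α F = (EuclideanSpace.single (i, α) 1, dcof F (EuclideanSpace.single (i, α) 1),
      cof F (i, α)) := by
  have h1 : DifferentiableAt ℝ cof F := contDiff_cof.differentiable (by simp) F
  have h2 : DifferentiableAt ℝ (fun F : Mat3 => (toMatrix F).det) F :=
    contDiff_det.differentiable (by simp) F
  have h := (hasFDerivAt_id F).prodMk (h1.hasFDerivAt.prodMk h2.hasFDerivAt)
  have h' : fderiv ℝ Phi F = _ := HasFDerivAt.fderiv h
  rw [dPhi, h']
  simp [fderiv_cof, fderiv_det]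

theorem fderiv_dPhi (i α : Fin 3) (F G : Mat3) :
    fderiv ℝ (dPhi i α) F G = (0, dcof G (EuclideanSpace.single (i, α) 1), dcof F G (i, α)) := by
  have hd : DifferentiableAt ℝ (dPhi i α) F := (contDiff_dPhi i α).differentiable (by simp) F
  rw [← hd.lineDeriv_eq_fderiv]
  refine HasDerivAt.deriv ?_
  simp only [dPhi_eq]
  refine (hasDerivAt_const _ _).prodMk (HasDerivAt.prodMk ?_ (hasDerivAt_cof_line F G (i, α)))
  refine hasDerivAt_euclidean fun b => ?_
  have h := fun c => hasDerivAt_coord_line F G c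
  simp only [dcof]
  exact (((h _).mul_const _).add ((h _).const_mul _)).sub
    (((h _).mul_const _).add ((h _).const_mul _))

set_option maxHeartbeats 1000000 in
/-- The null-Lagrangian (Piola) identity in algebraic form. -/
theorem sum_fderiv_dPhi_eq_zero (F : Mat3) (G : Fin 3 → Mat3)
    (hG : ∀ i α β, G α (i, β) = G β (i, α)) (i : Fin 3) :
    ∑ α, fderiv ℝ (dPhi i α) F (G α) = 0 := by
  simp only [fderiv_dPhi, Fin.sum_univ_three]
  refine Prod.ext (by simp) (Prod.ext ?_ ?_)
  · ext ⟨j, β⟩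
    -- Compatibility says that mixed derivatives agree. Rewriting each pair to one representative
    -- makes the alternating sum over α cancel by pure algebra.
    have h1 := fun j => hG j 0 1
    have h2 := fun j => hG j 0 2
    have h3 := fun j => hG j 1 2
    fin_cases i <;> fin_cases j <;> fin_cases β <;> simp [dcof] <;> simp only [h1, h2, h3] <;> ring
  · have h1 := fun j => hG j 0 1
    have h2 := fun j => hG j 0 2
    have h3 := fun j => hG j 1 2
    fin_cases i <;> simp [dcof] <;> simp only [h1, h2, h3] <;> ring

/-! ### Growth of ∂Φ/∂F in F -/

theorem abs_coord_le (F : Mat3) (b : Fin 3 × Fin 3) : |F b| ≤ ‖F‖ := by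
  simpa using PiLp.norm_apply_le F b

theorem norm_le_sum_coord (F : Mat3) : ‖F‖ ≤ ∑ b, |F b| := by
  have h : F = ∑ b, EuclideanSpace.single b (F b) := by
    ext c; simp [Finset.sum_apply, Pi.single_apply]
  conv_lhs => rw [h]
  refine (norm_sum_le _ _).trans (Finset.sum_le_sum fun b _ => ?_)
  simp

theorem abs_cof_apply_le (F : Mat3) (b : Fin 3 × Fin 3) : |cof F b| ≤ 2 * ‖F‖ ^ 2 := by
  obtain ⟨i, α⟩ := b
  rw [cof_apply]
  have h : ∀ c d, |F c * F d| ≤ ‖F‖ ^ 2 := fun c d => by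
    rw [abs_mul, sq]
    exact mul_le_mul (abs_coord_le F c) (abs_coord_le F d) (abs_nonneg _) (norm_nonneg _)
  refine (abs_sub _ _).trans ?_
  linarith [h (i + 1, α + 1) (i + 2, α + 2), h (i + 1, α + 2) (i + 2, α + 1)]

theorem norm_dcof_le (F G : Mat3) : ‖dcof F G‖ ≤ 36 * (‖F‖ * ‖G‖) := by
  refine (norm_le_sum_coord _).trans ?_
  have h : ∀ c d, |F c * G d| ≤ ‖F‖ * ‖G‖ := fun c d => by
    rw [abs_mul]
    exact mul_le_mul (abs_coord_le F c) (abs_coord_le G d) (abs_nonneg _) (norm_nonneg _)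
  have h' : ∀ c d, |G c * F d| ≤ ‖F‖ * ‖G‖ := fun c d => by rw [mul_comm]; exact h d c
  -- Each entry consists of four products; summed over nine entries this gives the constant 36.
  have : ∀ b ∈ (Finset.univ : Finset (Fin 3 × Fin 3)), |dcof F G b| ≤ 4 * (‖F‖ * ‖G‖) := by
    rintro b -
    refine (abs_sub _ _).trans ?_
    have h1 := abs_add_le (F (b.1 + 1, b.2 + 1) * G (b.1 + 2, b.2 + 2))
      (G (b.1 + 1, b.2 + 1) * F (b.1 + 2, b.2 + 2))
    have h2 := abs_add_le (F (b.1 + 1, b.2 + 2) * G (b.1 + 2, b.2 + 1))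
      (G (b.1 + 1, b.2 + 2) * F (b.1 + 2, b.2 + 1))
    linarith [h (b.1 + 1, b.2 + 1) (b.1 + 2, b.2 + 2), h' (b.1 + 1, b.2 + 1) (b.1 + 2, b.2 + 2),
      h (b.1 + 1, b.2 + 2) (b.1 + 2, b.2 + 1), h' (b.1 + 1, b.2 + 2) (b.1 + 2, b.2 + 1)]
  refine (Finset.sum_le_sum this).trans ?_
  simp
  linarith

/-- The three blocks of ∂Φ/∂F_{iα} have degree 0, 1 and 2 in F. They are bounded separately because
the growth hypotheses on ψ̂ weigh the three partial derivatives differently. -/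
theorem norm_dPhi_fst (i α : Fin 3) (F : Mat3) : ‖(dPhi i α F).1‖ = 1 := by
  simp [dPhi_eq]

theorem norm_dPhi_snd_le (i α : Fin 3) (F : Mat3) : ‖(dPhi i α F).2.1‖ ≤ 36 * ‖F‖ := by
  rw [dPhi_eq]
  simpa using norm_dcof_le F (EuclideanSpace.single (i, α) 1)

theorem abs_dPhi_trd_le (i α : Fin 3) (F : Mat3) : |(dPhi i α F).2.2| ≤ 2 * ‖F‖ ^ 2 := by
  rw [dPhi_eq]
  exact abs_cof_apply_le F _

theorem norm_dPhi_le (i α : Fin 3) (F : Mat3) : ‖dPhi i α F‖ ≤ 36 * (1 + ‖F‖ ^ 2) := by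
  have h1 := norm_dPhi_fst i α F
  have h2 := norm_dPhi_snd_le i α F
  have h3 := abs_dPhi_trd_le i α F
  refine (norm_prod_le_iff).2 ⟨?_, (norm_prod_le_iff).2 ⟨?_, ?_⟩⟩
  · nlinarith [sq_nonneg ‖F‖]
  · nlinarith [sq_nonneg (‖F‖ - 1)]
  · rw [Real.norm_eq_abs]; nlinarith [sq_nonneg ‖F‖]

end Thermo

namespace Thermo

/-! ### Calculus on compact convex sets -/

section Calculus

variable {E G : Type*} [NormedAddCommGroup E] [NormedSpace ℝ E]
  [NormedAddCommGroup G] [NormedSpace ℝ G]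

theorem hasDerivAt_clm_comp_apply {g : E → E →L[ℝ] ℝ} {H : E →L[ℝ] E →L[ℝ] ℝ} {γ : ℝ → E}
    {γ' h : E} {s : ℝ} (hg : HasFDerivAt g H (γ s)) (hγ : HasDerivAt γ γ' s) :
    HasDerivAt (fun s => g (γ s) h) (H γ' h) s :=
  (ContinuousLinearMap.apply ℝ ℝ h).hasFDerivAt.comp_hasDerivAt s (hg.comp_hasDerivAt s hγ)

theorem hasFDerivAt_partial_fst {f : E × ℝ → G} {f' : E × ℝ →L[ℝ] G} {e : E} {s : ℝ}
    (hf : HasFDerivAt f f' (e, s)) :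
    HasFDerivAt (fun e => f (e, s)) (f'.comp (ContinuousLinearMap.inl ℝ E ℝ)) e :=
  HasFDerivAt.comp (f := fun e => (e, s)) e hf (hasFDerivAt_prodMk_left e s)

theorem hasDerivAt_partial_snd {f : E × ℝ → G} {f' : E × ℝ →L[ℝ] G} {e : E} {s : ℝ}
    (hf : HasFDerivAt f f' (e, s)) : HasDerivAt (fun s => f (e, s)) (f' (0, 1)) s :=
  HasFDerivAt.comp_hasDerivAt s hf ((hasDerivAt_const s e).prodMk (hasDerivAt_id s))

theorem fderiv_partial_fst_apply {g : E × ℝ → E × ℝ →L[ℝ] ℝ}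
    {H : E × ℝ →L[ℝ] E × ℝ →L[ℝ] ℝ} {e : E} {s : ℝ} (hg : HasFDerivAt g H (e, s)) (a b : E) :
    fderiv ℝ (fun e => (g (e, s)).comp (ContinuousLinearMap.inl ℝ E ℝ)) e a b
      = H (a, 0) (b, 0) := by
  have h := ((ContinuousLinearMap.compL ℝ E (E × ℝ) ℝ).flip
    (ContinuousLinearMap.inl ℝ E ℝ)).hasFDerivAt.comp e (hasFDerivAt_partial_fst hg)
  have h' : fderiv ℝ (fun e => (g (e, s)).comp (ContinuousLinearMap.inl ℝ E ℝ)) e = _ := h.fderiv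
  rw [h']
  rfl

theorem exists_lipschitz_of_contDiffOn {f : E → G} {S K : Set E} (hS : IsOpen S)
    (hf : ContDiffOn ℝ 1 f S) (hK : IsCompact K) (hKc : Convex ℝ K) (hKS : K ⊆ S) :
    ∃ L, 0 ≤ L ∧ ∀ x ∈ K, ∀ y ∈ K, ‖f x - f y‖ ≤ L * ‖x - y‖ := by
  have hc : ContinuousOn (fun x => fderiv ℝ f x) K :=
    (hf.continuousOn_fderiv_of_isOpen hS le_rfl).mono hKS
  obtain ⟨L, hL⟩ := hK.exists_bound_of_continuousOn hc
  refine ⟨max L 0, le_max_right _ _, fun x hx y hy => ?_⟩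
  exact hKc.norm_image_sub_le_of_norm_fderiv_le
    (fun z hz => (hf.differentiableOn one_ne_zero).differentiableAt (hS.mem_nhds (hKS hz)))
    (fun z hz => (hL z hz).trans (le_max_left _ _)) hy hx

/-- The mean value inequality is applied on the segment from y to x only, where the derivative
differs from its value at y by at most L‖x - y‖. -/
theorem exists_taylor_bound_of_contDiffOn {f : E → G} {S K : Set E} (hS : IsOpen S)
    (hf : ContDiffOn ℝ 2 f S) (hK : IsCompact K) (hKc : Convex ℝ K) (hKS : K ⊆ S) :
    ∃ L, 0 ≤ L ∧ ∀ x ∈ K, ∀ y ∈ K, ‖f x - f y - fderiv ℝ f y (x - y)‖ ≤ L * ‖x - y‖ ^ 2 := by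
  obtain ⟨L, hL0, hL⟩ := exists_lipschitz_of_contDiffOn hS
    (hf.fderiv_of_isOpen hS (m := 1) (by norm_num)) hK hKc hKS
  refine ⟨L, hL0, fun x hx y hy => ?_⟩
  have hseg : segment ℝ y x ⊆ K := hKc.segment_subset hy hx
  have h := (convex_segment y x).norm_image_sub_le_of_norm_fderiv_le' (f := f)
    (φ := fderiv ℝ f y) (C := L * ‖x - y‖)
    (fun z hz => (hf.differentiableOn two_ne_zero).differentiableAt
      (hS.mem_nhds (hKS (hseg hz))))
    (fun z hz => (hL z (hseg hz) y hy).trans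
      (mul_le_mul_of_nonneg_left (norm_sub_le_of_mem_segment hz) hL0))
    (left_mem_segment ℝ y x) (right_mem_segment ℝ y x)
  rw [sq, ← mul_assoc]
  exact h

/-- Subtracting the linear function c·s from f', and then the matching quadratic from f, leaves two
monotone functions. No continuity of f'' is needed, as it would be for an integral remainder. -/
theorem le_sub_sub_of_second_deriv_ge {f f' f'' : ℝ → ℝ} {c : ℝ}
    (hf : ∀ s ∈ Icc (0 : ℝ) 1, HasDerivAt f (f' s) s)
    (hf' : ∀ s ∈ Icc (0 : ℝ) 1, HasDerivAt f' (f'' s) s)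
    (hc : ∀ s ∈ Icc (0 : ℝ) 1, c ≤ f'' s) : c / 2 ≤ f 1 - f 0 - f' 0 := by
  have hm : MonotoneOn (fun s => f' s - c * s) (Icc 0 1) := by
    have hd : ∀ s ∈ Icc (0 : ℝ) 1, HasDerivAt (fun s => f' s - c * s) (f'' s - c) s :=
      fun s hs => by
        simpa [Pi.sub_def] using (hf' s hs).sub ((hasDerivAt_id s).const_mul c)
    refine monotoneOn_of_deriv_nonneg (convex_Icc 0 1)
      (fun s hs => (hd s hs).continuousAt.continuousWithinAt)
      (fun s hs => (hd s (interior_subset hs)).differentiableAt.differentiableWithinAt)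
      (fun s hs => ?_)
    rw [(hd s (interior_subset hs)).deriv]
    linarith [hc s (interior_subset hs)]
  have hd : ∀ s ∈ Icc (0 : ℝ) 1, HasDerivAt (fun s => f s - f' 0 * s - c / 2 * s ^ 2)
      (f' s - f' 0 - c * s) s := fun s hs => by
    have h := ((hf s hs).sub ((hasDerivAt_id s).const_mul (f' 0))).sub
      (((hasDerivAt_id s).pow 2).const_mul (c / 2))
    refine h.congr_deriv ?_
    simp; ring
  have hm2 : MonotoneOn (fun s => f s - f' 0 * s - c / 2 * s ^ 2) (Icc 0 1) := by
    refine monotoneOn_of_deriv_nonneg (convex_Icc 0 1)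
      (fun s hs => (hd s hs).continuousAt.continuousWithinAt)
      (fun s hs => (hd s (interior_subset hs)).differentiableAt.differentiableWithinAt)
      (fun s hs => ?_)
    have hs' := interior_subset hs
    rw [(hd s hs').deriv]
    have := hm (left_mem_Icc.2 zero_le_one) hs' hs'.1
    simp only [mul_zero, sub_zero] at this
    linarith
  have := hm2 (left_mem_Icc.2 zero_le_one) (right_mem_Icc.2 zero_le_one) zero_le_one
  norm_num at this
  linarith

theorem le_sub_sub_fderiv_of_hess_ge {f : E → ℝ} {g : E → E →L[ℝ] ℝ} {H : E → E →L[ℝ] E →L[ℝ] ℝ}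
    {x h : E} {c : ℝ} (hf : ∀ s ∈ Icc (0 : ℝ) 1, HasFDerivAt f (g (x + s • h)) (x + s • h))
    (hg : ∀ s ∈ Icc (0 : ℝ) 1, HasFDerivAt g (H (x + s • h)) (x + s • h))
    (hc : ∀ s ∈ Icc (0 : ℝ) 1, c ≤ H (x + s • h) h h) :
    c / 2 ≤ f (x + h) - f x - g x h := by
  have hline : ∀ s : ℝ, HasDerivAt (fun s : ℝ => x + s • h) h s := fun s => by
    simpa using ((hasDerivAt_id s).smul_const h).const_add x
  have := le_sub_sub_of_second_deriv_ge (f := fun s => f (x + s • h))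
    (f' := fun s => g (x + s • h) h) (f'' := fun s => H (x + s • h) h h)
    (fun s hs => (hf s hs).comp_hasDerivAt s (hline s))
    (fun s hs => hasDerivAt_clm_comp_apply (hg s hs) (hline s)) hc
  simpa using this

end Calculus

/-! ### The free energy as a function on `ℝ¹⁹ × (0, ∞)` -/

/-- The domain `ℝ¹⁹ × (0, ∞)` of the constitutive functions. -/
def Dom : Set (Ext × ℝ) := univ ×ˢ Ioi 0

/-- The free energy as a function of the pair `(ξ, θ)`. -/
def freeEnergy (ψ : Ext → ℝ → ℝ) (z : Ext × ℝ) : ℝ := ψ z.1 z.2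

/-- The full gradient of the free energy. -/
noncomputable def grad (ψ : Ext → ℝ → ℝ) (z : Ext × ℝ) : (Ext × ℝ) →L[ℝ] ℝ :=
  fderiv ℝ (freeEnergy ψ) z

/-- The full Hessian of the free energy. -/
noncomputable def hess (ψ : Ext → ℝ → ℝ) (z : Ext × ℝ) : (Ext × ℝ) →L[ℝ] (Ext × ℝ) →L[ℝ] ℝ :=
  fderiv ℝ (grad ψ) z

/-- The thermal part of the relative energy `I`. -/
noncomputable def relPsi (ψ : Ext → ℝ → ℝ) (z zb : Ext × ℝ) : ℝ :=
  freeEnergy ψ z - freeEnergy ψ zb - grad ψ zb (z.1 - zb.1, 0)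
    - grad ψ z (0, 1) * (z.2 - zb.2)

theorem mem_dom {z : Ext × ℝ} : z ∈ Dom ↔ 0 < z.2 := by simp [Dom]

theorem isOpen_dom : IsOpen Dom := isOpen_univ.prod isOpen_Ioi

variable {ψ : Ext → ℝ → ℝ}

theorem StableFreeEnergy.contDiffOn_freeEnergy (hψ : StableFreeEnergy ψ) :
    ContDiffOn ℝ 3 (freeEnergy ψ) Dom := hψ.smooth

theorem StableFreeEnergy.contDiffOn_grad (hψ : StableFreeEnergy ψ) :
    ContDiffOn ℝ 2 (grad ψ) Dom :=
  hψ.contDiffOn_freeEnergy.fderiv_of_isOpen isOpen_dom (by norm_num)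

theorem StableFreeEnergy.contDiffOn_hess (hψ : StableFreeEnergy ψ) :
    ContDiffOn ℝ 1 (hess ψ) Dom :=
  hψ.contDiffOn_grad.fderiv_of_isOpen isOpen_dom (by norm_num)

theorem StableFreeEnergy.hasFDerivAt_freeEnergy (hψ : StableFreeEnergy ψ) {z : Ext × ℝ}
    (hz : z ∈ Dom) : HasFDerivAt (freeEnergy ψ) (grad ψ z) z :=
  ((hψ.contDiffOn_freeEnergy.differentiableOn (by norm_num)).differentiableAt
    (isOpen_dom.mem_nhds hz)).hasFDerivAt

theorem StableFreeEnergy.hasFDerivAt_grad (hψ : StableFreeEnergy ψ) {z : Ext × ℝ}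
    (hz : z ∈ Dom) : HasFDerivAt (grad ψ) (hess ψ z) z :=
  ((hψ.contDiffOn_grad.differentiableOn (by norm_num)).differentiableAt
    (isOpen_dom.mem_nhds hz)).hasFDerivAt

theorem StableFreeEnergy.hess_symm (hψ : StableFreeEnergy ψ) {z : Ext × ℝ} (hz : z ∈ Dom)
    (a b : Ext × ℝ) : hess ψ z a b = hess ψ z b a := by
  have h : IsSymmSndFDerivAt ℝ (freeEnergy ψ) z :=
    (hψ.contDiffOn_freeEnergy.contDiffAt (isOpen_dom.mem_nhds hz)).isSymmSndFDerivAt (by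
      simp only [minSmoothness_of_isRCLikeNormedField]; norm_num)
  exact h a b

/-- The constitutive functions are defined by partial derivatives. Here and in the next lemmas they
become components of one full gradient on an open set, where the joint C³ regularity applies. -/
theorem StableFreeEnergy.psiXi_eq (hψ : StableFreeEnergy ψ) (ξ : Ext) {θ : ℝ} (hθ : 0 < θ) :
    psiXi ψ ξ θ = (grad ψ (ξ, θ)).comp (ContinuousLinearMap.inl ℝ Ext ℝ) :=
  (hasFDerivAt_partial_fst (hψ.hasFDerivAt_freeEnergy (z := (ξ, θ)) (mem_dom.2 hθ))).fderiv

theorem StableFreeEnergy.hasDerivAt_theta (hψ : StableFreeEnergy ψ) (ξ : Ext) {θ : ℝ}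
    (hθ : 0 < θ) : HasDerivAt (fun s => ψ ξ s) (grad ψ (ξ, θ) (0, 1)) θ :=
  hasDerivAt_partial_snd (hψ.hasFDerivAt_freeEnergy (z := (ξ, θ)) (mem_dom.2 hθ))

theorem StableFreeEnergy.eta_eq (hψ : StableFreeEnergy ψ) (ξ : Ext) {θ : ℝ} (hθ : 0 < θ) :
    eta ψ ξ θ = - grad ψ (ξ, θ) (0, 1) := by
  rw [eta, (hψ.hasDerivAt_theta ξ hθ).deriv]

theorem StableFreeEnergy.hess_xi_pos (hψ : StableFreeEnergy ψ) {z : Ext × ℝ} (hz : z ∈ Dom)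
    {h : Ext} (hh : h ≠ 0) : 0 < hess ψ z (h, 0) (h, 0) := by
  have hz' := mem_dom.1 hz
  have h1 := hψ.hess_pos z.1 z.2 hz' h hh
  have h2 : (fun ξ => psiXi ψ ξ z.2)
      = fun ξ => (grad ψ (ξ, z.2)).comp (ContinuousLinearMap.inl ℝ Ext ℝ) :=
    funext fun ξ => hψ.psiXi_eq ξ hz'
  rwa [h2, fderiv_partial_fst_apply (hψ.hasFDerivAt_grad hz)] at h1

theorem StableFreeEnergy.hess_theta_neg (hψ : StableFreeEnergy ψ) {z : Ext × ℝ} (hz : z ∈ Dom) :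
    hess ψ z (0, 1) (0, 1) < 0 := by
  have hz' := mem_dom.1 hz
  have h1 := hψ.eta_deriv_pos z.1 z.2 hz'
  have h2 : (fun s => eta ψ z.1 s) =ᶠ[𝓝 z.2] fun s => - grad ψ (z.1, s) (0, 1) := by
    filter_upwards [lt_mem_nhds hz'] with s hs using hψ.eta_eq z.1 hs
  have h3 := (hasDerivAt_clm_comp_apply (γ := fun s => (z.1, s)) (h := (0, 1))
    (hψ.hasFDerivAt_grad hz) ((hasDerivAt_const z.2 z.1).prodMk (hasDerivAt_id z.2))).neg
  have h4 : deriv (fun s => - grad ψ (z.1, s) (0, 1)) z.2 = _ := h3.deriv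
  rw [h2.deriv_eq, h4] at h1
  exact neg_pos.1 h1

theorem StableFreeEnergy.relI_eq (hψ : StableFreeEnergy ψ) {u ub : State} (hu : 0 < u.2.2)
    (hub : 0 < ub.2.2) :
    relI ψ u ub = relPsi ψ (u.1, u.2.2) (ub.1, ub.2.2) + 1 / 2 * ‖u.2.1 - ub.2.1‖ ^ 2 := by
  simp only [relI, relPsi, State.xi, State.th, State.v, hψ.eta_eq _ hu, hψ.eta_eq _ hub,
    hψ.psiXi_eq _ hub, freeEnergy, ContinuousLinearMap.comp_apply, ContinuousLinearMap.inl_apply]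
  ring

theorem StableFreeEnergy.energy_eq (hψ : StableFreeEnergy ψ) (ξ : Ext) {θ : ℝ} (hθ : 0 < θ) :
    energy ψ ξ θ = freeEnergy ψ (ξ, θ) - θ * grad ψ (ξ, θ) (0, 1) := by
  rw [energy, hψ.eta_eq ξ hθ, freeEnergy]; ring

/-! ### Convexity of the free energy -/

theorem add_smul_mk_zero (ξ h : Ext) (θ s : ℝ) :
    ((ξ, θ) : Ext × ℝ) + s • ((h, 0) : Ext × ℝ) = (ξ + s • h, θ) := by simp

theorem add_smul_zero_mk (ξ : Ext) (θ h s : ℝ) :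
    ((ξ, θ) : Ext × ℝ) + s • ((0, h) : Ext × ℝ) = (ξ, θ + s * h) := by simp

/-- Convexity along the segment from ξ̄ to ξ at frozen temperature; the constant c is left free so
that a Hessian bound on any convex set can be inserted. -/
theorem StableFreeEnergy.elastic_convexity (hψ : StableFreeEnergy ψ) {ξ ξb : Ext} {θ c : ℝ}
    (hθ : 0 < θ)
    (hc : ∀ s ∈ Icc (0 : ℝ) 1, c ≤ hess ψ (ξb + s • (ξ - ξb), θ) (ξ - ξb, 0) (ξ - ξb, 0)) :
    c / 2 ≤ freeEnergy ψ (ξ, θ) - freeEnergy ψ (ξb, θ) - grad ψ (ξb, θ) (ξ - ξb, 0) := by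
  have h := le_sub_sub_fderiv_of_hess_ge (f := freeEnergy ψ) (g := grad ψ) (H := hess ψ)
    (x := (ξb, θ)) (h := (ξ - ξb, 0)) (c := c)
    (fun s _ => hψ.hasFDerivAt_freeEnergy (by
      rw [add_smul_mk_zero]; exact mem_dom.2 hθ))
    (fun s _ => hψ.hasFDerivAt_grad (by
      rw [add_smul_mk_zero]; exact mem_dom.2 hθ))
    (fun s hs => by
      rw [add_smul_mk_zero]; exact hc s hs)
  have h1 : ((ξb, θ) : Ext × ℝ) + (ξ - ξb, 0) = (ξ, θ) := by simp
  rwa [h1] at h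

/-- The expansion of -ψ̂ is based at θ and evaluated at θ̄, since the term (η̂ - η̂bar)(θ - θ̄) of I
makes the entropy of U, not that of Ū, multiply θ - θ̄. -/
theorem StableFreeEnergy.thermal_concavity (hψ : StableFreeEnergy ψ) {ξ : Ext} {θ θb c : ℝ}
    (hθ : 0 < θ) (hθb : 0 < θb)
    (hc : ∀ s ∈ Icc (0 : ℝ) 1, c ≤ - hess ψ (ξ, θ + s * (θb - θ)) (0, 1) (0, 1)) :
    c * (θ - θb) ^ 2 / 2
      ≤ freeEnergy ψ (ξ, θ) - freeEnergy ψ (ξ, θb) - grad ψ (ξ, θ) (0, 1) * (θ - θb) := by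
  have hpos : ∀ s ∈ Icc (0 : ℝ) 1, 0 < θ + s * (θb - θ) := fun s hs => by
    rcases eq_or_lt_of_le hs.1 with h0 | h0
    · rw [← h0]; simpa using hθ
    · nlinarith [mul_nonneg (sub_nonneg.2 hs.2) hθ.le, mul_pos h0 hθb]
  have hsm : ((0, θb - θ) : Ext × ℝ) = (θb - θ) • ((0 : Ext), (1 : ℝ)) := by simp
  have h := le_sub_sub_fderiv_of_hess_ge (f := fun z => - freeEnergy ψ z)
    (g := fun z => - grad ψ z) (H := fun z => - hess ψ z)
    (x := (ξ, θ)) (h := (0, θb - θ)) (c := c * (θ - θb) ^ 2)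
    (fun s hs => (hψ.hasFDerivAt_freeEnergy (by
      rw [add_smul_zero_mk]; exact mem_dom.2 (hpos s hs))).neg)
    (fun s hs => (hψ.hasFDerivAt_grad (by
      rw [add_smul_zero_mk]; exact mem_dom.2 (hpos s hs))).neg)
    (fun s hs => by
      rw [add_smul_zero_mk]
      have := mul_le_mul_of_nonneg_right (hc s hs) (sq_nonneg (θ - θb))
      refine this.trans_eq ?_
      rw [hsm]
      simp only [map_smul, smul_apply, neg_apply,
        smul_eq_mul]
      ring)
  have h1 : ((ξ, θ) : Ext × ℝ) + (0, θb - θ) = (ξ, θb) := by simp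
  rw [h1, hsm, map_smul] at h
  simp only [neg_apply, smul_eq_mul] at h
  linarith

/-- The intermediate state (ξ, θ̄) separates a convexity defect in ξ at temperature θ̄ from a
concavity defect in θ at strain ξ. Only the pure second derivatives are needed, so no joint
convexity is required. -/
theorem relPsi_eq_add (z zb : Ext × ℝ) :
    relPsi ψ z zb
      = (freeEnergy ψ (z.1, zb.2) - freeEnergy ψ (zb.1, zb.2)
          - grad ψ (zb.1, zb.2) (z.1 - zb.1, 0))
        + (freeEnergy ψ (z.1, z.2) - freeEnergy ψ (z.1, zb.2)
          - grad ψ (z.1, z.2) (0, 1) * (z.2 - zb.2)) := by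
  simp only [relPsi]; ring

/-- A compact convex box `{‖ξ‖ ≤ R, a ≤ θ ≤ R}` in the state space. -/
def Box (R a : ℝ) : Set (Ext × ℝ) := Metric.closedBall 0 R ×ˢ Icc a R

theorem mem_box {R a : ℝ} {z : Ext × ℝ} : z ∈ Box R a ↔ ‖z.1‖ ≤ R ∧ a ≤ z.2 ∧ z.2 ≤ R := by
  simp [Box, Set.mem_prod]

theorem box_mono {R R' a : ℝ} (h : R ≤ R') : Box R a ⊆ Box R' a := fun z hz => by
  rw [mem_box] at *
  exact ⟨hz.1.trans h, hz.2.1, hz.2.2.trans h⟩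

theorem isCompact_box (R a : ℝ) : IsCompact (Box R a) :=
  (isCompact_closedBall 0 R).prod isCompact_Icc

theorem convex_box (R a : ℝ) : Convex ℝ (Box R a) := (convex_closedBall 0 R).prod (convex_Icc a R)

theorem box_subset_dom {R a : ℝ} (ha : 0 < a) : Box R a ⊆ Dom := fun _ hz =>
  mem_dom.2 (ha.trans_le (mem_box.1 hz).2.1)

/-- Positivity is made uniform by compactness of the box times the unit sphere, then extended to all
directions by homogeneity. -/
theorem StableFreeEnergy.exists_hess_xi_ge (hψ : StableFreeEnergy ψ) {R a : ℝ} (ha : 0 < a) :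
    ∃ c, 0 < c ∧ ∀ z ∈ Box R a, ∀ h : Ext, c * ‖h‖ ^ 2 ≤ hess ψ z (h, 0) (h, 0) := by
  have hK : IsCompact (Box R a ×ˢ Metric.sphere (0 : Ext) 1) :=
    (isCompact_box R a).prod (isCompact_sphere 0 1)
  have hc : ContinuousOn (fun p : (Ext × ℝ) × Ext => hess ψ p.1 (p.2, 0) (p.2, 0))
      (Box R a ×ˢ Metric.sphere (0 : Ext) 1) := by
    have h1 : ContinuousOn (fun p : (Ext × ℝ) × Ext => hess ψ p.1)
        (Box R a ×ˢ Metric.sphere (0 : Ext) 1) :=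
      hψ.contDiffOn_hess.continuousOn.comp continuousOn_fst
        fun _ hp => box_subset_dom ha hp.1
    have h2 : ContinuousOn (fun p : (Ext × ℝ) × Ext => (p.2, (0 : ℝ)))
        (Box R a ×ˢ Metric.sphere (0 : Ext) 1) := by fun_prop
    exact (h1.clm_apply h2).clm_apply h2
  have hpos : ∀ p ∈ Box R a ×ˢ Metric.sphere (0 : Ext) 1,
      0 < hess ψ p.1 (p.2, 0) (p.2, 0) := fun p hp =>
    hψ.hess_xi_pos (box_subset_dom ha hp.1) (ne_zero_of_mem_unit_sphere ⟨p.2, hp.2⟩)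
  obtain ⟨c, hc0, hcle⟩ := hK.exists_forall_le' hc hpos
  refine ⟨c, hc0, fun z hz h => ?_⟩
  by_cases hh : h = 0
  · subst hh
    have : (((0 : Ext), (0 : ℝ)) : Ext × ℝ) = 0 := rfl
    simp [this]
  have hn : ‖h‖ ≠ 0 := norm_ne_zero_iff.2 hh
  have h1 := hcle (z, ‖h‖⁻¹ • h) ⟨hz, by simp [norm_smul, hn]⟩
  have h2 : ((‖h‖⁻¹ • h, (0 : ℝ)) : Ext × ℝ) = ‖h‖⁻¹ • (h, (0 : ℝ)) := by simp
  simp only [h2, map_smul, smul_apply, smul_eq_mul] at h1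
  have h3 := mul_le_mul_of_nonneg_right h1 (sq_nonneg ‖h‖)
  refine h3.trans_eq ?_
  field_simp

theorem StableFreeEnergy.exists_neg_hess_theta_ge (hψ : StableFreeEnergy ψ) {R a : ℝ}
    (ha : 0 < a) :
    ∃ c, 0 < c ∧ ∀ z ∈ Box R a, c ≤ - hess ψ z (0, 1) (0, 1) := by
  have hc : ContinuousOn (fun z => - hess ψ z (0, 1) (0, 1)) (Box R a) :=
    (((hψ.contDiffOn_hess.continuousOn.mono (box_subset_dom ha)).clm_apply
      continuousOn_const).clm_apply continuousOn_const).neg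
  obtain ⟨c, hc0, hcle⟩ := (isCompact_box R a).exists_forall_le' hc
    fun _ hz => neg_pos.2 (hψ.hess_theta_neg (box_subset_dom ha hz))
  exact ⟨c, hc0, hcle⟩

/-- Both legs of the path through (ξ, θ̄) stay inside the convex box, so the two uniform Hessian
bounds apply along them. -/
theorem StableFreeEnergy.exists_relPsi_ge (hψ : StableFreeEnergy ψ) {R a : ℝ} (ha : 0 < a) :
    ∃ c, 0 < c ∧ ∀ z ∈ Box R a, ∀ zb ∈ Box R a, c * ‖z - zb‖ ^ 2 ≤ relPsi ψ z zb := by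
  obtain ⟨c₁, hc₁, h₁⟩ := hψ.exists_hess_xi_ge (R := R) ha
  obtain ⟨c₂, hc₂, h₂⟩ := hψ.exists_neg_hess_theta_ge (R := R) ha
  refine ⟨min c₁ c₂ / 2, by positivity, fun z hz zb hzb => ?_⟩
  have hz' := mem_box.1 hz
  have hzb' := mem_box.1 hzb
  have e₁ := hψ.elastic_convexity (ξ := z.1) (ξb := zb.1) (θ := zb.2)
    (c := c₁ * ‖z.1 - zb.1‖ ^ 2) (ha.trans_le hzb'.2.1) (fun s hs => by
      refine h₁ (zb.1 + s • (z.1 - zb.1), zb.2) (mem_box.2 ⟨?_, hzb'.2⟩) (z.1 - zb.1)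
      have := (convex_closedBall (0 : Ext) R).add_smul_sub_mem
        (mem_closedBall_zero_iff.2 hzb'.1) (mem_closedBall_zero_iff.2 hz'.1) hs
      exact mem_closedBall_zero_iff.1 this)
  have e₂ := hψ.thermal_concavity (ξ := z.1) (θ := z.2) (θb := zb.2) (c := c₂)
    (ha.trans_le hz'.2.1) (ha.trans_le hzb'.2.1) (fun s hs => by
      refine h₂ _ (mem_box.2 ⟨hz'.1, ?_⟩)
      exact (convex_Icc a R).add_smul_sub_mem hz'.2 hzb'.2 hs)
  rw [relPsi_eq_add]
  have hn : ‖z - zb‖ ^ 2 ≤ ‖z.1 - zb.1‖ ^ 2 + (z.2 - zb.2) ^ 2 := by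
    rw [Prod.norm_def]
    rcases max_cases ‖(z - zb).1‖ ‖(z - zb).2‖ with h | h <;> rw [h.1]
    · have := sq_nonneg (z.2 - zb.2); simp only [Prod.fst_sub]; linarith
    · simp only [Prod.snd_sub, Real.norm_eq_abs, sq_abs]
      have := sq_nonneg ‖z.1 - zb.1‖; linarith
  have hm := mul_le_mul_of_nonneg_left hn (by positivity : 0 ≤ min c₁ c₂ / 2)
  have m₁ := mul_le_mul_of_nonneg_right (min_le_left c₁ c₂) (sq_nonneg ‖z.1 - zb.1‖)
  have m₂ := mul_le_mul_of_nonneg_right (min_le_right c₁ c₂) (sq_nonneg (z.2 - zb.2))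
  linarith

theorem StableFreeEnergy.relPsi_nonneg (hψ : StableFreeEnergy ψ) {z zb : Ext × ℝ}
    (hz : z ∈ Dom) (hzb : zb ∈ Dom) : 0 ≤ relPsi ψ z zb := by
  have hz' := mem_dom.1 hz
  have hzb' := mem_dom.1 hzb
  -- Any two states with positive temperature lie in a common box.
  obtain ⟨c, hc, h⟩ := hψ.exists_relPsi_ge (R := max (max ‖z.1‖ ‖zb.1‖) (max z.2 zb.2))
    (a := min z.2 zb.2) (lt_min hz' hzb')
  exact (by positivity : 0 ≤ c * ‖z - zb‖ ^ 2).trans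
    (h z (mem_box.2 (by simp)) zb (mem_box.2 (by simp)))

end Thermo

namespace Thermo

/-! ### Elementary growth estimates -/

theorem le_one_add_rpow {x a : ℝ} (hx : 0 ≤ x) (ha : 1 ≤ a) : x ≤ 1 + x ^ a := by
  rcases le_total x 1 with h | h
  · linarith [Real.rpow_nonneg hx a]
  · linarith [Real.self_le_rpow_of_one_le h ha]

theorem rpow_le_one_add_rpow {x a b : ℝ} (hx : 0 ≤ x) (ha : 0 ≤ a) (hab : a ≤ b) :
    x ^ a ≤ 1 + x ^ b := by
  rcases le_total x 1 with h | h
  · linarith [Real.rpow_nonneg hx b, Real.rpow_le_one hx h ha]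
  · linarith [Real.rpow_le_rpow_of_exponent_le h hab]

theorem exists_le_mul_rpow_add {a ε : ℝ} (ha : 1 < a) (hε : 0 < ε) :
    ∃ C, 0 ≤ C ∧ ∀ x : ℝ, 0 ≤ x → x ≤ ε * x ^ a + C := by
  have ha' : 0 < a - 1 := sub_pos.2 ha
  -- Beyond this threshold ε x^{a-1} ≥ 1, so ε x^a alone dominates x; below it the constant does.
  refine ⟨(1 / ε) ^ (1 / (a - 1)), by positivity, fun x hx => ?_⟩
  rcases le_total x ((1 / ε) ^ (1 / (a - 1))) with h | h
  · have := Real.rpow_nonneg hx a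
    nlinarith
  · have hx0 : 0 < x := lt_of_lt_of_le (by positivity) h
    have h1 : 1 / ε ≤ x ^ (a - 1) := by
      have := Real.rpow_le_rpow (by positivity) h ha'.le
      rwa [← Real.rpow_mul (by positivity), one_div_mul_cancel ha'.ne', Real.rpow_one] at this
    have h2 : x ^ a = x ^ (a - 1) * x := by
      rw [Real.rpow_sub_one hx0.ne']; field_simp
    have h3 : 1 ≤ ε * x ^ (a - 1) := by
      rw [div_le_iff₀ hε] at h1; linarith
    have h4 : (0 : ℝ) ≤ (1 / ε) ^ (1 / (a - 1)) := by positivity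
    rw [h2]
    nlinarith

theorem mul_le_rpow_conj_add {a b p : ℝ} (ha : 0 ≤ a) (hb : 0 ≤ b) (hp : 1 < p) :
    a * b ≤ a ^ (p / (p - 1)) + b ^ p := by
  have hc : (p / (p - 1)).HolderConjugate p := (Real.HolderConjugate.conjExponent hp).symm
  refine (Real.young_inequality_of_nonneg ha hb hc).trans (add_le_add ?_ ?_)
  · exact div_le_self (Real.rpow_nonneg ha _) hc.lt.le
  · exact div_le_self (Real.rpow_nonneg hb _) hp.le

theorem mul_one_add_le {a x p : ℝ} (ha : 0 ≤ a) (hx : 0 ≤ x) (hp : 1 < p) :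
    a * (1 + x) ≤ 2 * a ^ (p / (p - 1)) + 1 + x ^ p := by
  have h1 := mul_le_rpow_conj_add ha hx hp
  have h2 : a ≤ 1 + a ^ (p / (p - 1)) :=
    le_one_add_rpow ha ((one_le_div (by linarith)).2 (by linarith))
  linarith

/-- Young's inequality for x² with exponent p/2, whose conjugate is p/(p-2): exactly the power in
the growth hypothesis on ∂_w ψ̂. -/
theorem mul_one_add_sq_le {a x p : ℝ} (ha : 0 ≤ a) (hx : 0 ≤ x) (hp : 2 < p) :
    a * (1 + x ^ 2) ≤ 2 * a ^ (p / (p - 2)) + 1 + x ^ p := by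
  have h := mul_one_add_le ha (sq_nonneg x) (p := p / 2) (by linarith)
  have h1 : p / 2 / (p / 2 - 1) = p / (p - 2) := by
    have : p - 2 ≠ 0 := by linarith
    have : p / 2 - 1 ≠ 0 := by linarith
    field_simp
  have h2 : (x ^ 2) ^ (p / 2) = x ^ p := by
    rw [← Real.rpow_natCast, ← Real.rpow_mul hx]; norm_num; ring_nf
  rwa [h1, h2] at h

theorem weight_nonneg {p q r l : ℝ} (ξ : Ext) {θ : ℝ} (hθ : 0 < θ) :
    0 ≤ weight p q r l ξ θ := by
  unfold weight; positivity

theorem rpow_fst_le_weight {p q r l : ℝ} (ξ : Ext) {θ : ℝ} (hθ : 0 < θ) :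
    ‖ξ.1‖ ^ p ≤ weight p q r l ξ θ := by
  unfold weight
  have : 0 ≤ ‖ξ.2.1‖ ^ q + |ξ.2.2| ^ r + θ ^ l := by positivity
  linarith

theorem theta_le_one_add_weight {p q r l : ℝ} (hl : 1 < l) (ξ : Ext) {θ : ℝ} (hθ : 0 < θ) :
    θ ≤ 1 + weight p q r l ξ θ := by
  unfold weight
  have : 0 ≤ ‖ξ.1‖ ^ p + ‖ξ.2.1‖ ^ q + |ξ.2.2| ^ r := by positivity
  linarith [le_one_add_rpow hθ.le hl.le]

theorem norm_ext_le (ξ : Ext) : ‖ξ‖ ≤ ‖ξ.1‖ + ‖ξ.2.1‖ + |ξ.2.2| := by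
  have h1 := norm_nonneg ξ.1
  have h2 := norm_nonneg ξ.2.1
  have h3 := abs_nonneg ξ.2.2
  refine norm_prod_le_iff.2 ⟨by linarith, norm_prod_le_iff.2 ⟨by linarith, ?_⟩⟩
  rw [Real.norm_eq_abs]; linarith

theorem exists_norm_le_weight {p q r l ε : ℝ} (hp : 1 < p) (hq : 1 < q) (hr : 1 < r)
    (hε : 0 < ε) :
    ∃ C, 0 ≤ C ∧ ∀ (ξ : Ext) (θ : ℝ), 0 < θ → ‖ξ‖ ≤ ε * weight p q r l ξ θ + C := by
  obtain ⟨A, hA, h₁⟩ := exists_le_mul_rpow_add hp hε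
  obtain ⟨B, hB, h₂⟩ := exists_le_mul_rpow_add hq hε
  obtain ⟨D, hD, h₃⟩ := exists_le_mul_rpow_add hr hε
  refine ⟨A + B + D, by positivity, fun ξ θ hθ => ?_⟩
  have := h₁ _ (norm_nonneg ξ.1)
  have := h₂ _ (norm_nonneg ξ.2.1)
  have := h₃ _ (abs_nonneg ξ.2.2)
  have : 0 ≤ ε * θ ^ l := by positivity
  refine (norm_ext_le ξ).trans ?_
  unfold weight
  linarith

theorem eventually_le_weight {p q r l ε : ℝ} {f : Ext × ℝ → ℝ} (hε : 0 < ε)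
    (hf : Tendsto (fun z => f z / weight p q r l z.1 z.2) (weightAtTop p q r l) (𝓝 0)) :
    ∃ R, ∀ z : Ext × ℝ, 0 < z.2 → R ≤ weight p q r l z.1 z.2 →
      f z ≤ ε * weight p q r l z.1 z.2 := by
  have h := hf.eventually (gt_mem_nhds hε)
  rw [weightAtTop, eventually_inf_principal, eventually_comap, eventually_atTop] at h
  obtain ⟨R, hR⟩ := h
  refine ⟨max R 1, fun z hz hW => ?_⟩
  have h1 := hR _ ((le_max_left _ _).trans hW) z rfl hz
  have hpos : 0 < weight p q r l z.1 z.2 := one_pos.trans_le ((le_max_right _ _).trans hW)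
  exact ((div_lt_iff₀ hpos).1 h1).le

/-! ### Growth of the constitutive functions -/

variable {ψ : Ext → ℝ → ℝ} {p q r l : ℝ}

theorem StableFreeEnergy.grad_xi_eq (hψ : StableFreeEnergy ψ) {z : Ext × ℝ} (hz : 0 < z.2)
    (h : Ext) :
    grad ψ z (h, 0) = fderiv ℝ (fun F : Mat3 => ψ (F, z.1.2.1, z.1.2.2) z.2) z.1.1 h.1
      + fderiv ℝ (fun ζ : Mat3 => ψ (z.1.1, ζ, z.1.2.2) z.2) z.1.2.1 h.2.1
      + deriv (fun w : ℝ => ψ (z.1.1, z.1.2.1, w) z.2) z.1.2.2 * h.2.2 := by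
  obtain ⟨⟨F, ζ, w⟩, θ⟩ := z
  have hd := hψ.hasFDerivAt_freeEnergy (z := ((F, ζ, w), θ)) (mem_dom.2 hz)
  have h1 : HasFDerivAt (fun F : Mat3 => ψ (F, ζ, w) θ) _ F :=
    HasFDerivAt.comp (f := fun F : Mat3 => (((F, ζ, w), θ) : Ext × ℝ)) F hd
      ((hasFDerivAt_prodMk_left F (ζ, w)).prodMk (hasFDerivAt_const θ F))
  have h2 : HasFDerivAt (fun ζ : Mat3 => ψ (F, ζ, w) θ) _ ζ :=
    HasFDerivAt.comp (f := fun ζ : Mat3 => (((F, ζ, w), θ) : Ext × ℝ)) ζ hd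
      (((hasFDerivAt_const F ζ).prodMk (hasFDerivAt_prodMk_left ζ w)).prodMk
        (hasFDerivAt_const θ ζ))
  have h3 : HasDerivAt (fun w : ℝ => ψ (F, ζ, w) θ) _ w :=
    HasFDerivAt.comp_hasDerivAt (f := fun w : ℝ => (((F, ζ, w), θ) : Ext × ℝ)) w hd
      (((hasDerivAt_const w F).prodMk ((hasDerivAt_const w ζ).prodMk (hasDerivAt_id w))).prodMk
        (hasDerivAt_const w θ))
  rw [h1.fderiv, h2.fderiv, h3.deriv]
  have e : ((h, 0) : Ext × ℝ) = ((h.1, 0, 0), 0) + ((0, h.2.1, 0), 0)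
      + h.2.2 • (((0 : Mat3), (0 : Mat3), (1 : ℝ)), (0 : ℝ)) := by
    ext <;> simp
  rw [e, map_add, map_add, map_smul, smul_eq_mul, mul_comm]
  rfl

/-- The three conditions on h reproduce, up to the factor D, the block growth of ∂Φ/∂F_{iα}. Each
pairing of a partial derivative of ψ̂ with its block is then bounded by W through Young's
inequality. Keeping D as a parameter also yields the plain operator norm bound. -/
theorem GrowthConditions.exists_grad_xi_le (hg : GrowthConditions ψ p q r l)
    (hψ : StableFreeEnergy ψ) (hp : 4 ≤ p) :
    ∃ C R : ℝ, 0 ≤ C ∧ ∀ z : Ext × ℝ, 0 < z.2 → R ≤ weight p q r l z.1 z.2 →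
      ∀ (D : ℝ) (h : Ext), ‖h.1‖ ≤ D → ‖h.2.1‖ ≤ D * (1 + ‖z.1.1‖) →
        |h.2.2| ≤ D * (1 + ‖z.1.1‖ ^ 2) →
        |grad ψ z (h, 0)| ≤ C * D * weight p q r l z.1 z.2 := by
  obtain ⟨R, hR⟩ := eventually_le_weight one_pos hg.psi_xi_growth
  -- With W ≥ 1 the additive constants left by Young's inequality are absorbed into W.
  refine ⟨9, max R 1, by norm_num, fun z hz hW D h h1 h2 h3 => ?_⟩
  have hD : 0 ≤ D := (norm_nonneg _).trans h1
  have hW1 : 1 ≤ weight p q r l z.1 z.2 := (le_max_right _ _).trans hW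
  have hb := hR z hz ((le_max_left _ _).trans hW)
  have hF := rpow_fst_le_weight (p := p) (q := q) (r := r) (l := l) z.1 hz
  rw [hψ.grad_xi_eq hz]
  set A := fderiv ℝ (fun F : Mat3 => ψ (F, z.1.2.1, z.1.2.2) z.2) z.1.1
  set B := fderiv ℝ (fun ζ : Mat3 => ψ (z.1.1, ζ, z.1.2.2) z.2) z.1.2.1
  set d := deriv (fun w : ℝ => ψ (z.1.1, z.1.2.1, w) z.2) z.1.2.2
  set W := weight p q r l z.1 z.2
  have y1 := mul_one_add_le (norm_nonneg B) (norm_nonneg z.1.1) (p := p) (by linarith)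
  have y2 := mul_one_add_sq_le (abs_nonneg d) (norm_nonneg z.1.1) (p := p) (by linarith)
  have n2 : 0 ≤ ‖B‖ ^ (p / (p - 1)) := by positivity
  have n3 : 0 ≤ |d| ^ (p / (p - 2)) := by positivity
  have n1 := norm_nonneg A
  have t1 : |A h.1| ≤ ‖A‖ * D :=
    (A.le_opNorm h.1).trans (mul_le_mul_of_nonneg_left h1 (norm_nonneg _))
  have t2 : |B h.2.1| ≤ (‖B‖ * (1 + ‖z.1.1‖)) * D :=
    (B.le_opNorm h.2.1).trans ((mul_le_mul_of_nonneg_left h2 (norm_nonneg _)).trans_eq (by ring))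
  have t3 : |d * h.2.2| ≤ (|d| * (1 + ‖z.1.1‖ ^ 2)) * D := by
    rw [abs_mul]
    exact (mul_le_mul_of_nonneg_left h3 (abs_nonneg _)).trans_eq (by ring)
  have s : ‖A‖ + ‖B‖ * (1 + ‖z.1.1‖) + |d| * (1 + ‖z.1.1‖ ^ 2) ≤ 9 * W := by linarith
  have := mul_le_mul_of_nonneg_right s hD
  have := abs_add_le (A h.1 + B h.2.1) (d * h.2.2)
  have := abs_add_le (A h.1) (B h.2.1)
  linarith

theorem GrowthConditions.exists_grad_theta_le (hg : GrowthConditions ψ p q r l)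
    (hψ : StableFreeEnergy ψ) {ε : ℝ} (hε : 0 < ε) :
    ∃ R : ℝ, ∀ z : Ext × ℝ, 0 < z.2 → R ≤ weight p q r l z.1 z.2 →
      |grad ψ z (0, 1)| ≤ ε * weight p q r l z.1 z.2 := by
  obtain ⟨R, hR⟩ := eventually_le_weight hε hg.psi_theta_growth
  refine ⟨R, fun z hz hW => ?_⟩
  have := hR z hz hW
  rwa [(hψ.hasDerivAt_theta z.1 hz).deriv] at this

/-- Every direction satisfies the block conditions with D equal to its own norm. -/
theorem GrowthConditions.exists_norm_grad_le (hg : GrowthConditions ψ p q r l)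
    (hψ : StableFreeEnergy ψ) (hp : 4 ≤ p) :
    ∃ C R : ℝ, 0 ≤ C ∧ ∀ z : Ext × ℝ, 0 < z.2 → R ≤ weight p q r l z.1 z.2 →
      ‖grad ψ z‖ ≤ C * weight p q r l z.1 z.2 := by
  obtain ⟨C, R, hC, h⟩ := hg.exists_grad_xi_le hψ hp
  obtain ⟨R', h'⟩ := hg.exists_grad_theta_le hψ one_pos
  refine ⟨C + 1, max R R', by positivity, fun z hz hW => ?_⟩
  have hW0 := weight_nonneg (p := p) (q := q) (r := r) (l := l) z.1 hz
  refine ContinuousLinearMap.opNorm_le_bound _ (by positivity) fun x => ?_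
  have n1 : ‖x.1‖ ≤ ‖x‖ := norm_fst_le x
  have n2 : |x.2| ≤ ‖x‖ := norm_snd_le x
  have n3 : ‖x.1.2.1‖ ≤ ‖x‖ := (norm_fst_le _).trans ((norm_snd_le _).trans n1)
  have n4 : |x.1.2.2| ≤ ‖x‖ := (norm_snd_le x.1.2).trans ((norm_snd_le _).trans n1)
  have hx := norm_nonneg x
  have g1 := h z hz ((le_max_left _ _).trans hW) ‖x‖ x.1 ((norm_fst_le _).trans n1)
    (by nlinarith [norm_nonneg z.1.1]) (by nlinarith [sq_nonneg ‖z.1.1‖])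
  have g2 := h' z hz ((le_max_right _ _).trans hW)
  have e : x = (x.1, 0) + x.2 • ((0 : Ext), (1 : ℝ)) := by ext <;> simp
  have e' : grad ψ z x = grad ψ z (x.1, 0) + x.2 * grad ψ z (0, 1) := by
    conv_lhs => rw [e]
    rw [map_add, map_smul, smul_eq_mul]
  rw [e', Real.norm_eq_abs]
  refine (abs_add_le _ _).trans ?_
  rw [abs_mul]
  have g3 := mul_le_mul n2 g2 (abs_nonneg _) hx
  linarith

/-- Rearranged, the relative quantity is ê(z) + θ̄ ∂_θψ̂(z) - ψ̂(z̄) - ∇_ξψ̂(z̄)·(ξ - ξ̄). The first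
term grows like W, the second is o(W) by hypothesis, and the last is linear in ξ, hence o(W) because
p, q, r > 1. -/
theorem GrowthConditions.exists_relPsi_ge_weight (hg : GrowthConditions ψ p q r l)
    (hψ : StableFreeEnergy ψ) (hp : 4 ≤ p) (hq : 1 < q) (hr : 1 < r) {M a : ℝ} (ha : 0 < a) :
    ∃ c R : ℝ, 0 < c ∧ ∀ z : Ext × ℝ, 0 < z.2 → ∀ zb ∈ Box M a, R ≤ weight p q r l z.1 z.2 →
      c * weight p q r l z.1 z.2 ≤ relPsi ψ z zb := by
  obtain ⟨c₁, c₂, hc₁, hc₂, he⟩ := hg.energy_growth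
  obtain ⟨A, hA⟩ := (isCompact_box M a).exists_bound_of_continuousOn
    (hψ.contDiffOn_freeEnergy.continuousOn.mono (box_subset_dom ha))
  obtain ⟨B', hB'⟩ := (isCompact_box M a).exists_bound_of_continuousOn
    (hψ.contDiffOn_grad.continuousOn.mono (box_subset_dom ha))
  set B := max B' 1
  have hB1 : 1 ≤ B := le_max_right _ _
  set m := max M 1
  have hm1 : 1 ≤ m := le_max_right _ _
  have hε₁ : 0 < c₁ / 4 / m := by positivity
  have hε₂ : 0 < c₁ / 4 / B := by positivity
  obtain ⟨R₁, hR₁⟩ := hg.exists_grad_theta_le hψ hε₁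
  obtain ⟨C, hC, hξ⟩ := exists_norm_le_weight (p := p) (q := q) (r := r) (l := l)
    (by linarith) hq hr hε₂
  -- Of the c₁W supplied by the energy, one quarter each pays for the temperature term, for the
  -- linear term and for all constants; one quarter remains.
  refine ⟨c₁ / 4, max R₁ ((c₂ + A + B * (C + m)) * (4 / c₁)), by positivity,
    fun z hz zb hzb hW => ?_⟩
  have hb := mem_box.1 hzb
  have hzb0 : 0 < zb.2 := ha.trans_le hb.2.1
  have hξz := hξ z.1 z.2 hz
  have hRz := hR₁ z hz ((le_max_left _ _).trans hW)
  have hBz : ‖grad ψ zb‖ ≤ B := (hB' zb hzb).trans (le_max_left _ _)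
  have hW0 := weight_nonneg (p := p) (q := q) (r := r) (l := l) z.1 hz
  have e1 := (he z.1 z.2 hz).1
  rw [hψ.energy_eq _ hz] at e1
  generalize weight p q r l z.1 z.2 = W at *
  have e2 : |zb.2 * grad ψ z (0, 1)| ≤ c₁ / 4 * W := by
    rw [abs_mul, abs_of_pos hzb0]
    have h1 : zb.2 ≤ m := hb.2.2.trans (le_max_left _ _)
    refine (mul_le_mul h1 hRz (abs_nonneg _)
      (by positivity)).trans_eq ?_
    field_simp
  have e3 := hA zb hzb
  have e4 : |grad ψ zb (z.1 - zb.1, 0)| ≤ c₁ / 4 * W + B * (C + m) := by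
    have h1 : ‖((z.1 - zb.1, 0) : Ext × ℝ)‖ ≤ c₁ / 4 / B * W + C + m := by
      refine norm_prod_le_iff.2 ⟨?_, ?_⟩
      · refine (norm_sub_le _ _).trans (add_le_add hξz ?_)
        exact hb.1.trans (le_max_left _ _)
      · simp only [norm_zero]; positivity
    refine ((grad ψ zb).le_opNorm _).trans ((mul_le_mul hBz h1
      (norm_nonneg _) (by positivity)).trans_eq ?_)
    field_simp
    ring
  have e5 : (c₂ + A + B * (C + m)) ≤ c₁ / 4 * W := by
    have h1 := mul_le_mul_of_nonneg_left ((le_max_right _ _).trans hW) (by positivity : 0 ≤ c₁ / 4)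
    refine le_trans (le_of_eq ?_) h1
    field_simp
  rw [Real.norm_eq_abs] at e3
  have a1 := (abs_le.1 e2).1
  have a2 := (abs_le.1 e3).2
  have a3 := (abs_le.1 e4).2
  have : relPsi ψ z zb = (freeEnergy ψ z - z.2 * grad ψ z (0, 1)) + zb.2 * grad ψ z (0, 1)
      - freeEnergy ψ zb - grad ψ zb (z.1 - zb.1, 0) := by
    simp only [relPsi]; ring
  rw [this]
  linarith

/-- Sublevel sets of W are bounded in ξ and bounded above in θ. The lower bound θ ≥ a keeps them
away from the boundary of the domain of ψ̂. -/
theorem mem_box_of_weight_le (hp : 4 ≤ p) (hq : 1 < q) (hr : 1 < r) (hl : 1 < l) {z : Ext × ℝ}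
    {a R : ℝ} (ha : 0 < a) (hz : a ≤ z.2) (hW : weight p q r l z.1 z.2 ≤ R) :
    z ∈ Box (1 + R) a := by
  have hz0 : 0 < z.2 := ha.trans_le hz
  have h1 := le_one_add_rpow (norm_nonneg z.1.1) (by linarith : 1 ≤ p)
  have h2 := le_one_add_rpow (norm_nonneg z.1.2.1) hq.le
  have h3 := le_one_add_rpow (abs_nonneg z.1.2.2) hr.le
  have h4 := theta_le_one_add_weight (p := p) (q := q) (r := r) hl z.1 hz0
  have n1 : 0 ≤ ‖z.1.1‖ ^ p := by positivity
  have n2 : 0 ≤ ‖z.1.2.1‖ ^ q := by positivity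
  have n3 : 0 ≤ |z.1.2.2| ^ r := by positivity
  have n4 : 0 ≤ z.2 ^ l := by positivity
  have hW' := hW
  unfold weight at hW'
  refine mem_box.2 ⟨norm_prod_le_iff.2 ⟨by linarith, norm_prod_le_iff.2 ⟨by linarith, ?_⟩⟩, hz,
    by linarith⟩
  rw [Real.norm_eq_abs]; linarith

/-- A quantity which is quadratic near the reference states and dominated by the weight at infinity
is controlled by the relative energy. -/
theorem GrowthConditions.exists_le_relPsi (hg : GrowthConditions ψ p q r l)
    (hψ : StableFreeEnergy ψ) (hp : 4 ≤ p) (hq : 1 < q) (hr : 1 < r) (hl : 1 < l) {M a : ℝ}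
    (ha : 0 < a) (P : Ext × ℝ → Prop) (f : Ext × ℝ → Ext × ℝ → ℝ)
    (hloc : ∀ R, ∃ C, ∀ z ∈ Box R a, ∀ zb ∈ Box R a, P z → f z zb ≤ C * ‖z - zb‖ ^ 2)
    (hinf : ∃ C R : ℝ, ∀ z : Ext × ℝ, 0 < z.2 → ∀ zb ∈ Box M a, P z →
      R ≤ weight p q r l z.1 z.2 → f z zb ≤ C * weight p q r l z.1 z.2) :
    ∃ C, 0 ≤ C ∧ ∀ z : Ext × ℝ, a ≤ z.2 → ∀ zb ∈ Box M a, P z → f z zb ≤ C * relPsi ψ z zb := by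
  obtain ⟨C₁, R₁, h₁⟩ := hinf
  obtain ⟨c, R₂, hc, h₂⟩ := hg.exists_relPsi_ge_weight hψ hp hq hr (M := M) ha
  -- This box contains all states with θ ≥ a and weight at most max R₁ R₂, and all reference states.
  -- The remaining states have large weight, where coercivity applies.
  set R := max (1 + max R₁ R₂) M
  obtain ⟨C₃, h₃⟩ := hloc R
  obtain ⟨c', hc', h₄⟩ := hψ.exists_relPsi_ge (R := R) ha
  refine ⟨max (|C₁| / c) (|C₃| / c'), by positivity, fun z hz zb hzb hP => ?_⟩
  have hz0 : 0 < z.2 := ha.trans_le hz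
  have hnn : 0 ≤ relPsi ψ z zb := hψ.relPsi_nonneg (mem_dom.2 hz0) (box_subset_dom ha hzb)
  rcases le_total (weight p q r l z.1 z.2) (max R₁ R₂) with hW | hW
  · have hzB : z ∈ Box R a :=
      box_mono (le_max_left _ _) (mem_box_of_weight_le hp hq hr hl ha hz hW)
    have hzbB : zb ∈ Box R a := box_mono (le_max_right _ _) hzb
    have e1 := h₃ z hzB zb hzbB hP
    have e2 := h₄ z hzB zb hzbB
    have e3 : f z zb ≤ |C₃| / c' * relPsi ψ z zb := by
      refine e1.trans ((mul_le_mul_of_nonneg_right (le_abs_self _) (sq_nonneg _)).trans ?_)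
      refine le_trans (le_of_eq ?_) (mul_le_mul_of_nonneg_left e2 (by positivity))
      field_simp
    exact e3.trans (mul_le_mul_of_nonneg_right (le_max_right _ _) hnn)
  · have e1 := h₁ z hz0 zb hzb hP ((le_max_left _ _).trans hW)
    have e2 := h₂ z hz0 zb hzb ((le_max_right _ _).trans hW)
    have e3 : f z zb ≤ |C₁| / c * relPsi ψ z zb := by
      refine e1.trans ((mul_le_mul_of_nonneg_right (le_abs_self _)
        (weight_nonneg _ hz0)).trans ?_)
      refine le_trans (le_of_eq ?_) (mul_le_mul_of_nonneg_left e2 (by positivity))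
      field_simp
    exact e3.trans (mul_le_mul_of_nonneg_right (le_max_left _ _) hnn)

end Thermo

namespace Thermo

/-! ### Pointwise control by the relative energy -/

variable {ψ : Ext → ℝ → ℝ} {p q r l : ℝ}

/-- The energy is at most of order 1 + W, and W is either bounded or dominated by the relative
quantity. This turns the bound on μθ in part (ii) into one by 1 + I. -/
theorem GrowthConditions.exists_abs_energy_le (hg : GrowthConditions ψ p q r l)
    (hψ : StableFreeEnergy ψ) (hp : 4 ≤ p) (hq : 1 < q) (hr : 1 < r) {M a : ℝ} (ha : 0 < a) :
    ∃ C, 0 ≤ C ∧ ∀ z : Ext × ℝ, 0 < z.2 → ∀ zb ∈ Box M a,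
      |energy ψ z.1 z.2| ≤ C * (1 + relPsi ψ z zb) := by
  obtain ⟨c₁, c₂, hc₁, hc₂, he⟩ := hg.energy_growth
  obtain ⟨c, R, hc, h⟩ := hg.exists_relPsi_ge_weight hψ hp hq hr (M := M) ha
  refine ⟨c₂ * (|R| + 1) + c₂ / c, by positivity, fun z hz zb hzb => ?_⟩
  have hnn : 0 ≤ relPsi ψ z zb := hψ.relPsi_nonneg (mem_dom.2 hz) (box_subset_dom ha hzb)
  have hW0 := weight_nonneg (p := p) (q := q) (r := r) (l := l) z.1 hz
  have hez := he z.1 z.2 hz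
  have hh := h z hz zb hzb
  generalize weight p q r l z.1 z.2 = W at *
  have h1 : |energy ψ z.1 z.2| ≤ c₂ * W + c₂ := by
    rw [abs_le]; constructor <;> nlinarith
  have h2 : 0 ≤ c₂ * (|R| + 1) * relPsi ψ z zb := by positivity
  have h3 : 0 < c₂ / c := by positivity
  rcases le_total R W with hRW | hRW
  · have h4 : c₂ * W ≤ c₂ / c * relPsi ψ z zb := by
      refine le_trans (le_of_eq ?_) (mul_le_mul_of_nonneg_left (hh hRW) h3.le)
      field_simp
    have h5 : 0 ≤ c₂ * |R| := by positivity
    nlinarith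
  · have h4 : W ≤ |R| := hRW.trans (le_abs_self R)
    have h5 := mul_le_mul_of_nonneg_left h4 hc₂.le
    have h6 : 0 ≤ c₂ / c * relPsi ψ z zb := by positivity
    nlinarith

/-- Locally the remainder is quadratic because ψ̂ is C³, so that its gradient is C². At infinity the
gradient is O(W), and the two terms based at z̄ grow at most linearly in z. -/
theorem GrowthConditions.exists_taylor_grad_le (hg : GrowthConditions ψ p q r l)
    (hψ : StableFreeEnergy ψ) (hp : 4 ≤ p) (hq : 1 < q) (hr : 1 < r) (hl : 1 < l) {M a : ℝ}
    (ha : 0 < a) :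
    ∃ C, 0 ≤ C ∧ ∀ z : Ext × ℝ, a ≤ z.2 → ∀ zb ∈ Box M a,
      ‖grad ψ z - grad ψ zb - hess ψ zb (z - zb)‖ ≤ C * relPsi ψ z zb := by
  obtain ⟨C, hC, h⟩ := hg.exists_le_relPsi hψ hp hq hr hl (M := M) ha (fun _ => True)
    (fun z zb => ‖grad ψ z - grad ψ zb - hess ψ zb (z - zb)‖) (fun R => by
      obtain ⟨L, -, hL⟩ := exists_taylor_bound_of_contDiffOn isOpen_dom hψ.contDiffOn_grad
        (isCompact_box R a) (convex_box R a) (box_subset_dom ha)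
      exact ⟨L, fun z hz zb hzb _ => hL z hz zb hzb⟩) (by
      obtain ⟨A, R₁, hA, h₁⟩ := hg.exists_norm_grad_le hψ hp
      obtain ⟨B, hB⟩ := (isCompact_box M a).exists_bound_of_continuousOn
        (hψ.contDiffOn_grad.continuousOn.mono (box_subset_dom ha))
      have hH : ContinuousOn (hess ψ) (Box M a) :=
        hψ.contDiffOn_hess.continuousOn.mono (box_subset_dom ha)
      obtain ⟨D, hD⟩ := (isCompact_box M a).exists_bound_of_continuousOn (f := hess ψ) hH
      obtain ⟨E, hE, h₂⟩ := exists_norm_le_weight (p := p) (q := q) (r := r) (l := l)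
        (by linarith) hq hr one_pos
      refine ⟨A + |B| + |D| * (2 + E + |M|), max R₁ 1, fun z hz zb hzb _ hW => ?_⟩
      have g1 := h₁ z hz ((le_max_left _ _).trans hW)
      have g2 := h₂ z.1 z.2 hz
      have g3 := theta_le_one_add_weight (p := p) (q := q) (r := r) hl z.1 hz
      have hW1 := (le_max_right _ _).trans hW
      have hb := mem_box.1 hzb
      generalize weight p q r l z.1 z.2 = W at *
      have n1 : ‖z‖ ≤ W + E + 1 := by
        refine norm_prod_le_iff.2 ⟨by linarith, ?_⟩
        rw [Real.norm_eq_abs, abs_of_pos hz]; linarith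
      have n2 : ‖zb‖ ≤ |M| := by
        refine norm_prod_le_iff.2 ⟨hb.1.trans (le_abs_self M), ?_⟩
        rw [Real.norm_eq_abs, abs_of_pos (ha.trans_le hb.2.1)]
        exact hb.2.2.trans (le_abs_self M)
      have n3 : ‖z - zb‖ ≤ (2 + E + |M|) * W := by
        have := norm_sub_le z zb
        nlinarith [abs_nonneg M]
      have n4 : ‖hess ψ zb (z - zb)‖ ≤ |D| * ((2 + E + |M|) * W) :=
        ((hess ψ zb).le_opNorm _).trans (mul_le_mul ((hD zb hzb).trans (le_abs_self D)) n3
          (norm_nonneg _) (abs_nonneg _))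
      have n5 : ‖grad ψ zb‖ ≤ |B| * W := by
        have := (hB zb hzb).trans (le_abs_self B)
        nlinarith [abs_nonneg B]
      have := norm_sub_le (grad ψ z - grad ψ zb) (hess ψ zb (z - zb))
      have := norm_sub_le (grad ψ z) (grad ψ zb)
      linarith)
  exact ⟨C, hC, fun z hz zb hzb => h z hz zb hzb trivial⟩

theorem exists_lipschitz_dPhi (R : ℝ) :
    ∃ L, 0 ≤ L ∧ ∀ i α, ∀ F Fb : Mat3, ‖F‖ ≤ R → ‖Fb‖ ≤ R →
      ‖dPhi i α F - dPhi i α Fb‖ ≤ L * ‖F - Fb‖ := by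
  have h := fun i α => exists_lipschitz_of_contDiffOn isOpen_univ
    ((contDiff_dPhi i α).contDiffOn.of_le (by simp)) (isCompact_closedBall (0 : Mat3) R)
    (convex_closedBall 0 R) (subset_univ _)
  choose L hL0 hL using h
  refine ⟨∑ i, ∑ α, L i α, Finset.sum_nonneg fun i _ => Finset.sum_nonneg fun α _ => hL0 i α,
    fun i α F Fb hF hFb => ?_⟩
  refine (hL i α F (by simpa using hF) Fb (by simpa using hFb)).trans
    (mul_le_mul_of_nonneg_right ?_ (norm_nonneg _))
  exact (Finset.single_le_sum (f := fun α => L i α) (fun α _ => hL0 i α)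
    (Finset.mem_univ α)).trans (Finset.single_le_sum (f := fun i => ∑ α, L i α)
      (fun i _ => Finset.sum_nonneg fun α _ => hL0 i α) (Finset.mem_univ i))

theorem norm_F_le_of_mem_box {M a : ℝ} {z : Ext × ℝ} (hz : z ∈ Box M a) : ‖z.1.1‖ ≤ M :=
  (norm_fst_le _).trans (mem_box.1 hz).1

theorem norm_F_sub_le (z zb : Ext × ℝ) : ‖z.1.1 - zb.1.1‖ ≤ ‖z - zb‖ :=
  (norm_fst_le (z.1 - zb.1)).trans (norm_fst_le (z - zb))

/-- Locally a product of two Lipschitz differences is quadratic. At infinity ∇ψ̂(z) is tested only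
in a direction with the block growth of ∂Φ, which is what keeps the product O(W); the full norms
would not suffice. -/
theorem GrowthConditions.exists_grad_dPhi_le (hg : GrowthConditions ψ p q r l)
    (hψ : StableFreeEnergy ψ) (hp : 4 ≤ p) (hq : 1 < q) (hr : 1 < r) (hl : 1 < l) {M a : ℝ}
    (ha : 0 < a) :
    ∃ C, 0 ≤ C ∧ ∀ z : Ext × ℝ, a ≤ z.2 → ∀ zb ∈ Box M a, ∀ i α,
      |(grad ψ z - grad ψ zb) (dPhi i α z.1.1 - dPhi i α zb.1.1, 0)| ≤ C * relPsi ψ z zb := by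
  have key := fun i α => hg.exists_le_relPsi hψ hp hq hr hl (M := M) ha (fun _ => True)
    (fun z zb => |(grad ψ z - grad ψ zb) (dPhi i α z.1.1 - dPhi i α zb.1.1, 0)|) (fun R => by
      obtain ⟨L, hL0, hL⟩ := exists_lipschitz_of_contDiffOn isOpen_dom
        (hψ.contDiffOn_grad.of_le (by norm_num)) (isCompact_box R a) (convex_box R a)
        (box_subset_dom ha)
      obtain ⟨L', hL0', hL'⟩ := exists_lipschitz_dPhi R
      refine ⟨L * L', fun z hz zb hzb _ => ?_⟩
      have h1 := (hL' i α z.1.1 zb.1.1 (norm_F_le_of_mem_box hz) (norm_F_le_of_mem_box hzb)).trans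
        (mul_le_mul_of_nonneg_left (norm_F_sub_le z zb) hL0')
      have h2 : ‖((dPhi i α z.1.1 - dPhi i α zb.1.1, 0) : Ext × ℝ)‖ ≤ L' * ‖z - zb‖ := by
        refine norm_prod_le_iff.2 ⟨h1, ?_⟩
        rw [norm_zero]; positivity
      refine (ContinuousLinearMap.le_opNorm _ _).trans ((mul_le_mul (hL z hz zb hzb) h2
        (norm_nonneg _) (by positivity)).trans_eq (by ring))) (by
      obtain ⟨A, R₁, hA, h₁⟩ := hg.exists_grad_xi_le hψ hp
      obtain ⟨B, hB⟩ := (isCompact_box M a).exists_bound_of_continuousOn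
        (hψ.contDiffOn_grad.continuousOn.mono (box_subset_dom ha))
      -- D bounds ∂Φ at every reference state and also the coefficients in the bounds at z, so 2D
      -- serves for their difference.
      set D := 36 * (1 + |M| ^ 2) + 36 with hDdef
      refine ⟨A * (2 * D) + |B| * (4 * D), max R₁ 1, fun z hz zb hzb _ hW => ?_⟩
      have hW1 := (le_max_right _ _).trans hW
      have g1 := h₁ z hz ((le_max_left _ _).trans hW)
      have g2 := rpow_fst_le_weight (p := p) (q := q) (r := r) (l := l) z.1 hz
      have hF0 := norm_nonneg z.1.1
      have hM0 := sq_nonneg |M|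
      have g3 := rpow_le_one_add_rpow hF0 (by norm_num : (0 : ℝ) ≤ 2) (by linarith : (2 : ℝ) ≤ p)
      rw [show (2 : ℝ) = ((2 : ℕ) : ℝ) by norm_num, Real.rpow_natCast] at g3
      have hFb : ‖zb.1.1‖ ^ 2 ≤ |M| ^ 2 :=
        pow_le_pow_left₀ (norm_nonneg _) ((norm_F_le_of_mem_box hzb).trans (le_abs_self M)) 2
      have hb0 : ‖dPhi i α zb.1.1‖ ≤ D := (norm_dPhi_le i α _).trans (by linarith)
      have hb1 : ‖(dPhi i α zb.1.1).1‖ ≤ D := (norm_fst_le _).trans hb0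
      have hb2 : ‖(dPhi i α zb.1.1).2.1‖ ≤ D :=
        (norm_fst_le _).trans ((norm_snd_le (dPhi i α zb.1.1)).trans hb0)
      have hb3 : |(dPhi i α zb.1.1).2.2| ≤ D :=
        (norm_snd_le (dPhi i α zb.1.1).2).trans ((norm_snd_le (dPhi i α zb.1.1)).trans hb0)
      have hD36 : 36 ≤ D := by simp only [hDdef]; nlinarith
      have e1 := g1 (2 * D) (dPhi i α z.1.1 - dPhi i α zb.1.1)
        (by
          refine (norm_sub_le _ _).trans ?_
          rw [norm_dPhi_fst]; linarith)
        (by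
          refine (norm_sub_le _ _).trans ?_
          have := norm_dPhi_snd_le i α z.1.1
          nlinarith)
        (by
          refine (abs_sub _ _).trans ?_
          have := abs_dPhi_trd_le i α z.1.1
          nlinarith [sq_nonneg ‖z.1.1‖])
      have e2 : |grad ψ zb (dPhi i α z.1.1 - dPhi i α zb.1.1, 0)|
          ≤ |B| * (4 * D * weight p q r l z.1 z.2) := by
        refine ((grad ψ zb).le_opNorm _).trans (mul_le_mul ((hB zb hzb).trans (le_abs_self B)) ?_
          (norm_nonneg _) (abs_nonneg _))
        refine norm_prod_le_iff.2 ⟨?_, ?_⟩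
        · refine (norm_sub_le _ _).trans ?_
          have := norm_dPhi_le i α z.1.1
          nlinarith
        · rw [norm_zero]
          have : 0 ≤ D := by linarith
          positivity
      rw [sub_apply]
      refine (abs_sub _ _).trans ?_
      linarith)
  choose C hC h using key
  refine ⟨∑ i, ∑ α, C i α, Finset.sum_nonneg fun i _ => Finset.sum_nonneg fun α _ => hC i α,
    fun z hz zb hzb i α => ?_⟩
  refine (h i α z hz zb hzb trivial).trans (mul_le_mul_of_nonneg_right ?_
    (hψ.relPsi_nonneg (mem_dom.2 (ha.trans_le hz)) (box_subset_dom ha hzb)))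
  exact (Finset.single_le_sum (f := fun α => C i α) (fun α _ => hC i α)
    (Finset.mem_univ α)).trans (Finset.single_le_sum (f := fun i => ∑ α, C i α)
      (fun i _ => Finset.sum_nonneg fun α _ => hC i α) (Finset.mem_univ i))

/-- The full hypothesis p ≥ 4 is used here: the square of ∂Φ grows like |F|⁴, which |F|^p must
dominate. -/
theorem GrowthConditions.exists_dPhi_sq_le (hg : GrowthConditions ψ p q r l)
    (hψ : StableFreeEnergy ψ) (hp : 4 ≤ p) (hq : 1 < q) (hr : 1 < r) (hl : 1 < l) {M a : ℝ}
    (ha : 0 < a) :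
    ∃ C, 0 ≤ C ∧ ∀ z : Ext × ℝ, a ≤ z.2 → ∀ zb ∈ Box M a, ∀ i α,
      ‖dPhi i α z.1.1 - dPhi i α zb.1.1‖ ^ 2 ≤ C * relPsi ψ z zb := by
  have key := fun i α => hg.exists_le_relPsi hψ hp hq hr hl (M := M) ha (fun _ => True)
    (fun z zb => ‖dPhi i α z.1.1 - dPhi i α zb.1.1‖ ^ 2) (fun R => by
      obtain ⟨L', hL0', hL'⟩ := exists_lipschitz_dPhi R
      refine ⟨L' ^ 2, fun z hz zb hzb _ => ?_⟩
      have h1 := (hL' i α z.1.1 zb.1.1 (norm_F_le_of_mem_box hz) (norm_F_le_of_mem_box hzb)).trans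
        (mul_le_mul_of_nonneg_left (norm_F_sub_le z zb) hL0')
      rw [← mul_pow]
      exact pow_le_pow_left₀ (norm_nonneg _) h1 2) (by
      -- From (a + b + c)² ≤ 3(a² + b² + c²) and |F|⁴ ≤ 1 + W, the bracket is 15 + 3W + 3M⁴, at most
      -- (18 + 3M⁴)W when W ≥ 1.
      refine ⟨36 ^ 2 * (18 + 3 * |M| ^ 4), 1, fun z hz zb hzb _ hW => ?_⟩
      have g2 := rpow_fst_le_weight (p := p) (q := q) (r := r) (l := l) z.1 hz
      have g3 := rpow_le_one_add_rpow (norm_nonneg z.1.1) (by norm_num : (0 : ℝ) ≤ 4) hp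
      rw [show (4 : ℝ) = ((4 : ℕ) : ℝ) by norm_num, Real.rpow_natCast] at g3
      have hFb : ‖zb.1.1‖ ^ 4 ≤ |M| ^ 4 :=
        pow_le_pow_left₀ (norm_nonneg _) ((norm_F_le_of_mem_box hzb).trans (le_abs_self M)) 4
      have n : ‖dPhi i α z.1.1 - dPhi i α zb.1.1‖ ≤ 36 * (2 + ‖z.1.1‖ ^ 2 + ‖zb.1.1‖ ^ 2) := by
        refine (norm_sub_le _ _).trans ?_
        have := norm_dPhi_le i α z.1.1
        have := norm_dPhi_le i α zb.1.1
        linarith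
      refine (pow_le_pow_left₀ (norm_nonneg _) n 2).trans ?_
      have s : (2 + ‖z.1.1‖ ^ 2 + ‖zb.1.1‖ ^ 2) ^ 2
          ≤ 3 * (4 + ‖z.1.1‖ ^ 4 + ‖zb.1.1‖ ^ 4) := by
        nlinarith [sq_nonneg (2 - ‖z.1.1‖ ^ 2), sq_nonneg (2 - ‖zb.1.1‖ ^ 2),
          sq_nonneg (‖z.1.1‖ ^ 2 - ‖zb.1.1‖ ^ 2)]
      have hM : 0 ≤ |M| ^ 4 := by positivity
      rw [mul_pow, mul_assoc]
      refine mul_le_mul_of_nonneg_left (s.trans ?_) (by norm_num)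
      nlinarith)
  choose C hC h using key
  refine ⟨∑ i, ∑ α, C i α, Finset.sum_nonneg fun i _ => Finset.sum_nonneg fun α _ => hC i α,
    fun z hz zb hzb i α => ?_⟩
  refine (h i α z hz zb hzb trivial).trans (mul_le_mul_of_nonneg_right ?_
    (hψ.relPsi_nonneg (mem_dom.2 (ha.trans_le hz)) (box_subset_dom ha hzb)))
  exact (Finset.single_le_sum (f := fun α => C i α) (fun α _ => hC i α)
    (Finset.mem_univ α)).trans (Finset.single_le_sum (f := fun i => ∑ α, C i α)
      (fun i _ => Finset.sum_nonneg fun α _ => hC i α) (Finset.mem_univ i))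

/-- The conductivity as a function on `ℝ¹⁹ × (0, ∞)`. -/
def conductivity (k : Mat3 → ℝ → ℝ) (z : Ext × ℝ) : ℝ := k z.1.1 z.2

theorem IsConductivity.contDiffOn {k : Mat3 → ℝ → ℝ} (hk : IsConductivity k) :
    ContDiffOn ℝ 1 (conductivity k) Dom := by
  have h : ContDiff ℝ 1 (fun z : Ext × ℝ => (z.1.1, z.2)) := by fun_prop
  exact hk.1.comp (s := Dom) (f := fun z : Ext × ℝ => (z.1.1, z.2)) h.contDiffOn
    fun z hz => ⟨mem_univ _, mem_dom.1 hz⟩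

/-- The numerator vanishes at the reference state and k is bounded below on compact sets, so the
quotient is locally quadratic. At infinity it is at most 2(k̄² θ²/k + θ̄² k), which the thermal
hypothesis bounds by a multiple of ê, hence of W. -/
theorem GrowthConditions.exists_heat_defect_le (hg : GrowthConditions ψ p q r l)
    (hψ : StableFreeEnergy ψ) (hp : 4 ≤ p) (hq : 1 < q) (hr : 1 < r) (hl : 1 < l) {M a : ℝ}
    (ha : 0 < a) {k : Mat3 → ℝ → ℝ} (hk : IsConductivity k) {C₀ : ℝ} (hC₀ : 0 < C₀) :
    ∃ C, 0 ≤ C ∧ ∀ z : Ext × ℝ, a ≤ z.2 → ∀ zb ∈ Box M a,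
      conductivity k z + z.2 ^ 2 / conductivity k z ≤ C₀ * energy ψ z.1 z.2 →
      (z.2 * conductivity k zb - zb.2 * conductivity k z) ^ 2 / conductivity k z
        ≤ C * relPsi ψ z zb := by
  refine hg.exists_le_relPsi hψ hp hq hr hl (M := M) ha
    (fun z => conductivity k z + z.2 ^ 2 / conductivity k z ≤ C₀ * energy ψ z.1 z.2)
    (fun z zb => (z.2 * conductivity k zb - zb.2 * conductivity k z) ^ 2 / conductivity k z)
    (fun R => ?_) ?_
  · obtain ⟨L, hL0, hL⟩ := exists_lipschitz_of_contDiffOn isOpen_dom hk.contDiffOn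
      (isCompact_box R a) (convex_box R a) (box_subset_dom ha)
    obtain ⟨B, hB⟩ := (isCompact_box R a).exists_bound_of_continuousOn
      (hk.contDiffOn.continuousOn.mono (box_subset_dom ha))
    obtain ⟨κ, hκ, hκ'⟩ := (isCompact_box R a).exists_forall_le' (a := 0)
      (hk.contDiffOn.continuousOn.mono (box_subset_dom ha))
      (fun z hz => hk.2 _ _ (mem_dom.1 (box_subset_dom ha hz)))
    refine ⟨(|R| * L + |B|) ^ 2 / κ, fun z hz zb hzb _ => ?_⟩
    have hz' := mem_box.1 hz
    have hz0 : 0 < z.2 := ha.trans_le hz'.2.1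
    have h1 : |z.2 * conductivity k zb - zb.2 * conductivity k z|
        ≤ (|R| * L + |B|) * ‖z - zb‖ := by
      have e : z.2 * conductivity k zb - zb.2 * conductivity k z
          = conductivity k z * (z.2 - zb.2) - z.2 * (conductivity k z - conductivity k zb) := by
        ring
      rw [e]
      refine (abs_sub _ _).trans ?_
      rw [abs_mul, abs_mul]
      have a1 : |conductivity k z| * |z.2 - zb.2| ≤ |B| * ‖z - zb‖ :=
        mul_le_mul ((hB z hz).trans (le_abs_self B)) (norm_snd_le (z - zb)) (abs_nonneg _)
          (abs_nonneg _)
      have a2 : |z.2| * |conductivity k z - conductivity k zb| ≤ |R| * (L * ‖z - zb‖) := by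
        refine mul_le_mul ?_ (hL z hz zb hzb) (abs_nonneg _) (abs_nonneg _)
        rw [abs_of_pos hz0]; exact hz'.2.2.trans (le_abs_self R)
      linarith
    have h2 := pow_le_pow_left₀ (abs_nonneg _) h1 2
    rw [sq_abs] at h2
    refine (div_le_div₀ (sq_nonneg _) h2 hκ (hκ' z hz)).trans_eq ?_
    ring
  · obtain ⟨c₁, c₂, hc₁, hc₂, he⟩ := hg.energy_growth
    obtain ⟨B, hB⟩ := (isCompact_box M a).exists_bound_of_continuousOn
      (hk.contDiffOn.continuousOn.mono (box_subset_dom ha))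
    refine ⟨2 * (|B| ^ 2 + |M| ^ 2) * (C₀ * (2 * c₂)), 1, fun z hz zb hzb hP hW => ?_⟩
    have hb := mem_box.1 hzb
    have hkz : 0 < conductivity k z := hk.2 _ _ hz
    have e1 := (he z.1 z.2 hz).2
    generalize weight p q r l z.1 z.2 = W at *
    have e2 : C₀ * energy ψ z.1 z.2 ≤ C₀ * (2 * c₂) * W := by
      rw [mul_assoc]
      exact mul_le_mul_of_nonneg_left (by nlinarith) hC₀.le
    have b1 : conductivity k zb ^ 2 ≤ |B| ^ 2 := by
      rw [← sq_abs]
      exact pow_le_pow_left₀ (abs_nonneg _) ((hB zb hzb).trans (le_abs_self B)) 2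
    have b2 : zb.2 ^ 2 ≤ |M| ^ 2 :=
      pow_le_pow_left₀ (ha.le.trans hb.2.1) (hb.2.2.trans (le_abs_self M)) 2
    have q0 : 0 ≤ z.2 ^ 2 / conductivity k z := by positivity
    have e3 : (z.2 * conductivity k zb - zb.2 * conductivity k z) ^ 2 / conductivity k z
        ≤ 2 * (conductivity k zb ^ 2 * (z.2 ^ 2 / conductivity k z)
          + zb.2 ^ 2 * conductivity k z) := by
      rw [div_le_iff₀ hkz]
      have : 2 * (conductivity k zb ^ 2 * (z.2 ^ 2 / conductivity k z)
          + zb.2 ^ 2 * conductivity k z) * conductivity k z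
          = 2 * ((z.2 * conductivity k zb) ^ 2 + (zb.2 * conductivity k z) ^ 2) := by
        field_simp
      rw [this]
      nlinarith [sq_nonneg (z.2 * conductivity k zb + zb.2 * conductivity k z)]
    have m1 := mul_le_mul_of_nonneg_right b1 q0
    have m2 := mul_le_mul_of_nonneg_right b2 hkz.le
    have m3 : 0 ≤ |B| ^ 2 * conductivity k z := by positivity
    have m4 : 0 ≤ |M| ^ 2 * (z.2 ^ 2 / conductivity k z) := by positivity
    have m5 := mul_le_mul_of_nonneg_left (hP.trans e2) (by positivity : 0 ≤ |B| ^ 2 + |M| ^ 2)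
    linarith

end Thermo

namespace Thermo

/-! ### Space-time fields of class `C¹` -/

section Fields

variable {E G : Type*} [NormedAddCommGroup E] [NormedSpace ℝ E]
  [NormedAddCommGroup G] [NormedSpace ℝ G]

/-- `f` is of class `C¹` on `[0, T] × ℝ³`. -/
def FieldC1 (T : ℝ) (f : ℝ → Pt → E) : Prop :=
  ContDiffOn ℝ 1 (fun z : ℝ × Pt => f z.1 z.2) (Icc 0 T ×ˢ univ)

/-- The space-time derivative of a field on `[0, T] × ℝ³`. -/
noncomputable def stDeriv (T : ℝ) (f : ℝ → Pt → E) (z : ℝ × Pt) : ℝ × Pt →L[ℝ] E :=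
  fderivWithin ℝ (fun z : ℝ × Pt => f z.1 z.2) (Icc 0 T ×ˢ univ) z

variable {T t : ℝ} {f : ℝ → Pt → E} {x : Pt}

theorem FieldC1.continuousOn_stDeriv (hf : FieldC1 T f) (hT : 0 < T) :
    ContinuousOn (stDeriv T f) (Icc 0 T ×ˢ univ) :=
  ContDiffOn.continuousOn_fderivWithin hf ((uniqueDiffOn_Icc hT).prod uniqueDiffOn_univ) le_rfl

theorem FieldC1.hasFDerivWithinAt (hf : FieldC1 T f) (ht : t ∈ Icc 0 T) (x : Pt) :
    HasFDerivWithinAt (fun z : ℝ × Pt => f z.1 z.2) (stDeriv T f (t, x)) (Icc 0 T ×ˢ univ)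
      (t, x) :=
  (ContDiffOn.differentiableOn hf one_ne_zero (t, x) ⟨ht, mem_univ x⟩).hasFDerivWithinAt

theorem FieldC1.hasFDerivAt_slice (hf : FieldC1 T f) (ht : t ∈ Icc 0 T) (x : Pt) :
    HasFDerivAt (f t) ((stDeriv T f (t, x)).comp (ContinuousLinearMap.inr ℝ ℝ Pt)) x := by
  rw [← hasFDerivWithinAt_univ]
  exact HasFDerivWithinAt.comp (f := fun y => (t, y)) x (hf.hasFDerivWithinAt ht x)
    (hasFDerivAt_prodMk_right t x).hasFDerivWithinAt fun y _ => ⟨ht, mem_univ y⟩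

theorem FieldC1.hasDerivAt_time (hf : FieldC1 T f) (ht : t ∈ Ioo 0 T) (x : Pt) :
    HasDerivAt (fun s => f s x) (stDeriv T f (t, x) (1, 0)) t := by
  have h := (hf.hasFDerivWithinAt (Ioo_subset_Icc_self ht) x).hasFDerivAt
    (prod_mem_nhds (Icc_mem_nhds ht.1 ht.2) univ_mem)
  exact HasFDerivAt.comp_hasDerivAt (f := fun s => (s, x)) t h
    ((hasDerivAt_id t).prodMk (hasDerivAt_const t x))

theorem FieldC1.pd_eq (hf : FieldC1 T f) (ht : t ∈ Icc 0 T) (α : Fin 3) (x : Pt) :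
    pd α (f t) x = stDeriv T f (t, x) (0, Pi.single α 1) := by
  rw [pd, (hf.hasFDerivAt_slice ht x).fderiv]; rfl

theorem FieldC1.contDiff_slice (hf : FieldC1 T f) (ht : t ∈ Icc 0 T) : ContDiff ℝ 1 (f t) := by
  rw [← contDiffOn_univ]
  exact ContDiffOn.comp (f := fun y : Pt => (t, y)) hf
    (contDiff_const.prodMk contDiff_id).contDiffOn fun y _ => ⟨ht, mem_univ y⟩

/-- Compactness of [0, T] times the closed period cell; a bound there suffices because every
integral is taken over that cell. -/
theorem FieldC1.exists_bound (hf : FieldC1 T f) (hT : 0 < T) :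
    ∃ N, 0 ≤ N ∧ ∀ t ∈ Icc 0 T, ∀ x ∈ Icc (0 : Pt) 1, (∀ α, ‖pd α (f t) x‖ ≤ N) ∧
      ‖stDeriv T f (t, x) (1, 0)‖ ≤ N := by
  obtain ⟨N, hN⟩ := (isCompact_Icc.prod isCompact_Icc).exists_bound_of_continuousOn
    ((hf.continuousOn_stDeriv hT).mono
      (prod_mono_right (subset_univ (Icc (0 : Pt) 1))))
  refine ⟨max N 0, le_max_right _ _, fun t ht x hx => ?_⟩
  have h1 : ∀ v : ℝ × Pt, ‖v‖ ≤ 1 → ‖stDeriv T f (t, x) v‖ ≤ max N 0 := fun v hv => by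
    refine ((stDeriv T f (t, x)).le_opNorm v).trans ?_
    refine (mul_le_mul ((hN (t, x) ⟨ht, hx⟩).trans (le_max_left _ _)) hv (norm_nonneg _)
      (le_max_right _ _)).trans_eq (mul_one _)
  refine ⟨fun α => ?_, h1 _ (by simp)⟩
  rw [hf.pd_eq ht]
  refine h1 _ (norm_prod_le_iff.2 ⟨by simp, ?_⟩)
  simp only [Pi.norm_single, norm_one, le_refl]

theorem pdt_eq {g : ℝ → E} {g' : E} (ht : t ∈ Ioo 0 T) (hg : HasDerivAt g g' t) :
    pdt T g t = g' := by
  rw [pdt, derivWithin_of_mem_nhds (Icc_mem_nhds ht.1 ht.2), hg.deriv]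

theorem pd_comp {g : Pt → E} {h : E → G} {h' : E →L[ℝ] G} (hg : DifferentiableAt ℝ g x)
    (hh : HasFDerivAt h h' (g x)) (α : Fin 3) : pd α (fun y => h (g y)) x = h' (pd α g x) := by
  have h : HasFDerivAt (fun y => h (g y)) _ x := hh.comp x hg.hasFDerivAt
  rw [pd, h.fderiv]; rfl

theorem pd_clm_comp {g : Pt → E} (L : E →L[ℝ] G) (hg : DifferentiableAt ℝ g x) (α : Fin 3) :
    pd α (fun y => L (g y)) x = L (pd α g x) :=
  pd_comp hg L.hasFDerivAt α

theorem pd_add {g h : Pt → E} (hg : DifferentiableAt ℝ g x) (hh : DifferentiableAt ℝ h x)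
    (α : Fin 3) : pd α (fun y => g y + h y) x = pd α g x + pd α h x := by
  have h : HasFDerivAt (fun y => g y + h y) _ x := hg.hasFDerivAt.add hh.hasFDerivAt
  rw [pd, h.fderiv]; rfl

theorem pd_sub {g h : Pt → E} (hg : DifferentiableAt ℝ g x) (hh : DifferentiableAt ℝ h x)
    (α : Fin 3) : pd α (fun y => g y - h y) x = pd α g x - pd α h x := by
  have h : HasFDerivAt (fun y => g y - h y) _ x := hg.hasFDerivAt.sub hh.hasFDerivAt
  rw [pd, h.fderiv]; rfl

theorem pd_sum {ι : Type*} (s : Finset ι) {g : ι → Pt → E}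
    (hg : ∀ i ∈ s, DifferentiableAt ℝ (g i) x) (α : Fin 3) :
    pd α (fun y => ∑ i ∈ s, g i y) x = ∑ i ∈ s, pd α (g i) x := by
  have h := HasFDerivAt.fun_sum fun i hi => (hg i hi).hasFDerivAt
  rw [pd, h.fderiv]
  simp [pd]

theorem pd_smul {c : Pt → ℝ} {g : Pt → E} (hc : DifferentiableAt ℝ c x)
    (hg : DifferentiableAt ℝ g x) (α : Fin 3) :
    pd α (fun y => c y • g y) x = pd α c x • g x + c x • pd α g x := by
  have h : HasFDerivAt (fun y => c y • g y) _ x := hc.hasFDerivAt.smul hg.hasFDerivAt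
  rw [pd, h.fderiv]
  simp [pd, add_comm]

theorem pd_mul {c g : Pt → ℝ} (hc : DifferentiableAt ℝ c x)
    (hg : DifferentiableAt ℝ g x) (α : Fin 3) :
    pd α (fun y => c y * g y) x = pd α c x * g x + c x * pd α g x :=
  pd_smul hc hg α

theorem pd_div {c g : Pt → ℝ} (hc : DifferentiableAt ℝ c x)
    (hg : DifferentiableAt ℝ g x) (h0 : g x ≠ 0) (α : Fin 3) :
    pd α (fun y => c y / g y) x = pd α c x / g x - c x * pd α g x / g x ^ 2 := by
  have h : HasFDerivAt (fun y => c y * (g y)⁻¹) _ x :=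
    hc.hasFDerivAt.mul ((hasFDerivAt_inv h0).comp x hg.hasFDerivAt)
  simp only [div_eq_mul_inv]
  rw [pd, h.fderiv]
  simp [pd]
  ring

end Fields

/-! ### The divergence theorem on the torus -/

theorem insertNth_one_eq {n : ℕ} (i : Fin (n + 1)) (y : Fin n → ℝ) :
    i.insertNth (1 : ℝ) y = (i.insertNth (0 : ℝ) y : Fin (n + 1) → ℝ) + Pi.single i 1 := by
  funext j
  refine Fin.succAboveCases i ?_ (fun j => ?_) j
  · simp
  · simp

/-- Opposite faces of the cell differ by a unit shift, so by periodicity their boundary integrals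
cancel in pairs. -/
theorem integral_div_eq_zero {J : Fin 3 → Pt → ℝ} (hJ : ∀ α, ContDiff ℝ 1 (J α))
    (hper : ∀ α x j, J α (x + Pi.single j 1) = J α x) :
    ∫ x in Icc (0 : Pt) 1, ∑ α, pd α (J α) x = 0 := by
  have hcont : Continuous fun x => ∑ α, pd α (J α) x :=
    continuous_finsetSum _ fun α _ =>
      ((hJ α).continuous_fderiv one_ne_zero).clm_apply continuous_const
  have h := integral_divergence_of_hasFDerivAt_off_countable' (E := ℝ) (0 : Pt) 1
    (zero_le_one) J (fun α x => fderiv ℝ (J α) x) ∅ countable_empty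
    (fun α => (hJ α).continuous.continuousOn)
    (fun x _ α => ((hJ α).differentiable one_ne_zero x).hasFDerivAt)
    (hcont.continuousOn.integrableOn_compact isCompact_Icc)
  simp only [pd]
  rw [h]
  refine Finset.sum_eq_zero fun α _ => ?_
  rw [sub_eq_zero]
  congr 1
  funext y
  rw [Pi.one_apply, Pi.zero_apply, insertNth_one_eq, hper]

theorem pd_periodic {E : Type*} [NormedAddCommGroup E] [NormedSpace ℝ E] {f : Pt → E}
    {j : Fin 3} (hf : ∀ x, f (x + Pi.single j 1) = f x) (α : Fin 3) (x : Pt) :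
    pd α f (x + Pi.single j 1) = pd α f x := by
  have h : (fun y => f (y + Pi.single j 1)) = f := funext hf
  rw [pd, pd, ← fderiv_comp_add_right, h]

end Thermo

namespace Thermo

/-! ### Projections of the state -/

/-- The thermodynamic part `(ξ, θ)` of a state. -/
noncomputable def projZ : State →L[ℝ] Ext × ℝ :=
  (ContinuousLinearMap.fst ℝ Ext (Vec3 × ℝ)).prod
    ((ContinuousLinearMap.snd ℝ Vec3 ℝ).comp (ContinuousLinearMap.snd ℝ Ext (Vec3 × ℝ)))

/-- The temperature of a state. -/
noncomputable def projTh : State →L[ℝ] ℝ :=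
  (ContinuousLinearMap.snd ℝ Vec3 ℝ).comp (ContinuousLinearMap.snd ℝ Ext (Vec3 × ℝ))

/-- The deformation gradient of a state. -/
noncomputable def projF : State →L[ℝ] Mat3 :=
  (ContinuousLinearMap.fst ℝ Mat3 (Mat3 × ℝ)).comp (ContinuousLinearMap.fst ℝ Ext (Vec3 × ℝ))

/-- The velocity of a state. -/
noncomputable def projVel : State →L[ℝ] Vec3 :=
  (ContinuousLinearMap.fst ℝ Vec3 ℝ).comp (ContinuousLinearMap.snd ℝ Ext (Vec3 × ℝ))

/-- A component of the velocity of a state. -/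
noncomputable def projV (i : Fin 3) : State →L[ℝ] ℝ :=
  (EuclideanSpace.proj i : Vec3 →L[ℝ] ℝ).comp projVel

theorem projZ_apply (u : State) : projZ u = (u.1, u.2.2) := rfl

theorem projZ_mem_dom {u : State} (h : 0 < u.th) : projZ u ∈ Dom := mem_dom.2 h

variable {ψ : Ext → ℝ → ℝ} {A B : Pt → State} {x : Pt}

theorem pd_v (hA : ContDiff ℝ 1 A) (i α : Fin 3) :
    pd α (fun y => (A y).v i) x = (pd α A x).2.1 i :=
  pd_clm_comp (projV i) (hA.differentiable one_ne_zero x) α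

theorem pd_th (hA : ContDiff ℝ 1 A) (α : Fin 3) :
    pd α (fun y => (A y).th) x = (pd α A x).2.2 :=
  pd_clm_comp projTh (hA.differentiable one_ne_zero x) α

theorem pd_F (hA : ContDiff ℝ 1 A) (b : Fin 3 × Fin 3) (α : Fin 3) :
    pd α (fun y => (A y).F b) x = (pd α A x).1.1 b :=
  pd_clm_comp ((EuclideanSpace.proj b : Mat3 →L[ℝ] ℝ).comp projF)
    (hA.differentiable one_ne_zero x) α

theorem contDiff_v (hA : ContDiff ℝ 1 A) (i : Fin 3) : ContDiff ℝ 1 fun y => (A y).v i :=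
  (projV i).contDiff.comp hA

theorem contDiff_th (hA : ContDiff ℝ 1 A) : ContDiff ℝ 1 fun y => (A y).th :=
  projTh.contDiff.comp hA

theorem contDiff_dPhi_comp (hA : ContDiff ℝ 1 A) (i α : Fin 3) :
    ContDiff ℝ 1 fun y => dPhi i α (A y).F :=
  ((contDiff_dPhi i α).of_le (by simp)).comp (projF.contDiff.comp hA)

theorem pd_dPhi (hA : ContDiff ℝ 1 A) (i α β : Fin 3) :
    pd β (fun y => dPhi i α (A y).F) x = fderiv ℝ (dPhi i α) (A x).F (pd β A x).1.1 :=
  pd_comp (h := fun u : State => dPhi i α u.F) (hA.differentiable one_ne_zero x)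
    (h' := (fderiv ℝ (dPhi i α) (A x).F).comp projF)
    (((contDiff_dPhi i α).differentiable (by simp) _).hasFDerivAt.comp _ projF.hasFDerivAt) β

theorem StableFreeEnergy.contDiff_grad_comp (hψ : StableFreeEnergy ψ) (hA : ContDiff ℝ 1 A)
    (hpos : ∀ y, 0 < (A y).th) : ContDiff ℝ 1 fun y => grad ψ (projZ (A y)) :=
  (hψ.contDiffOn_grad.of_le (by norm_num)).comp_contDiff (projZ.contDiff.comp hA)
    fun y => projZ_mem_dom (hpos y)

theorem StableFreeEnergy.pd_grad (hψ : StableFreeEnergy ψ) (hA : ContDiff ℝ 1 A)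
    (hpos : ∀ y, 0 < (A y).th) (α : Fin 3) :
    pd α (fun y => grad ψ (projZ (A y))) x = hess ψ (projZ (A x)) (projZ (pd α A x)) :=
  pd_comp (h := fun u : State => grad ψ (projZ u)) (hA.differentiable one_ne_zero x)
    (h' := (hess ψ (projZ (A x))).comp projZ)
    ((hψ.hasFDerivAt_grad (projZ_mem_dom (hpos x))).comp _ projZ.hasFDerivAt) α

theorem StableFreeEnergy.contDiff_grad_dPhi (hψ : StableFreeEnergy ψ) (hA : ContDiff ℝ 1 A)
    (hB : ContDiff ℝ 1 B) (hpos : ∀ y, 0 < (A y).th) (i α : Fin 3) :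
    ContDiff ℝ 1 fun y => grad ψ (projZ (A y)) (dPhi i α (B y).F, 0) :=
  (hψ.contDiff_grad_comp hA hpos).clm_apply ((contDiff_dPhi_comp hB i α).prodMk contDiff_const)

theorem pd_clm_apply {E : Type*} [NormedAddCommGroup E] [NormedSpace ℝ E] {L : Pt → E →L[ℝ] ℝ}
    {h : Pt → E} (hL : DifferentiableAt ℝ L x) (hh : DifferentiableAt ℝ h x) (α : Fin 3) :
    pd α (fun y => L y (h y)) x = pd α L x (h x) + L x (pd α h x) := by
  have H : HasFDerivAt (fun y => L y (h y)) _ x := hL.hasFDerivAt.clm_apply hh.hasFDerivAt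
  rw [pd, H.fderiv]
  simp [pd, add_comm]

theorem pd_prodMk_zero {h : Pt → Ext} (hh : DifferentiableAt ℝ h x) (α : Fin 3) :
    pd α (fun y => ((h y, 0) : Ext × ℝ)) x = (pd α h x, 0) :=
  pd_clm_comp (ContinuousLinearMap.inl ℝ Ext ℝ) hh α

/-- The gradient and the deformation may belong to different solutions: the relative flux contains
∇ψ̂ at Ū contracted with ∂Φ at F. -/
theorem StableFreeEnergy.pd_grad_dPhi (hψ : StableFreeEnergy ψ) (hA : ContDiff ℝ 1 A)
    (hB : ContDiff ℝ 1 B) (hpos : ∀ y, 0 < (A y).th) (i α : Fin 3) :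
    pd α (fun y => grad ψ (projZ (A y)) (dPhi i α (B y).F, 0)) x
      = hess ψ (projZ (A x)) (projZ (pd α A x)) (dPhi i α (B x).F, 0)
        + grad ψ (projZ (A x)) (fderiv ℝ (dPhi i α) (B x).F (pd α B x).1.1, 0) := by
  have h1 := (hψ.contDiff_grad_comp hA hpos).differentiable one_ne_zero x
  have h2 := (contDiff_dPhi_comp hB i α).differentiable one_ne_zero x
  rw [pd_clm_apply h1 (h2.prodMk (differentiableAt_const 0)), hψ.pd_grad hA hpos,
    pd_prodMk_zero h2, pd_dPhi hB]

/-- By the null-Lagrangian identity only the gradient factor is differentiated. -/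
theorem StableFreeEnergy.sum_pd_grad_dPhi (hψ : StableFreeEnergy ψ) (hA : ContDiff ℝ 1 A)
    (hB : ContDiff ℝ 1 B) (hpos : ∀ y, 0 < (A y).th)
    (hcompat : ∀ i α β, (pd α B x).1.1 (i, β) = (pd β B x).1.1 (i, α)) (i : Fin 3) :
    ∑ α, pd α (fun y => grad ψ (projZ (A y)) (dPhi i α (B y).F, 0)) x
      = ∑ α, hess ψ (projZ (A x)) (projZ (pd α A x)) (dPhi i α (B x).F, 0) := by
  simp only [hψ.pd_grad_dPhi hA hB hpos, Finset.sum_add_distrib]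
  rw [add_eq_left]
  have h := sum_fderiv_dPhi_eq_zero (B x).F (fun α => (pd α B x).1.1) hcompat i
  have h' : ∑ α, grad ψ (projZ (A x)) (fderiv ℝ (dPhi i α) (B x).F (pd α B x).1.1, 0)
      = ((grad ψ (projZ (A x))).comp (ContinuousLinearMap.inl ℝ Ext ℝ))
        (∑ α, fderiv ℝ (dPhi i α) (B x).F (pd α B x).1.1) := by
    rw [map_sum]; rfl
  rw [h', h, map_zero]

theorem StableFreeEnergy.stress_eq (hψ : StableFreeEnergy ψ) {u : State} (hu : 0 < u.th)
    (i α : Fin 3) : stress ψ u i α = grad ψ (projZ u) (dPhi i α u.F, 0) := by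
  rw [stress, hψ.psiXi_eq _ hu]; rfl

/-! ### The equations in terms of first derivatives of the state -/

variable {μ k : Mat3 → ℝ → ℝ} {T t : ℝ} {U : ℝ → Pt → State}

theorem SpaceC1.contDiff {g : ℝ → Pt → ℝ} (hg : SpaceC1 T g) (ht : t ∈ Icc 0 T) :
    ContDiff ℝ 1 (g t) := by
  rw [contDiff_one_iff_fderiv]
  refine ⟨hg.1 t ht, ?_⟩
  rw [← continuousOn_univ]
  exact ContinuousOn.comp (f := fun y : Pt => (t, y)) hg.2 (by fun_prop)
    fun y _ => ⟨ht, mem_univ y⟩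

theorem IsStrongSolution.contDiff_slice (hU : IsStrongSolution ψ μ k T U) (ht : t ∈ Icc 0 T) :
    ContDiff ℝ 1 (U t) :=
  FieldC1.contDiff_slice hU.regular ht

theorem IsStrongSolution.pd_F_symm (hU : IsStrongSolution ψ μ k T U) (ht : t ∈ Icc 0 T)
    (x : Pt) (i α β : Fin 3) : (pd α (U t) x).1.1 (i, β) = (pd β (U t) x).1.1 (i, α) := by
  rw [← pd_F (hU.contDiff_slice ht), ← pd_F (hU.contDiff_slice ht)]
  exact hU.compatibility t ht x i α β

theorem IsStrongSolution.contDiff_stress (hU : IsStrongSolution ψ μ k T U)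
    (hψ : StableFreeEnergy ψ) (ht : t ∈ Icc 0 T) (i α : Fin 3) :
    ContDiff ℝ 1 fun y => stress ψ (U t y) i α := by
  have h := hψ.contDiff_grad_dPhi (hU.contDiff_slice ht) (hU.contDiff_slice ht)
    (hU.temp_pos t ht) i α
  simpa only [hψ.stress_eq (hU.temp_pos t ht _)] using h

/-- Expanding the divergence, the terms in which ∂Φ is differentiated vanish by the Piola identity.
-/
theorem IsStrongSolution.time_xi (hU : IsStrongSolution ψ μ k T U) (ht : t ∈ Ioo 0 T) (x : Pt) :
    (stDeriv T U (t, x) (1, 0)).1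
      = ∑ α, ∑ i, (pd α (U t) x).2.1 i • dPhi i α (U t x).F := by
  have ht' := Ioo_subset_Icc_self ht
  have hC := hU.contDiff_slice ht'
  have h1 := hU.kinematics t ht' x
  have h2 : HasDerivAt (fun s => (U s x).xi) (stDeriv T U (t, x) (1, 0)).1 t :=
    (ContinuousLinearMap.fst ℝ Ext (Vec3 × ℝ)).hasFDerivAt.comp_hasDerivAt t
      (FieldC1.hasDerivAt_time hU.regular ht x)
  rw [pdt_eq ht h2, sub_eq_zero] at h1
  rw [h1]
  have h3 : ∀ i α, DifferentiableAt ℝ (fun y => (U t y).v i • dPhi i α (U t y).F) x :=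
    fun i α => ((contDiff_v hC i).smul (contDiff_dPhi_comp hC i α)).differentiable one_ne_zero x
  have h4 : ∀ α, pd α (fun y => ∑ i, (U t y).v i • dPhi i α (U t y).F) x
      = ∑ i, (pd α (U t) x).2.1 i • dPhi i α (U t x).F
        + ∑ i, (U t x).v i • fderiv ℝ (dPhi i α) (U t x).F (pd α (U t) x).1.1 := fun α => by
    rw [pd_sum _ fun i _ => h3 i α, ← Finset.sum_add_distrib]
    refine Finset.sum_congr rfl fun i _ => ?_
    rw [pd_smul ((contDiff_v hC i).differentiable one_ne_zero x)
      ((contDiff_dPhi_comp hC i α).differentiable one_ne_zero x), pd_v hC, pd_dPhi hC]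
  simp only [h4, Finset.sum_add_distrib]
  rw [add_eq_left, Finset.sum_comm]
  refine Finset.sum_eq_zero fun i _ => ?_
  rw [← Finset.smul_sum, sum_fderiv_dPhi_eq_zero _ _ (hU.pd_F_symm ht' x), smul_zero]

theorem hasDerivAt_v {u : ℝ → State} {u' : State} (hu : HasDerivAt u u' t) (i : Fin 3) :
    HasDerivAt (fun s => (u s).v i) (u'.2.1 i) t :=
  (projV i).hasFDerivAt.comp_hasDerivAt t hu

theorem IsStrongSolution.time_v (hU : IsStrongSolution ψ μ k T U) (ht : t ∈ Ioo 0 T) (x : Pt)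
    (i : Fin 3) :
    (stDeriv T U (t, x) (1, 0)).2.1 i = ∑ α, pd α (fun y => stress ψ (U t y) i α) x
      + ∑ α, pd α (viscousStress μ U i α t) x := by
  have h1 := hU.momentum t (Ioo_subset_Icc_self ht) x i
  rw [pdt_eq ht (hasDerivAt_v (FieldC1.hasDerivAt_time hU.regular ht x) i)] at h1
  linarith

theorem hasDerivAt_half_norm_sq {v : ℝ → Vec3} {v' : Vec3} (hv : HasDerivAt v v' t) :
    HasDerivAt (fun s => 1 / 2 * ‖v s‖ ^ 2) (∑ i, v t i * v' i) t := by
  have h := (hv.norm_sq).const_mul (1 / 2 : ℝ)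
  refine h.congr_deriv ?_
  simp only [PiLp.inner_apply, RCLike.inner_apply, conj_trivial]
  rw [← mul_assoc]
  norm_num
  exact Finset.sum_congr rfl fun i _ => mul_comm _ _

/-- The two terms with ∂_tθ ∂_θψ̂ cancel, which leaves ∂_ξψ̂·∂_tξ + θ ∂_tη̂. -/
theorem StableFreeEnergy.hasDerivAt_energy (hψ : StableFreeEnergy ψ) {u : ℝ → State} {u' : State}
    (hu : HasDerivAt u u' t) (hpos : ∀ᶠ s in 𝓝 t, 0 < (u s).th) :
    HasDerivAt (fun s => energy ψ (u s).xi (u s).th)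
      (grad ψ (projZ (u t)) (u'.1, 0) - (u t).th * hess ψ (projZ (u t)) (projZ u') (0, 1)) t := by
  have hz : HasDerivAt (fun s => projZ (u s)) (projZ u') t :=
    projZ.hasFDerivAt.comp_hasDerivAt t hu
  have hth : HasDerivAt (fun s => (u s).th) u'.2.2 t := projTh.hasFDerivAt.comp_hasDerivAt t hu
  have hdom := projZ_mem_dom hpos.self_of_nhds
  have h1 : HasDerivAt (fun s => freeEnergy ψ (projZ (u s))) _ t :=
    HasFDerivAt.comp_hasDerivAt (f := fun s => projZ (u s)) t (hψ.hasFDerivAt_freeEnergy hdom) hz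
  have h2 : HasDerivAt (fun s => (u s).th * grad ψ (projZ (u s)) (0, 1)) _ t := hth.mul
    (hasDerivAt_clm_comp_apply (γ := fun s => projZ (u s)) (h := (0, 1))
      (hψ.hasFDerivAt_grad hdom) hz)
  have h3 : HasDerivAt (fun s => freeEnergy ψ (projZ (u s))
      - (u s).th * grad ψ (projZ (u s)) (0, 1)) _ t := h1.sub h2
  refine (h3.congr_of_eventuallyEq ?_).congr_deriv ?_
  · filter_upwards [hpos] with s hs
    exact hψ.energy_eq _ hs
  · have e : projZ u' = (u'.1, 0) + u'.2.2 • ((0 : Ext), (1 : ℝ)) := by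
      rw [projZ_apply]; ext <;> simp
    have e' : grad ψ (projZ (u t)) (projZ u')
        = grad ψ (projZ (u t)) (u'.1, 0) + u'.2.2 * grad ψ (projZ (u t)) (0, 1) := by
      conv_lhs => rw [e]
      rw [map_add, map_smul, smul_eq_mul]
    rw [e']
    ring

theorem eventually_th_pos (hU : IsStrongSolution ψ μ k T U) (ht : t ∈ Ioo 0 T) (x : Pt) :
    ∀ᶠ s in 𝓝 t, 0 < (U s x).th := by
  filter_upwards [Icc_mem_nhds ht.1 ht.2] with s hs using hU.temp_pos s hs x

theorem grad_sum_dPhi (L : Ext × ℝ →L[ℝ] ℝ) (g : Fin 3 → Fin 3 → ℝ) (F : Mat3) :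
    L (∑ α, ∑ i, g α i • dPhi i α F, 0) = ∑ α, ∑ i, g α i * L (dPhi i α F, 0) := by
  have h : L (∑ α, ∑ i, g α i • dPhi i α F, 0)
      = (L.comp (ContinuousLinearMap.inl ℝ Ext ℝ)) (∑ α, ∑ i, g α i • dPhi i α F) := rfl
  rw [h]
  simp only [map_sum, map_smul, smul_eq_mul]
  rfl

/-- The balance of entropy. -/
theorem IsStrongSolution.entropy_balance (hU : IsStrongSolution ψ μ k T U)
    (hψ : StableFreeEnergy ψ) (ht : t ∈ Ioo 0 T) (x : Pt) :
    - ((U t x).th * hess ψ (projZ (U t x)) (projZ (stDeriv T U (t, x) (1, 0))) (0, 1))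
      = ∑ α, ∑ i, viscousStress μ U i α t x * (pd α (U t) x).2.1 i
        + ∑ α, pd α (heatFlux k U α t) x := by
  have ht' := Ioo_subset_Icc_self ht
  have hC := hU.contDiff_slice ht'
  have hd := FieldC1.hasDerivAt_time hU.regular ht x
  have h1 := hU.energy_balance t ht' x
  have hk : HasDerivAt (fun s => 1 / 2 * ‖(U s x).v‖ ^ 2 + energy ψ (U s x).xi (U s x).th) _ t :=
    (hasDerivAt_half_norm_sq (projVel.hasFDerivAt.comp_hasDerivAt t hd)).add
      (hψ.hasDerivAt_energy hd (eventually_th_pos hU ht x))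
  rw [pdt_eq ht hk] at h1
  have hv := fun i => (contDiff_v hC i).differentiable one_ne_zero x
  have hs := fun i α => (hU.contDiff_stress hψ ht' i α).differentiable one_ne_zero x
  have hz := fun i α => ((hU.viscous_regular i α).contDiff ht').differentiable one_ne_zero x
  have p1 : ∀ α, pd α (fun y => ∑ i, stress ψ (U t y) i α * (U t y).v i) x
      = ∑ i, (pd α (fun y => stress ψ (U t y) i α) x * (U t x).v i
        + stress ψ (U t x) i α * (pd α (U t) x).2.1 i) := fun α => by
    rw [pd_sum _ fun i _ => (hs i α).fun_mul (hv i)]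
    exact Finset.sum_congr rfl fun i _ => by rw [pd_mul (hs i α) (hv i), pd_v hC]
  have p2 : ∀ α, pd α (fun y => ∑ i, viscousStress μ U i α t y * (U t y).v i) x
      = ∑ i, (pd α (viscousStress μ U i α t) x * (U t x).v i
        + viscousStress μ U i α t x * (pd α (U t) x).2.1 i) := fun α => by
    rw [pd_sum _ fun i _ => (hz i α).fun_mul (hv i)]
    exact Finset.sum_congr rfl fun i _ => by rw [pd_mul (hz i α) (hv i), pd_v hC]
  have p3 : grad ψ (projZ (U t x)) ((stDeriv T U (t, x) (1, 0)).1, 0)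
      = ∑ α, ∑ i, (pd α (U t) x).2.1 i * stress ψ (U t x) i α := by
    rw [hU.time_xi ht x, grad_sum_dPhi]
    simp only [hψ.stress_eq (hU.temp_pos t ht' x)]
  have p4 : ∑ i, (projVel (U t x)) i * (projVel (stDeriv T U (t, x) (1, 0))) i
      = ∑ i, (U t x).v i * (∑ α, pd α (fun y => stress ψ (U t y) i α) x
      + ∑ α, pd α (viscousStress μ U i α t) x) :=
    Finset.sum_congr rfl fun i _ => by rw [← hU.time_v ht x i]; rfl
  -- The kinetic energy rate cancels v times the stress divergences, and the elastic power Σ:∇v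
  -- occurs on both sides. What remains is θ ∂_tη̂ = Z:∇v + div Q.
  simp only [p1, p2, p3, Function.comp_def, p4] at h1
  simp only [Fin.sum_univ_three] at h1 ⊢
  linear_combination h1

end Thermo

namespace Thermo

/-! ### The relative energy identity -/

variable {ψ : Ext → ℝ → ℝ} {μ k : Mat3 → ℝ → ℝ} {T t : ℝ} {U Ub : ℝ → Pt → State}

/-- The second-order remainder of the gradient of the free energy. -/
noncomputable def gradRel (ψ : Ext → ℝ → ℝ) (z zb : Ext × ℝ) : Ext × ℝ →L[ℝ] ℝ :=
  grad ψ z - grad ψ zb - hess ψ zb (z - zb)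

/-- Purely kinematic, with no evolution equation. Symmetry of the Hessian exchanges z - z̄ with ∂_t
z̄, so ∂_tθ̄ multiplies only the quadratic remainder `gradRel`. -/
theorem StableFreeEnergy.hasDerivAt_relI (hψ : StableFreeEnergy ψ) {u ub : ℝ → State}
    {u' ub' : State} (hu : HasDerivAt u u' t) (hub : HasDerivAt ub ub' t)
    (hpos : ∀ᶠ s in 𝓝 t, 0 < (u s).th) (hposb : ∀ᶠ s in 𝓝 t, 0 < (ub s).th) :
    HasDerivAt (fun s => relI ψ (u s) (ub s))
      ((grad ψ (projZ (u t)) - grad ψ (projZ (ub t))) (u'.1, 0)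
        + gradRel ψ (projZ (u t)) (projZ (ub t)) (0, 1) * ub'.2.2
        - hess ψ (projZ (ub t)) (projZ (u t) - projZ (ub t)) (ub'.1, 0)
        - ((u t).th - (ub t).th) * (hess ψ (projZ (u t)) (projZ u') (0, 1)
          - hess ψ (projZ (ub t)) (projZ ub') (0, 1))
        + ∑ i, ((u t).v i - (ub t).v i) * (u'.2.1 i - ub'.2.1 i)) t := by
  have hz : HasDerivAt (fun s => projZ (u s)) (projZ u') t :=
    projZ.hasFDerivAt.comp_hasDerivAt t hu
  have hzb : HasDerivAt (fun s => projZ (ub s)) (projZ ub') t :=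
    projZ.hasFDerivAt.comp_hasDerivAt t hub
  have hdom := projZ_mem_dom hpos.self_of_nhds
  have hdomb := projZ_mem_dom hposb.self_of_nhds
  have h1 : HasDerivAt (fun s => freeEnergy ψ (projZ (u s))) _ t :=
    HasFDerivAt.comp_hasDerivAt (f := fun s => projZ (u s)) t (hψ.hasFDerivAt_freeEnergy hdom) hz
  have h2 : HasDerivAt (fun s => freeEnergy ψ (projZ (ub s))) _ t :=
    HasFDerivAt.comp_hasDerivAt (f := fun s => projZ (ub s)) t
      (hψ.hasFDerivAt_freeEnergy hdomb) hzb
  have hg : HasDerivAt (fun s => grad ψ (projZ (u s))) _ t :=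
    HasFDerivAt.comp_hasDerivAt (f := fun s => projZ (u s)) t (hψ.hasFDerivAt_grad hdom) hz
  have hgb : HasDerivAt (fun s => grad ψ (projZ (ub s))) _ t :=
    HasFDerivAt.comp_hasDerivAt (f := fun s => projZ (ub s)) t (hψ.hasFDerivAt_grad hdomb) hzb
  have hξ : HasDerivAt (fun s => (((u s).1 - (ub s).1, 0) : Ext × ℝ)) (u'.1 - ub'.1, 0) t :=
    ((ContinuousLinearMap.inl ℝ Ext ℝ).comp
      (ContinuousLinearMap.fst ℝ Ext (Vec3 × ℝ))).hasFDerivAt.comp_hasDerivAt t (hu.sub hub)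
  have hθ : HasDerivAt (fun s => (u s).th - (ub s).th) (u'.2.2 - ub'.2.2) t :=
    projTh.hasFDerivAt.comp_hasDerivAt t (hu.sub hub)
  have hv : HasDerivAt (fun s => (u s).v - (ub s).v) (u'.2.1 - ub'.2.1) t :=
    projVel.hasFDerivAt.comp_hasDerivAt t (hu.sub hub)
  have h3 : HasDerivAt (fun s => grad ψ (projZ (ub s)) ((u s).1 - (ub s).1, 0)) _ t :=
    hgb.clm_apply hξ
  have h4 : HasDerivAt (fun s => grad ψ (projZ (u s)) (0, 1)) _ t :=
    hg.clm_apply (hasDerivAt_const t ((0 : Ext), (1 : ℝ)))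
  have h5 : HasDerivAt (fun s => (freeEnergy ψ (projZ (u s)) - freeEnergy ψ (projZ (ub s))
      - grad ψ (projZ (ub s)) ((u s).1 - (ub s).1, 0)
      - grad ψ (projZ (u s)) (0, 1) * ((u s).th - (ub s).th))
      + 1 / 2 * ‖(u s).v - (ub s).v‖ ^ 2) _ t :=
    (((h1.sub h2).sub h3).sub (h4.mul hθ)).add (hasDerivAt_half_norm_sq hv)
  refine (h5.congr_of_eventuallyEq ?_).congr_deriv ?_
  · filter_upwards [hpos, hposb] with s hs hsb
    exact hψ.relI_eq hs hsb
  · have e : ∀ w : State, projZ w = (w.1, 0) + w.2.2 • ((0 : Ext), (1 : ℝ)) := fun w => by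
      rw [projZ_apply]; ext <;> simp
    have e1 : ∀ (L : Ext × ℝ →L[ℝ] ℝ) (w : State),
        L (projZ w) = L (w.1, 0) + w.2.2 * L (0, 1) := fun L w => by
      conv_lhs => rw [e]
      rw [map_add, map_smul, smul_eq_mul]
    have e2 : ∀ (L : Ext × ℝ →L[ℝ] ℝ), L ((u t).1 - (ub t).1, 0)
        = L (projZ (u t) - projZ (ub t)) - ((u t).th - (ub t).th) * L (0, 1) := fun L => by
      have := e1 L (u t - ub t)
      rw [map_sub] at this
      rw [this]
      simp [State.th]
    have e3 : ∀ (L : Ext × ℝ →L[ℝ] ℝ),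
        L (u'.1 - ub'.1, 0) = L (u'.1, 0) - L (ub'.1, 0) := fun L => by
      rw [← map_sub]; simp
    have e4 := hψ.hess_symm hdomb (projZ ub') (projZ (u t) - projZ (ub t))
    have e5 : hess ψ (projZ (ub t)) (projZ (u t) - projZ (ub t)) (projZ ub') = _ := e1 _ ub'
    rw [e5] at e4
    simp only [e1 (grad ψ (projZ (u t))), e1 (grad ψ (projZ (ub t))), e2, e3, e4, gradRel,
      sub_apply, map_zero, add_zero]
    simp only [State.v, PiLp.sub_apply]
    ring

/-- The flux of the relative energy. -/
noncomputable def relFlux (ψ : Ext → ℝ → ℝ) (μ k : Mat3 → ℝ → ℝ) (U Ub : ℝ → Pt → State) (t : ℝ)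
    (α : Fin 3) (y : Pt) : ℝ :=
  ∑ i, (stress ψ (U t y) i α - grad ψ (projZ (Ub t y)) (dPhi i α (U t y).F, 0)
      + viscousStress μ U i α t y) * ((U t y).v i - (Ub t y).v i)
    + ((U t y).th - (Ub t y).th) * (heatFlux k U α t y / (U t y).th
      - heatFlux k Ub α t y / (Ub t y).th)

/-- The production of relative energy by the elastic and thermal nonlinearities. -/
noncomputable def elasticProduction (ψ : Ext → ℝ → ℝ) (T : ℝ) (U Ub : ℝ → Pt → State)
    (t : ℝ) (x : Pt) : ℝ :=
  ∑ α, ∑ i, (pd α (Ub t) x).2.1 i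
      * (gradRel ψ (projZ (U t x)) (projZ (Ub t x)) (dPhi i α (Ub t x).F, 0)
        + (grad ψ (projZ (U t x)) - grad ψ (projZ (Ub t x)))
          (dPhi i α (U t x).F - dPhi i α (Ub t x).F, 0))
    + gradRel ψ (projZ (U t x)) (projZ (Ub t x)) (0, 1) * (stDeriv T Ub (t, x) (1, 0)).2.2
    + ∑ α, ∑ i, ((U t x).v i - (Ub t x).v i)
      * hess ψ (projZ (Ub t x)) (projZ (pd α (Ub t) x))
        (dPhi i α (U t x).F - dPhi i α (Ub t x).F, 0)

/-- The production of relative energy by viscosity. -/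
noncomputable def viscousProduction (μ : Mat3 → ℝ → ℝ) (U Ub : ℝ → Pt → State)
    (t : ℝ) (x : Pt) : ℝ :=
  ∑ α, ∑ i, viscousStress μ U i α t x
    * ((pd α (Ub t) x).2.1 i - (Ub t x).th / (U t x).th * (pd α (U t) x).2.1 i)

/-- The production of relative energy by heat conduction. -/
noncomputable def heatProduction (k : Mat3 → ℝ → ℝ) (U Ub : ℝ → Pt → State)
    (t : ℝ) (x : Pt) : ℝ :=
  ∑ α, (((U t x).th - (Ub t x).th) * (heatFlux k U α t x * (pd α (U t) x).2.2 / (U t x).th ^ 2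
      - heatFlux k Ub α t x * (pd α (Ub t) x).2.2 / (Ub t x).th ^ 2)
    - ((pd α (U t) x).2.2 - (pd α (Ub t) x).2.2)
      * (heatFlux k U α t x / (U t x).th - heatFlux k Ub α t x / (Ub t x).th))

/-- U itself is only C¹, so ∇v and ∇θ need not be differentiable; the assumed spatial regularity of
Z and Q is what makes this flux C¹. -/
theorem contDiff_relFlux (hψ : StableFreeEnergy ψ) (hU : IsStrongSolution ψ μ k T U)
    {μb : Mat3 → ℝ → ℝ} (hUb : IsStrongSolution ψ μb k T Ub) (ht : t ∈ Icc 0 T) (α : Fin 3) :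
    ContDiff ℝ 1 (relFlux ψ μ k U Ub t α) := by
  have hC := hU.contDiff_slice ht
  have hCb := hUb.contDiff_slice ht
  refine ContDiff.add (ContDiff.sum fun i _ => ?_) ?_
  · exact (((hU.contDiff_stress hψ ht i α).sub
      (hψ.contDiff_grad_dPhi hCb hC (hUb.temp_pos t ht) i α)).add
      ((hU.viscous_regular i α).contDiff ht)).mul ((contDiff_v hC i).sub (contDiff_v hCb i))
  · exact ((contDiff_th hC).sub (contDiff_th hCb)).mul
      ((((hU.heat_regular α).contDiff ht).div (contDiff_th hC)
        fun y => (hU.temp_pos t ht y).ne').sub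
      (((hUb.heat_regular α).contDiff ht).div (contDiff_th hCb)
        fun y => (hUb.temp_pos t ht y).ne'))

theorem IsStrongSolution.pd_periodic (hU : IsStrongSolution ψ μ k T U) (ht : t ∈ Icc 0 T)
    (x : Pt) (α j : Fin 3) : pd α (U t) (x + Pi.single j 1) = pd α (U t) x :=
  Thermo.pd_periodic (fun y => hU.periodic t ht y j) α x

theorem IsStrongSolution.viscousStress_periodic (hU : IsStrongSolution ψ μ k T U)
    (ht : t ∈ Icc 0 T) (x : Pt) (i α j : Fin 3) :
    viscousStress μ U i α t (x + Pi.single j 1) = viscousStress μ U i α t x := by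
  simp only [viscousStress, pd_v (hU.contDiff_slice ht), hU.pd_periodic ht, hU.periodic t ht]

theorem IsStrongSolution.heatFlux_periodic (hU : IsStrongSolution ψ μ k T U)
    (ht : t ∈ Icc 0 T) (x : Pt) (α j : Fin 3) :
    heatFlux k U α t (x + Pi.single j 1) = heatFlux k U α t x := by
  simp only [heatFlux, pd_th (hU.contDiff_slice ht), hU.pd_periodic ht, hU.periodic t ht]

theorem relFlux_periodic (hU : IsStrongSolution ψ μ k T U)
    {μb : Mat3 → ℝ → ℝ} (hUb : IsStrongSolution ψ μb k T Ub) (ht : t ∈ Icc 0 T) (α : Fin 3)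
    (x : Pt) (j : Fin 3) :
    relFlux ψ μ k U Ub t α (x + Pi.single j 1) = relFlux ψ μ k U Ub t α x := by
  simp only [relFlux, hU.viscousStress_periodic ht, hU.heatFlux_periodic ht,
    hUb.heatFlux_periodic ht, hU.periodic t ht, hUb.periodic t ht]

theorem pd_relFlux (hψ : StableFreeEnergy ψ) (hU : IsStrongSolution ψ μ k T U)
    {μb : Mat3 → ℝ → ℝ} (hUb : IsStrongSolution ψ μb k T Ub) (ht : t ∈ Icc 0 T) (α : Fin 3)
    (x : Pt) :
    pd α (relFlux ψ μ k U Ub t α) x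
      = ∑ i, ((pd α (fun y => stress ψ (U t y) i α) x
          - pd α (fun y => grad ψ (projZ (Ub t y)) (dPhi i α (U t y).F, 0)) x
          + pd α (viscousStress μ U i α t) x) * ((U t x).v i - (Ub t x).v i)
        + (grad ψ (projZ (U t x)) (dPhi i α (U t x).F, 0)
          - grad ψ (projZ (Ub t x)) (dPhi i α (U t x).F, 0) + viscousStress μ U i α t x)
          * ((pd α (U t) x).2.1 i - (pd α (Ub t) x).2.1 i))
      + (((pd α (U t) x).2.2 - (pd α (Ub t) x).2.2) * (heatFlux k U α t x / (U t x).th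
          - heatFlux k Ub α t x / (Ub t x).th)
        + ((U t x).th - (Ub t x).th)
          * ((pd α (heatFlux k U α t) x / (U t x).th
              - heatFlux k U α t x * (pd α (U t) x).2.2 / (U t x).th ^ 2)
            - (pd α (heatFlux k Ub α t) x / (Ub t x).th
              - heatFlux k Ub α t x * (pd α (Ub t) x).2.2 / (Ub t x).th ^ 2))) := by
  have hC := hU.contDiff_slice ht
  have hCb := hUb.contDiff_slice ht
  have d1 := fun i => (hU.contDiff_stress hψ ht i α).differentiable one_ne_zero x
  have d2 := fun i =>
    (hψ.contDiff_grad_dPhi hCb hC (hUb.temp_pos t ht) i α).differentiable one_ne_zero x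
  have d3 := fun i => ((hU.viscous_regular i α).contDiff ht).differentiable one_ne_zero x
  have d4 := fun i => (contDiff_v hC i).differentiable one_ne_zero x
  have d5 := fun i => (contDiff_v hCb i).differentiable one_ne_zero x
  have d6 := (contDiff_th hC).differentiable one_ne_zero x
  have d7 := (contDiff_th hCb).differentiable one_ne_zero x
  have d8 := ((hU.heat_regular α).contDiff ht).differentiable one_ne_zero x
  have d9 := ((hUb.heat_regular α).contDiff ht).differentiable one_ne_zero x
  have n1 := (hU.temp_pos t ht x).ne'
  have n2 := (hUb.temp_pos t ht x).ne'
  have s1 := fun i => (((d1 i).fun_sub (d2 i)).fun_add (d3 i)).fun_mul ((d4 i).fun_sub (d5 i))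
  have e1 : DifferentiableAt ℝ (fun y => heatFlux k U α t y / (U t y).th) x :=
    (((hU.heat_regular α).contDiff ht).div (contDiff_th hC)
      fun y => (hU.temp_pos t ht y).ne').differentiable one_ne_zero x
  have e2 : DifferentiableAt ℝ (fun y => heatFlux k Ub α t y / (Ub t y).th) x :=
    (((hUb.heat_regular α).contDiff ht).div (contDiff_th hCb)
      fun y => (hUb.temp_pos t ht y).ne').differentiable one_ne_zero x
  have s2 := e1.fun_sub e2
  have s3 := (d6.fun_sub d7).fun_mul s2
  have s4 := DifferentiableAt.fun_sum fun i (_ : i ∈ (Finset.univ : Finset (Fin 3))) => s1 i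
  unfold relFlux
  rw [pd_add s4 s3, pd_sum _ fun i _ => s1 i, pd_mul (d6.fun_sub d7) s2, pd_sub d6 d7,
    pd_sub e1 e2, pd_div d8 d6 n1, pd_div d9 d7 n2, pd_th hC,
    pd_th hCb]
  congr 1
  refine Finset.sum_congr rfl fun i _ => ?_
  rw [pd_mul (((d1 i).fun_sub (d2 i)).fun_add (d3 i)) ((d4 i).fun_sub (d5 i)),
    pd_add ((d1 i).fun_sub (d2 i)) (d3 i), pd_sub (d1 i) (d2 i), pd_sub (d4 i) (d5 i), pd_v hC,
    pd_v hCb, hψ.stress_eq (hU.temp_pos t ht x)]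

theorem viscousStress_zero (i α : Fin 3) :
    viscousStress (fun _ _ => 0) U i α t = fun _ => 0 := by
  funext y; simp [viscousStress]

/-- The identity with all fields at one point replaced by independent reals. Here `s`, `A`, `sb` are
derivatives of the stress, of the mixed term ∇ψ̂(Ū)·∂Φ(F) and of the reference stress; `e`, `eb` are
the rates of -η̂; `g`, `gb` and `n`, `nb` are the gradients of velocity and temperature; `w` is v -
v̄. The hypotheses `he`, `heb` are the entropy balances, `hA` and `hsb` the Piola identity. -/
theorem relative_energy_algebra {a c h s sb A Z Z' g gb : Fin 3 → Fin 3 → ℝ}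
    {w : Fin 3 → ℝ} {Q Qb Q' Qb' n nb : Fin 3 → ℝ} {θ θb e eb r hb hz : ℝ}
    {X Y B : Fin 3 → Fin 3 → ℝ}
    (hθ : θ ≠ 0) (hθb : θb ≠ 0)
    (he : -(θ * e) = ∑ α, ∑ i, Z i α * g i α + ∑ α, Q' α)
    (heb : -(θb * eb) = ∑ α, Qb' α)
    (hA : ∀ i, ∑ α, A i α = ∑ α, X i α) (hsb : ∀ i, ∑ α, sb i α = ∑ α, Y i α)
    (hB : ∀ i α, B i α = X i α - Y i α)
    (hz' : hz = ∑ α, ∑ i, g i α * (a i α - c i α)) (hb' : hb = ∑ α, ∑ i, gb i α * h i α) :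
    hz + r - hb - (θ - θb) * (e - eb)
        + ∑ i, w i * ((∑ α, s i α + ∑ α, Z' i α) - ∑ α, sb i α)
      = ∑ α, (∑ i, ((s i α - A i α + Z' i α) * w i
          + (a i α - c i α + Z i α) * (g i α - gb i α))
        + ((n α - nb α) * (Q α / θ - Qb α / θb)
          + (θ - θb) * ((Q' α / θ - Q α * n α / θ ^ 2) - (Qb' α / θb - Qb α * nb α / θb ^ 2))))
      + ((∑ α, ∑ i, gb i α * (a i α - c i α - h i α) + r + ∑ α, ∑ i, w i * B i α)
        + ∑ α, ∑ i, Z i α * (gb i α - θb / θ * g i α)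
        + ∑ α, ((θ - θb) * (Q α * n α / θ ^ 2 - Qb α * nb α / θb ^ 2)
          - (n α - nb α) * (Q α / θ - Qb α / θb))) := by
  have e1 : e = -(∑ α, ∑ i, Z i α * g i α + ∑ α, Q' α) / θ := by rw [← he]; field_simp
  have e2 : eb = -(∑ α, Qb' α) / θb := by rw [← heb]; field_simp
  -- The entropy balance weights Z:∇v by (θ - θ̄)/θ, and this splitting matches it with the weight
  -- θ̄/θ of the viscous production.
  have hd : θb / θ = 1 - (θ - θb) / θ := by field_simp; ring
  simp only [hB, e1, e2, hz', hb', hd, Fin.sum_univ_three] at *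
  linear_combination (-1) * w 0 * hsb 0 - w 1 * hsb 1 - w 2 * hsb 2 + w 0 * hA 0 + w 1 * hA 1
    + w 2 * hA 2

/-- Putting the mixed term ∇ψ̂(Ū)·∂Φ(F) into the flux and applying the Piola identity to F leaves
derivatives of Ū only in the elastic production. Zero viscosity of the reference solution removes
its viscous stress. -/
theorem hasDerivAt_relI_solution (hψ : StableFreeEnergy ψ) (hU : IsStrongSolution ψ μ k T U)
    (hUb : IsStrongSolution ψ (fun _ _ => 0) k T Ub) (ht : t ∈ Ioo 0 T) (x : Pt) :
    HasDerivAt (fun s => relI ψ (U s x) (Ub s x))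
      (∑ α, pd α (relFlux ψ μ k U Ub t α) x
        + (elasticProduction ψ T U Ub t x + viscousProduction μ U Ub t x
          + heatProduction k U Ub t x)) t := by
  have ht' := Ioo_subset_Icc_self ht
  have hC := hU.contDiff_slice ht'
  have hCb := hUb.contDiff_slice ht'
  refine (hψ.hasDerivAt_relI (FieldC1.hasDerivAt_time hU.regular ht x)
    (FieldC1.hasDerivAt_time hUb.regular ht x) (eventually_th_pos hU ht x)
    (eventually_th_pos hUb ht x)).congr_deriv ?_
  have heb := hUb.entropy_balance hψ ht x
  simp only [viscousStress_zero, zero_mul, Finset.sum_const_zero, zero_add] at heb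
  have htv := hUb.time_v ht x
  have hpd0 : ∀ α, pd α (fun _ : Pt => (0 : ℝ)) x = 0 := fun α => by simp [pd]
  simp only [viscousStress_zero, hpd0, Finset.sum_const_zero, add_zero,
    hψ.stress_eq (hUb.temp_pos t ht' _)] at htv
  simp only [hU.time_v ht x, htv, pd_relFlux hψ hU hUb ht', elasticProduction, viscousProduction,
    heatProduction]
  refine (relative_energy_algebra
    (gb := fun i α => (pd α (Ub t) x).2.1 i)
    (Q := fun α => heatFlux k U α t x) (Qb := fun α => heatFlux k Ub α t x)
    (n := fun α => (pd α (U t) x).2.2) (nb := fun α => (pd α (Ub t) x).2.2)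
    (a := fun i α => grad ψ (projZ (U t x)) (dPhi i α (U t x).F, 0))
    (c := fun i α => grad ψ (projZ (Ub t x)) (dPhi i α (U t x).F, 0))
    (h := fun i α => hess ψ (projZ (Ub t x)) (projZ (U t x) - projZ (Ub t x))
      (dPhi i α (Ub t x).F, 0))
    (X := fun i α => hess ψ (projZ (Ub t x)) (projZ (pd α (Ub t) x)) (dPhi i α (U t x).F, 0))
    (Y := fun i α => hess ψ (projZ (Ub t x)) (projZ (pd α (Ub t) x)) (dPhi i α (Ub t x).F, 0))
    (B := fun i α => hess ψ (projZ (Ub t x)) (projZ (pd α (Ub t) x))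
      (dPhi i α (U t x).F - dPhi i α (Ub t x).F, 0))
    (hU.temp_pos t ht' x).ne' (hUb.temp_pos t ht' x).ne' (hU.entropy_balance hψ ht x) heb
    (fun i => hψ.sum_pd_grad_dPhi hCb hC (hUb.temp_pos t ht') (hU.pd_F_symm ht' x) i)
    (fun i => hψ.sum_pd_grad_dPhi hCb hCb (hUb.temp_pos t ht') (hUb.pd_F_symm ht' x) i)
    (fun i α => ?_) ?_ ?_).trans ?_
  · rw [← map_sub]; simp
  · rw [hU.time_xi ht x, grad_sum_dPhi]; rfl
  · rw [hUb.time_xi ht x, grad_sum_dPhi]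
  · congr 5
    refine Finset.sum_congr rfl fun α _ => Finset.sum_congr rfl fun i _ => ?_
    congr 1
    have e : ∀ L : Ext × ℝ →L[ℝ] ℝ, L (dPhi i α (U t x).F - dPhi i α (Ub t x).F, 0)
        = L (dPhi i α (U t x).F, 0) - L (dPhi i α (Ub t x).F, 0) := fun L => by
      rw [← map_sub]; simp
    simp only [e, gradRel, sub_apply]
    ring

end Thermo

namespace Thermo

/-! ### Estimates for the production terms -/

variable {ψ : Ext → ℝ → ℝ} {μ k : Mat3 → ℝ → ℝ} {T t p q r l : ℝ} {U Ub : ℝ → Pt → State}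

/-- The density `μ(F,θ) θ |∇v̄|² / θ̄` of the viscous error. -/
noncomputable def viscousDensity (μ : Mat3 → ℝ → ℝ) (U Ub : ℝ → Pt → State) (t : ℝ) (x : Pt) : ℝ :=
  μ (U t x).F (U t x).th * (U t x).th * (gradVelSq Ub t x / (Ub t x).th)

/-- With x = θ·gb and y = θ̄·g the claim is x² - xy + y² ≥ 0: the dissipation -(θ̄/θ)g² absorbs the
cross term g·gb. -/
theorem viscous_production_term_le {m g gb θ θb : ℝ} (hm : 0 ≤ m) (hθ : 0 < θ) (hθb : 0 < θb) :
    m * g * (gb - θb / θ * g) ≤ m * θ * (gb ^ 2 / θb) := by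
  have e : m * θ * (gb ^ 2 / θb) - m * g * (gb - θb / θ * g)
      = m * (((θ * gb) ^ 2 - (θ * gb) * (θb * g) + (θb * g) ^ 2) / (θ * θb)) := by
    field_simp
    ring
  have h : 0 ≤ (θ * gb) ^ 2 - (θ * gb) * (θb * g) + (θb * g) ^ 2 := by
    nlinarith [sq_nonneg (θ * gb - θb * g), sq_nonneg (θ * gb), sq_nonneg (θb * g)]
  have : 0 ≤ m * (((θ * gb) ^ 2 - (θ * gb) * (θb * g) + (θb * g) ^ 2) / (θ * θb)) := by
    positivity
  linarith

theorem viscousProduction_le (hU : ContDiff ℝ 1 (U t)) (hUb : ContDiff ℝ 1 (Ub t)) {x : Pt}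
    (hμ : 0 ≤ μ (U t x).F (U t x).th) (hθ : 0 < (U t x).th) (hθb : 0 < (Ub t x).th) :
    viscousProduction μ U Ub t x ≤ viscousDensity μ U Ub t x := by
  unfold viscousProduction viscousDensity gradVelSq viscousStress
  rw [Finset.sum_comm, Finset.sum_div, Finset.mul_sum]
  refine Finset.sum_le_sum fun i _ => ?_
  rw [Finset.sum_div, Finset.mul_sum]
  refine Finset.sum_le_sum fun α _ => ?_
  rw [pd_v hU, pd_v hUb]
  exact viscous_production_term_le hμ hθ hθb

/-- In terms of the logarithmic derivatives a = n/θ and b = nb/θ̄ the left side is -θ̄κ(a - b)² +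
(θκb - θ̄κ)b(a - b). Completing the square in a - b removes the uncontrolled gradient n. -/
theorem heat_production_term_le {κ κb n nb θ θb : ℝ} (hκ : 0 < κ) (hθ : 0 < θ) (hθb : 0 < θb) :
    (θ - θb) * (κ * n * n / θ ^ 2 - κb * nb * nb / θb ^ 2)
        - (n - nb) * (κ * n / θ - κb * nb / θb)
      ≤ (θ * κb - θb * κ) ^ 2 / κ * (nb ^ 2 / (4 * θb ^ 3)) := by
  obtain ⟨a, rfl⟩ : ∃ a, n = a * θ := ⟨n / θ, by field_simp⟩
  obtain ⟨b, rfl⟩ : ∃ b, nb = b * θb := ⟨nb / θb, by field_simp⟩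
  have e1 : (θ - θb) * (κ * (a * θ) * (a * θ) / θ ^ 2 - κb * (b * θb) * (b * θb) / θb ^ 2)
        - (a * θ - b * θb) * (κ * (a * θ) / θ - κb * (b * θb) / θb)
      = -(θb * κ) * (a - b) ^ 2 + (θ * κb - θb * κ) * b * (a - b) := by
    field_simp
    ring
  have e2 : (θ * κb - θb * κ) ^ 2 / κ * ((b * θb) ^ 2 / (4 * θb ^ 3))
      - (-(θb * κ) * (a - b) ^ 2 + (θ * κb - θb * κ) * b * (a - b))
      = (2 * (θb * κ) * (a - b) - (θ * κb - θb * κ) * b) ^ 2 / (4 * (θb * κ)) := by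
    field_simp
    ring
  have e3 : 0 ≤ (2 * (θb * κ) * (a - b) - (θ * κb - θb * κ) * b) ^ 2 / (4 * (θb * κ)) := by
    positivity
  rw [e1]
  linarith

theorem heatProduction_le (hk : IsConductivity k) (hU : ContDiff ℝ 1 (U t))
    (hUb : ContDiff ℝ 1 (Ub t)) {x : Pt} {N δ D : ℝ} (hθ : 0 < (U t x).th) (hδ : 0 < δ)
    (hθb : δ ≤ (Ub t x).th) (hN : ∀ α, |(pd α (Ub t) x).2.2| ≤ N)
    (hD : ((U t x).th * conductivity k (projZ (Ub t x))
      - (Ub t x).th * conductivity k (projZ (U t x))) ^ 2 / conductivity k (projZ (U t x)) ≤ D) :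
    heatProduction k U Ub t x ≤ 3 * (D * (N ^ 2 / (4 * δ ^ 3))) := by
  have hθb0 : 0 < (Ub t x).th := hδ.trans_le hθb
  have hκ : 0 < conductivity k (projZ (U t x)) := hk.2 _ _ hθ
  have hD0 : 0 ≤ D := le_trans (by positivity) hD
  have key : ∀ α ∈ (Finset.univ : Finset (Fin 3)),
      (((U t x).th - (Ub t x).th) * (heatFlux k U α t x * (pd α (U t) x).2.2 / (U t x).th ^ 2
      - heatFlux k Ub α t x * (pd α (Ub t) x).2.2 / (Ub t x).th ^ 2)
    - ((pd α (U t) x).2.2 - (pd α (Ub t) x).2.2)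
      * (heatFlux k U α t x / (U t x).th - heatFlux k Ub α t x / (Ub t x).th))
      ≤ D * (N ^ 2 / (4 * δ ^ 3)) := fun α _ => by
    unfold heatFlux
    rw [pd_th hU, pd_th hUb]
    refine (heat_production_term_le hκ hθ hθb0).trans ?_
    refine mul_le_mul hD ?_ (by positivity) hD0
    refine div_le_div₀ (sq_nonneg _) ?_ (by positivity) ?_
    · rw [← sq_abs]; exact pow_le_pow_left₀ (abs_nonneg _) (hN α) 2
    · exact mul_le_mul_of_nonneg_left (pow_le_pow_left₀ hδ.le hθb 3) (by norm_num)
  exact (Finset.sum_le_sum key).trans (by simp)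

theorem abs_coord_vec_le (v : Vec3) (i : Fin 3) : |v i| ≤ ‖v‖ := by
  simpa using PiLp.norm_apply_le v i

theorem norm_projZ_le (u : State) : ‖projZ u‖ ≤ ‖u‖ :=
  norm_prod_le_iff.2 ⟨norm_fst_le u, (norm_snd_le u.2).trans (norm_snd_le u)⟩

theorem norm_mk_zero (ξ : Ext) : ‖((ξ, 0) : Ext × ℝ)‖ = ‖ξ‖ := by
  simp [Prod.norm_def]

/-- Remainders of order I are multiplied by bounded derivatives of Ū, while the coupling of v - v̄
with the difference of ∂Φ is split into squares. The factor 9 counts the pairs (i, α). -/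
theorem elasticProduction_le {x : Pt} {N D B C₁ C₂ C₃ I : ℝ}
    (hN0 : 0 ≤ N) (hB : 0 ≤ B)
    (hN : ∀ α, ‖pd α (Ub t) x‖ ≤ N) (hNt : ‖stDeriv T Ub (t, x) (1, 0)‖ ≤ N)
    (hD : ∀ i α, ‖dPhi i α (Ub t x).F‖ ≤ D) (hHess : ‖hess ψ (projZ (Ub t x))‖ ≤ B)
    (h₁ : ‖gradRel ψ (projZ (U t x)) (projZ (Ub t x))‖ ≤ C₁ * I)
    (h₂ : ∀ i α, |(grad ψ (projZ (U t x)) - grad ψ (projZ (Ub t x)))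
      (dPhi i α (U t x).F - dPhi i α (Ub t x).F, 0)| ≤ C₂ * I)
    (h₃ : ∀ i α, ‖dPhi i α (U t x).F - dPhi i α (Ub t x).F‖ ^ 2 ≤ C₃ * I) :
    elasticProduction ψ T U Ub t x
      ≤ 9 * (N * (C₁ * I * D + C₂ * I)) + C₁ * I * N
        + 9 * (B * N * (‖(U t x).v - (Ub t x).v‖ ^ 2 + C₃ * I)) := by
  have hv : ∀ i α, |(pd α (Ub t) x).2.1 i| ≤ N := fun i α =>
    (abs_coord_vec_le _ i).trans ((norm_fst_le _).trans ((norm_snd_le _).trans (hN α)))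
  have hC₁ : 0 ≤ C₁ * I := (norm_nonneg _).trans h₁
  have hC₂ : 0 ≤ C₂ * I := (abs_nonneg _).trans (h₂ 0 0)
  have t1 : ∀ α ∈ (Finset.univ : Finset (Fin 3)), ∀ i ∈ (Finset.univ : Finset (Fin 3)),
      (pd α (Ub t) x).2.1 i * (gradRel ψ (projZ (U t x)) (projZ (Ub t x)) (dPhi i α (Ub t x).F, 0)
        + (grad ψ (projZ (U t x)) - grad ψ (projZ (Ub t x)))
          (dPhi i α (U t x).F - dPhi i α (Ub t x).F, 0)) ≤ N * (C₁ * I * D + C₂ * I) :=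
    fun α _ i _ => by
      refine (le_abs_self _).trans ?_
      rw [abs_mul]
      refine mul_le_mul (hv i α) ((abs_add_le _ _).trans (add_le_add ?_ (h₂ i α)))
        (abs_nonneg _) hN0
      rw [← Real.norm_eq_abs]
      refine (ContinuousLinearMap.le_opNorm _ _).trans ?_
      rw [norm_mk_zero]
      exact mul_le_mul h₁ (hD i α) (norm_nonneg _) hC₁
  have t2 : gradRel ψ (projZ (U t x)) (projZ (Ub t x)) (0, 1) * (stDeriv T Ub (t, x) (1, 0)).2.2
      ≤ C₁ * I * N := by
    refine (le_abs_self _).trans ?_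
    rw [abs_mul]
    refine mul_le_mul ?_ ((norm_snd_le _).trans ((norm_snd_le _).trans hNt)) (abs_nonneg _) hC₁
    rw [← Real.norm_eq_abs]
    refine (ContinuousLinearMap.le_opNorm _ _).trans ?_
    have : ‖((0, 1) : Ext × ℝ)‖ = 1 := by simp [Prod.norm_def]
    rwa [this, mul_one]
  have t3 : ∀ α ∈ (Finset.univ : Finset (Fin 3)), ∀ i ∈ (Finset.univ : Finset (Fin 3)),
      ((U t x).v i - (Ub t x).v i) * hess ψ (projZ (Ub t x)) (projZ (pd α (Ub t) x))
        (dPhi i α (U t x).F - dPhi i α (Ub t x).F, 0)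
      ≤ B * N * (‖(U t x).v - (Ub t x).v‖ ^ 2 + C₃ * I) := fun α _ i _ => by
    refine (le_abs_self _).trans ?_
    rw [abs_mul]
    have a1 : |(U t x).v i - (Ub t x).v i| ≤ ‖(U t x).v - (Ub t x).v‖ :=
      abs_coord_vec_le ((U t x).v - (Ub t x).v) i
    have a2 : |hess ψ (projZ (Ub t x)) (projZ (pd α (Ub t) x))
        (dPhi i α (U t x).F - dPhi i α (Ub t x).F, 0)|
        ≤ B * N * ‖dPhi i α (U t x).F - dPhi i α (Ub t x).F‖ := by
      rw [← Real.norm_eq_abs]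
      refine (ContinuousLinearMap.le_opNorm _ _).trans ?_
      rw [norm_mk_zero]
      refine mul_le_mul_of_nonneg_right ?_ (norm_nonneg _)
      exact (ContinuousLinearMap.le_opNorm _ _).trans
        (mul_le_mul hHess ((norm_projZ_le _).trans (hN α)) (norm_nonneg _) hB)
    refine (mul_le_mul a1 a2 (abs_nonneg _) (norm_nonneg _)).trans ?_
    have a3 := h₃ i α
    set X := ‖(U t x).v - (Ub t x).v‖
    set Y := ‖dPhi i α (U t x).F - dPhi i α (Ub t x).F‖
    have a4 : X * Y ≤ X ^ 2 + C₃ * I := by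
      nlinarith [sq_nonneg (X - Y), sq_nonneg X, sq_nonneg Y]
    have := mul_le_mul_of_nonneg_left a4 (mul_nonneg hB hN0)
    linarith
  have s1 := Finset.sum_le_sum fun α hα => Finset.sum_le_sum (t1 α hα)
  have s3 := Finset.sum_le_sum fun α hα => Finset.sum_le_sum (t3 α hα)
  simp only [Finset.sum_const, Finset.card_univ, Fintype.card_fin, nsmul_eq_mul,
    Nat.cast_ofNat] at s1 s3
  unfold elasticProduction
  linarith

theorem projZ_F (u : State) : (projZ u).1.1 = u.F := rfl

theorem projZ_th (u : State) : (projZ u).2 = u.th := rfl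

theorem projZ_xi (u : State) : (projZ u).1 = u.xi := rfl

theorem projZ_mem_box {M δ a : ℝ} (ha : a ≤ δ) {u : State} (hu : u ∈ Gam M δ) :
    projZ u ∈ Box M a := by
  obtain ⟨h1, h2, h3, -, h5, h6⟩ := hu
  exact mem_box.2 ⟨norm_prod_le_iff.2 ⟨h1, norm_prod_le_iff.2 ⟨h2, h3⟩⟩, ha.trans h5, h6⟩

/-- The production of relative energy is controlled by the relative energy and the viscous
error. -/
theorem exists_production_le (hψ : StableFreeEnergy ψ) (hp : 4 ≤ p) (hq : 1 < q) (hr : 1 < r)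
    (hl : 1 < l) (hg : GrowthConditions ψ p q r l) (hk : IsConductivity k) (hT : 0 < T)
    {M δ δ₀ C₀ : ℝ} (hδ : 0 < δ) (hδ₀ : 0 < δ₀) (hC₀ : 0 < C₀) {μb : Mat3 → ℝ → ℝ}
    (hUb : IsStrongSolution ψ μb k T Ub) (hΓ : ∀ t ∈ Icc 0 T, ∀ x, Ub t x ∈ Gam M δ) :
    ∃ C, 0 ≤ C ∧ ∀ (μ : Mat3 → ℝ → ℝ) (U : ℝ → Pt → State), IsViscosity μ →
      IsStrongSolution ψ μ k T U → ThermalBounds ψ k T δ₀ C₀ U →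
      ∀ t ∈ Icc 0 T, ∀ x ∈ Icc (0 : Pt) 1,
        elasticProduction ψ T U Ub t x + viscousProduction μ U Ub t x + heatProduction k U Ub t x
          ≤ C * relI ψ (U t x) (Ub t x) + viscousDensity μ U Ub t x := by
  -- A common lower bound for the temperatures of both solutions.
  obtain ⟨a, ha, haδ, haδ₀⟩ : ∃ a, 0 < a ∧ a ≤ δ ∧ a ≤ δ₀ :=
    ⟨min δ δ₀, lt_min hδ hδ₀, min_le_left _ _, min_le_right _ _⟩
  obtain ⟨C₁, hC₁, h₁⟩ := hg.exists_taylor_grad_le hψ hp hq hr hl (M := M) ha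
  obtain ⟨C₂, hC₂, h₂⟩ := hg.exists_grad_dPhi_le hψ hp hq hr hl (M := M) ha
  obtain ⟨C₃, hC₃, h₃⟩ := hg.exists_dPhi_sq_le hψ hp hq hr hl (M := M) ha
  obtain ⟨C₄, hC₄, h₄⟩ := hg.exists_heat_defect_le hψ hp hq hr hl (M := M) ha hk hC₀
  obtain ⟨N, hN0, hN⟩ := FieldC1.exists_bound hUb.regular hT
  have hH : ContinuousOn (hess ψ) (Box M a) :=
    hψ.contDiffOn_hess.continuousOn.mono (box_subset_dom ha)
  obtain ⟨B, hB⟩ := (isCompact_box M a).exists_bound_of_continuousOn (f := hess ψ) hH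
  obtain ⟨D, hD0, hD⟩ : ∃ D, 0 ≤ D ∧ 36 * (1 + |M| ^ 2) ≤ D := ⟨_, by positivity, le_rfl⟩
  -- The 2 in 2 + C₃ compensates the factor ½ in front of |v - v̄|² in I. All ingredients depend
  -- only on Ū and the constitutive data, so K is fixed before μ and U.
  obtain ⟨K, hK⟩ : ∃ K, K = 9 * (N * (C₁ * D + C₂)) + C₁ * N + 9 * (|B| * N * (2 + C₃))
    + 3 * (C₄ * (N ^ 2 / (4 * δ ^ 3))) := ⟨_, rfl⟩
  have hK0 : 0 ≤ K := by rw [hK]; positivity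
  refine ⟨K, hK0, ?_⟩
  intro μ U hμ hU hth t ht x hx
  have hθ := hU.temp_pos t ht x
  have hθb := hUb.temp_pos t ht x
  have hz : a ≤ (projZ (U t x)).2 := haδ₀.trans (hth t ht x).1
  have hzb : projZ (Ub t x) ∈ Box M a := projZ_mem_box haδ (hΓ t ht x)
  have hI0 : 0 ≤ relPsi ψ (projZ (U t x)) (projZ (Ub t x)) :=
    hψ.relPsi_nonneg (projZ_mem_dom hθ) (projZ_mem_dom hθb)
  have hI := hψ.relI_eq hθ hθb
  rw [← projZ_apply, ← projZ_apply] at hI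
  have g₁ := h₁ _ hz _ hzb
  rw [← gradRel] at g₁
  have g₂ := h₂ _ hz _ hzb
  have g₃ := h₃ _ hz _ hzb
  have g₄ := h₄ _ hz _ hzb (hth t ht x).2
  simp only [projZ_F, projZ_th] at g₂ g₃ g₄
  have e1 := elasticProduction_le (T := T) (U := U) (I := relPsi ψ (projZ (U t x)) (projZ (Ub t x)))
    hN0 (abs_nonneg B) (D := D) (hN t ht x hx).1 (hN t ht x hx).2
    (fun i α => (norm_dPhi_le i α _).trans (by
      have : ‖(Ub t x).F‖ ^ 2 ≤ |M| ^ 2 :=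
        pow_le_pow_left₀ (norm_nonneg _) ((hΓ t ht x).1.trans (le_abs_self M)) 2
      linarith))
    ((hB _ hzb).trans (le_abs_self B)) g₁ g₂ g₃
  have e2 := viscousProduction_le (hU.contDiff_slice ht) (hUb.contDiff_slice ht)
    (hμ.2 _ _ hθ).le hθ hθb
  have e3 := heatProduction_le hk (hU.contDiff_slice ht) (hUb.contDiff_slice ht) (N := N) hθ hδ
    (hΓ t ht x).2.2.2.2.1
    (fun α => (norm_snd_le _).trans ((norm_snd_le _).trans ((hN t ht x hx).1 α)))
    g₄
  rw [hI]
  have e4 : ‖(U t x).v - (Ub t x).v‖ = ‖(U t x).2.1 - (Ub t x).2.1‖ := rfl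
  rw [e4] at e1
  generalize relPsi ψ (projZ (U t x)) (projZ (Ub t x)) = I at *
  have hX : 0 ≤ ‖(U t x).2.1 - (Ub t x).2.1‖ ^ 2 := sq_nonneg _
  generalize ‖(U t x).2.1 - (Ub t x).2.1‖ ^ 2 = X at *
  have p1 : 0 ≤ (9 * (N * (C₁ * D + C₂)) + C₁ * N + 9 * (|B| * N * C₃)
    + 3 * (C₄ * (N ^ 2 / (4 * δ ^ 3)))) * (1 / 2 * X) := by positivity
  have p2 : 0 ≤ 9 * (|B| * N * 2) * I := by positivity
  rw [hK]
  linarith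

end Thermo

namespace Thermo

/-! ### Integration over the period cell -/

variable {ψ : Ext → ℝ → ℝ} {μ k : Mat3 → ℝ → ℝ} {T t p q r l : ℝ} {U Ub : ℝ → Pt → State}

theorem continuousOn_integral_cell {f : ℝ → Pt → ℝ} (hT : 0 ≤ T)
    (hf : ContinuousOn (fun z : ℝ × Pt => f z.1 z.2) (Icc 0 T ×ˢ univ)) :
    ContinuousOn (fun t => ∫ x in Icc (0 : Pt) 1, f t x) (Icc 0 T) := by
  -- Projecting time onto [0, T] yields a globally continuous integrand without changing it on [0,
  -- T].
  have hc : Continuous (fun z : ℝ × Pt => f (projIcc 0 T hT z.1) z.2) := by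
    rw [← continuousOn_univ]
    refine ContinuousOn.comp (f := fun z : ℝ × Pt => ((projIcc 0 T hT z.1 : ℝ), z.2)) hf ?_ ?_
    · exact ((continuous_subtype_val.comp (continuous_projIcc.comp continuous_fst)).prodMk
        continuous_snd).continuousOn
    · exact fun z _ => ⟨(projIcc 0 T hT z.1).2, mem_univ _⟩
  have h := continuous_parametric_integral_of_continuous (μ := (volume : Measure Pt))
    (f := fun s x => f (projIcc 0 T hT s) x) hc (isCompact_Icc (a := (0 : Pt)) (b := 1))
  refine h.continuousOn.congr fun s hs => ?_
  simp only [projIcc_of_mem hT hs]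

theorem continuous_slice {E : Type*} [TopologicalSpace E] {f : ℝ → Pt → E}
    (hf : ContinuousOn (fun z : ℝ × Pt => f z.1 z.2) (Icc 0 T ×ˢ univ)) (ht : t ∈ Icc 0 T) :
    Continuous (f t) := by
  rw [← continuousOn_univ]
  exact ContinuousOn.comp (f := fun y : Pt => (t, y)) hf (by fun_prop)
    fun y _ => ⟨ht, mem_univ y⟩

theorem integrableOn_cell {f : Pt → ℝ} (hf : Continuous f) : IntegrableOn f (Icc 0 1) :=
  hf.continuousOn.integrableOn_compact isCompact_Icc

/-- On the period cell the time derivative is bounded by a constant, which serves as the dominating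
function for differentiation under the integral. -/
theorem FieldC1.hasDerivAt_integral {f : ℝ → Pt → ℝ} (hf : FieldC1 T f) (hT : 0 < T)
    (ht : t ∈ Ioo 0 T) :
    Continuous (fun x => stDeriv T f (t, x) (1, 0)) ∧
    HasDerivAt (fun s => ∫ x in Icc (0 : Pt) 1, f s x)
      (∫ x in Icc (0 : Pt) 1, stDeriv T f (t, x) (1, 0)) t := by
  obtain ⟨N, -, hN⟩ := hf.exists_bound hT
  have hc : Continuous (fun x => stDeriv T f (t, x) (1, 0)) :=
    (continuous_slice (f := fun s x => stDeriv T f (s, x)) (hf.continuousOn_stDeriv hT)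
      (Ioo_subset_Icc_self ht)).clm_apply continuous_const
  refine ⟨hc, (hasDerivAt_integral_of_dominated_loc_of_deriv_le
    (F' := fun s x => stDeriv T f (s, x) (1, 0)) (bound := fun _ => N)
    (Ioo_mem_nhds ht.1 ht.2) ?_ ?_ hc.aestronglyMeasurable ?_ ?_ ?_).2⟩
  · filter_upwards [Ioo_mem_nhds ht.1 ht.2] with s hs
    exact (hf.contDiff_slice (Ioo_subset_Icc_self hs)).continuous.aestronglyMeasurable
  · exact integrableOn_cell (hf.contDiff_slice (Ioo_subset_Icc_self ht)).continuous
  · rw [ae_restrict_iff' measurableSet_Icc]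
    exact Eventually.of_forall fun x hx s hs => (hN s (Ioo_subset_Icc_self hs) x hx).2
  · exact integrableOn_cell continuous_const
  · exact Eventually.of_forall fun x s hs => hf.hasDerivAt_time hs x

theorem FieldC1.relI (hψ : StableFreeEnergy ψ) (hU : FieldC1 T U) (hUb : FieldC1 T Ub)
    (hpos : ∀ t ∈ Icc 0 T, ∀ x, 0 < (U t x).th) (hposb : ∀ t ∈ Icc 0 T, ∀ x, 0 < (Ub t x).th) :
    FieldC1 T fun t x => relI ψ (U t x) (Ub t x) := by
  have hz : ContDiffOn ℝ 1 (fun z : ℝ × Pt => projZ (U z.1 z.2)) (Icc 0 T ×ˢ univ) :=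
    projZ.contDiff.comp_contDiffOn hU
  have hzb : ContDiffOn ℝ 1 (fun z : ℝ × Pt => projZ (Ub z.1 z.2)) (Icc 0 T ×ˢ univ) :=
    projZ.contDiff.comp_contDiffOn hUb
  have hm : MapsTo (fun z : ℝ × Pt => projZ (U z.1 z.2)) (Icc 0 T ×ˢ univ) Dom :=
    fun z h => projZ_mem_dom (hpos z.1 h.1 z.2)
  have hmb : MapsTo (fun z : ℝ × Pt => projZ (Ub z.1 z.2)) (Icc 0 T ×ˢ univ) Dom :=
    fun z h => projZ_mem_dom (hposb z.1 h.1 z.2)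
  have h1 : ContDiffOn ℝ 1 (fun z : ℝ × Pt => freeEnergy ψ (projZ (U z.1 z.2))) _ :=
    (hψ.contDiffOn_freeEnergy.of_le (by norm_num)).comp hz hm
  have h2 : ContDiffOn ℝ 1 (fun z : ℝ × Pt => freeEnergy ψ (projZ (Ub z.1 z.2))) _ :=
    (hψ.contDiffOn_freeEnergy.of_le (by norm_num)).comp hzb hmb
  have h3 : ContDiffOn ℝ 1 (fun z : ℝ × Pt => grad ψ (projZ (U z.1 z.2))) _ :=
    (hψ.contDiffOn_grad.of_le (by norm_num)).comp hz hm
  have h4 : ContDiffOn ℝ 1 (fun z : ℝ × Pt => grad ψ (projZ (Ub z.1 z.2))) _ :=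
    (hψ.contDiffOn_grad.of_le (by norm_num)).comp hzb hmb
  have hd := ContDiffOn.sub hU hUb
  have h5 : ContDiffOn ℝ 1 (fun z : ℝ × Pt => (((U z.1 z.2).1 - (Ub z.1 z.2).1, 0) : Ext × ℝ))
      (Icc 0 T ×ˢ univ) :=
    ((ContinuousLinearMap.inl ℝ Ext ℝ).comp
      (ContinuousLinearMap.fst ℝ Ext (Vec3 × ℝ))).contDiff.comp_contDiffOn hd
  have h6 : ContDiffOn ℝ 1 (fun z : ℝ × Pt => (U z.1 z.2).th - (Ub z.1 z.2).th)
      (Icc 0 T ×ˢ univ) := projTh.contDiff.comp_contDiffOn hd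
  have h7 : ContDiffOn ℝ 1 (fun z : ℝ × Pt => (U z.1 z.2).v - (Ub z.1 z.2).v)
      (Icc 0 T ×ˢ univ) := projVel.contDiff.comp_contDiffOn hd
  have h8 : ContDiffOn ℝ 1 (fun z : ℝ × Pt =>
      (freeEnergy ψ (projZ (U z.1 z.2)) - freeEnergy ψ (projZ (Ub z.1 z.2))
      - grad ψ (projZ (Ub z.1 z.2)) ((U z.1 z.2).1 - (Ub z.1 z.2).1, 0)
      - grad ψ (projZ (U z.1 z.2)) (0, 1) * ((U z.1 z.2).th - (Ub z.1 z.2).th))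
      + 1 / 2 * ‖(U z.1 z.2).v - (Ub z.1 z.2).v‖ ^ 2) (Icc 0 T ×ˢ univ) :=
    (((h1.sub h2).sub (h4.clm_apply h5)).sub ((h3.clm_apply contDiffOn_const).mul h6)).add
      (contDiffOn_const.mul (h7.norm_sq ℝ))
  exact h8.congr fun z h => hψ.relI_eq (hpos z.1 h.1 z.2) (hposb z.1 h.1 z.2)

theorem StableFreeEnergy.relI_nonneg (hψ : StableFreeEnergy ψ) {u ub : State} (hu : 0 < u.th)
    (hub : 0 < ub.th) : 0 ≤ relI ψ u ub := by
  rw [hψ.relI_eq hu hub]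
  have := hψ.relPsi_nonneg (projZ_mem_dom hu) (projZ_mem_dom hub)
  rw [projZ_apply, projZ_apply] at this
  positivity

theorem totalRelI_nonneg (hψ : StableFreeEnergy ψ) (hU : IsStrongSolution ψ μ k T U)
    {μb : Mat3 → ℝ → ℝ} (hUb : IsStrongSolution ψ μb k T Ub) (ht : t ∈ Icc 0 T) :
    0 ≤ totalRelI ψ U Ub t :=
  setIntegral_nonneg measurableSet_Icc fun x _ =>
    hψ.relI_nonneg (hU.temp_pos t ht x) (hUb.temp_pos t ht x)

theorem continuousOn_viscousDensity (hμ : IsViscosity μ) (hU : FieldC1 T U) (hUb : FieldC1 T Ub)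
    (hpos : ∀ t ∈ Icc 0 T, ∀ x, 0 < (U t x).th) (hposb : ∀ t ∈ Icc 0 T, ∀ x, 0 < (Ub t x).th)
    (hT : 0 < T) :
    ContinuousOn (fun z : ℝ × Pt => viscousDensity μ U Ub z.1 z.2) (Icc 0 T ×ˢ univ) := by
  have hcU := ContDiffOn.continuousOn hU
  have hcUb := ContDiffOn.continuousOn hUb
  have h1 : ContinuousOn (fun z : ℝ × Pt => (U z.1 z.2).th) (Icc 0 T ×ˢ univ) :=
    projTh.continuous.comp_continuousOn hcU
  have h2 : ContinuousOn (fun z : ℝ × Pt => (Ub z.1 z.2).th) (Icc 0 T ×ˢ univ) :=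
    projTh.continuous.comp_continuousOn hcUb
  have h3 : ContinuousOn (fun z : ℝ × Pt => μ (U z.1 z.2).F (U z.1 z.2).th) (Icc 0 T ×ˢ univ) :=
    hμ.1.comp (f := fun z : ℝ × Pt => ((U z.1 z.2).F, (U z.1 z.2).th))
      ((projF.continuous.comp_continuousOn hcU).prodMk h1)
      fun z h => ⟨mem_univ _, hpos z.1 h.1 z.2⟩
  have h4 : ContinuousOn (fun z : ℝ × Pt => gradVelSq Ub z.1 z.2) (Icc 0 T ×ˢ univ) := by
    have h5 : ContinuousOn (fun z : ℝ × Pt => ∑ i : Fin 3, ∑ α : Fin 3,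
        (projV i (stDeriv T Ub z (0, Pi.single α 1))) ^ 2) (Icc 0 T ×ˢ univ) :=
      continuousOn_finsetSum _ fun i _ => continuousOn_finsetSum _ fun α _ =>
        ((projV i).continuous.comp_continuousOn
          ((hUb.continuousOn_stDeriv hT).clm_apply continuousOn_const)).pow 2
    refine h5.congr fun z h => ?_
    simp only [gradVelSq, pd_v (hUb.contDiff_slice h.1), hUb.pd_eq h.1]
    rfl
  exact (h3.mul h1).mul (h4.div h2 fun z h => (hposb z.1 h.1 z.2).ne')

theorem gradVelSq_nonneg (U : ℝ → Pt → State) (t : ℝ) (x : Pt) : 0 ≤ gradVelSq U t x :=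
  Finset.sum_nonneg fun _ _ => Finset.sum_nonneg fun _ _ => sq_nonneg _

theorem viscousDensity_nonneg (hμ : IsViscosity μ) {x : Pt} (hθ : 0 < (U t x).th)
    (hθb : 0 < (Ub t x).th) : 0 ≤ viscousDensity μ U Ub t x := by
  have h1 := hμ.2 (U t x).F _ hθ
  have h2 := gradVelSq_nonneg Ub t x
  unfold viscousDensity
  positivity

/-- The differential form of the relative energy inequality. -/
theorem exists_relative_energy_inequality (hψ : StableFreeEnergy ψ) (hp : 4 ≤ p) (hq : 1 < q)
    (hr : 1 < r) (hl : 1 < l) (hg : GrowthConditions ψ p q r l) (hk : IsConductivity k)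
    (hT : 0 < T) {M δ δ₀ C₀ : ℝ} (hδ : 0 < δ) (hδ₀ : 0 < δ₀) (hC₀ : 0 < C₀)
    (hUb : IsStrongSolution ψ (fun _ _ => 0) k T Ub)
    (hΓ : ∀ t ∈ Icc 0 T, ∀ x, Ub t x ∈ Gam M δ) :
    ∃ C, 0 ≤ C ∧ ∀ (μ : Mat3 → ℝ → ℝ) (U : ℝ → Pt → State), IsViscosity μ →
      IsStrongSolution ψ μ k T U → ThermalBounds ψ k T δ₀ C₀ U →
      ContinuousOn (totalRelI ψ U Ub) (Icc 0 T) ∧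
      ∀ t ∈ Ioo 0 T, ∃ y', HasDerivAt (totalRelI ψ U Ub) y' t ∧
        y' ≤ C * totalRelI ψ U Ub t + ∫ x in Icc (0 : Pt) 1, viscousDensity μ U Ub t x := by
  obtain ⟨C, hC, h⟩ := exists_production_le hψ hp hq hr hl hg hk hT hδ hδ₀ hC₀ hUb hΓ
  refine ⟨C, hC, fun μ U hμ hU hth => ?_⟩
  have hf : FieldC1 T fun t x => relI ψ (U t x) (Ub t x) :=
    FieldC1.relI hψ hU.regular hUb.regular hU.temp_pos hUb.temp_pos
  refine ⟨continuousOn_integral_cell hT.le (ContDiffOn.continuousOn hf), fun t ht => ?_⟩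
  have ht' := Ioo_subset_Icc_self ht
  obtain ⟨hc, hd⟩ := hf.hasDerivAt_integral hT ht
  refine ⟨_, hd, ?_⟩
  have hJ := fun α => contDiff_relFlux hψ hU hUb ht' α
  have hdivc : Continuous fun x => ∑ α, pd α (relFlux ψ μ k U Ub t α) x :=
    continuous_finsetSum _ fun α _ =>
      ((hJ α).continuous_fderiv one_ne_zero).clm_apply continuous_const
  have hdiv := integral_div_eq_zero hJ fun α x j => relFlux_periodic hU hUb ht' α x j
  have hIc := (hf.contDiff_slice ht').continuous
  have hvc : Continuous (viscousDensity μ U Ub t) := continuous_slice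
    (continuousOn_viscousDensity hμ hU.regular hUb.regular hU.temp_pos hUb.temp_pos hT) ht'
  -- The divergence of the relative flux has zero integral, so it may be subtracted before
  -- integrands are compared pointwise.
  have e1 : ∫ x in Icc (0 : Pt) 1,
      stDeriv T (fun t x => relI ψ (U t x) (Ub t x)) (t, x) (1, 0)
      = ∫ x in Icc (0 : Pt) 1, (stDeriv T (fun t x => relI ψ (U t x) (Ub t x)) (t, x) (1, 0)
        - ∑ α, pd α (relFlux ψ μ k U Ub t α) x) := by
    rw [integral_sub (integrableOn_cell hc) (integrableOn_cell hdivc), hdiv, sub_zero]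
  have e2 : C * totalRelI ψ U Ub t + ∫ x in Icc (0 : Pt) 1, viscousDensity μ U Ub t x
      = ∫ x in Icc (0 : Pt) 1, (C * relI ψ (U t x) (Ub t x) + viscousDensity μ U Ub t x) := by
    rw [integral_add ((integrableOn_cell hIc).const_mul C) (integrableOn_cell hvc),
      integral_const_mul]
    rfl
  rw [e1, e2]
  refine setIntegral_mono_on (integrableOn_cell (hc.sub hdivc))
    (integrableOn_cell ((continuous_const.mul hIc).add hvc)) measurableSet_Icc fun x hx => ?_
  rw [(hf.hasDerivAt_time ht x).unique (hasDerivAt_relI_solution hψ hU hUb ht x)]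
  have := h μ U hμ hU hth t ht' x hx
  linarith

/-! ### Grönwall's inequality -/

theorem gronwall_integral {y g : ℝ → ℝ} {C : ℝ} (hT : 0 < T) (hC : 0 ≤ C)
    (hy : ContinuousOn y (Icc 0 T)) (hg : ContinuousOn g (Icc 0 T))
    (hg0 : ∀ t ∈ Icc 0 T, 0 ≤ g t) (hy0 : 0 ≤ y 0)
    (hd : ∀ t ∈ Ioo 0 T, ∃ y', HasDerivAt y y' t ∧ y' ≤ C * y t + g t) :
    ∀ t ∈ Icc 0 T, y t ≤ Real.exp (C * T) * (y 0 + ∫ s in (0 : ℝ)..T, g s) := by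
  -- Extending g constantly beyond the end points makes its primitive differentiable at every time.
  set G := IccExtend hT.le ((Icc 0 T).domRestrict g) with hG
  have hGc : Continuous G := hg.domRestrict.Icc_extend'
  have hGe : ∀ t ∈ Icc 0 T, G t = g t := fun t ht => by
    rw [hG, IccExtend_of_mem _ _ ht]; rfl
  have hGi : ∀ a b, IntervalIntegrable G volume a b := fun a b => hGc.intervalIntegrable a b
  have hG0 : ∀ t, 0 ≤ G t := fun t => hg0 _ (projIcc 0 T hT.le t).2
  have hprim : ∀ t, HasDerivAt (fun t => ∫ s in (0 : ℝ)..t, G s) (G t) t := fun t =>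
    intervalIntegral.integral_hasDerivAt_right (hGi 0 t)
      hGc.stronglyMeasurable.stronglyMeasurableAtFilter hGc.continuousAt
  have hexp : ∀ t, HasDerivAt (fun t => Real.exp (-(C * t))) (Real.exp (-(C * t)) * -C) t :=
    fun t => by simpa using (((hasDerivAt_id t).const_mul C).neg).exp
  -- The integrating factor e^{-Ct} is at most 1 and g ≥ 0, so g may be subtracted without this
  -- factor. The derivative is needed only inside (0, T); continuity covers the end points.
  have hanti : AntitoneOn (fun t => Real.exp (-(C * t)) * y t - ∫ s in (0 : ℝ)..t, G s)
      (Icc 0 T) := by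
    refine antitoneOn_of_deriv_nonpos (convex_Icc 0 T) ?_ ?_ ?_
    · exact ((Continuous.continuousOn (by fun_prop)).mul hy).sub
        fun t _ => (hprim t).continuousAt.continuousWithinAt
    · intro t ht
      rw [interior_Icc] at ht
      obtain ⟨y', hy', -⟩ := hd t ht
      exact (((hexp t).mul hy').sub (hprim t)).differentiableAt.differentiableWithinAt
    · intro t ht
      rw [interior_Icc] at ht
      obtain ⟨y', hy', hle⟩ := hd t ht
      have hD : HasDerivAt (fun t => Real.exp (-(C * t)) * y t - ∫ s in (0 : ℝ)..t, G s) _ t :=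
        ((hexp t).mul hy').sub (hprim t)
      rw [hD.deriv]
      have e1 : Real.exp (-(C * t)) ≤ 1 := Real.exp_le_one_iff.2 (by
        have := mul_nonneg hC ht.1.le; linarith)
      have e2 := Real.exp_pos (-(C * t))
      have e3 := hG0 t
      rw [← hGe t (Ioo_subset_Icc_self ht)] at hle
      nlinarith [mul_le_mul_of_nonneg_left hle e2.le]
  intro t ht
  have h1 := hanti (left_mem_Icc.2 hT.le) ht ht.1
  simp only [mul_zero, neg_zero, Real.exp_zero, one_mul, intervalIntegral.integral_same,
    sub_zero] at h1
  have h2 : ∫ s in (0 : ℝ)..t, G s ≤ ∫ s in (0 : ℝ)..T, G s :=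
    intervalIntegral.integral_mono_interval le_rfl ht.1 ht.2
      (Eventually.of_forall hG0) (hGi 0 T)
  have h3 : ∫ s in (0 : ℝ)..T, G s = ∫ s in (0 : ℝ)..T, g s :=
    intervalIntegral.integral_congr fun s hs => hGe s (by rwa [uIcc_of_le hT.le] at hs)
  have h4 : 0 ≤ ∫ s in (0 : ℝ)..T, G s :=
    intervalIntegral.integral_nonneg hT.le fun s _ => hG0 s
  rw [h3] at h2 h4
  have h5 : y t = Real.exp (C * t) * (Real.exp (-(C * t)) * y t) := by
    rw [← mul_assoc, ← Real.exp_add]; simp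
  rw [h5]
  exact (mul_le_mul_of_nonneg_left (by linarith) (Real.exp_pos _).le).trans
    (mul_le_mul_of_nonneg_right (Real.exp_le_exp.2 (mul_le_mul_of_nonneg_left ht.2 hC))
      (by linarith))

/-! ### The vanishing viscosity limit -/

/-- The viscosity hypothesis gives μθ ≤ C₀μ₀|ê|, with |ê| at most a multiple of 1 + I, while
|∇v̄|²/θ̄ ≤ 9N²/δ from the nine bounded entries of ∇v̄. -/
theorem exists_viscousDensity_le (hψ : StableFreeEnergy ψ) (hp : 4 ≤ p) (hq : 1 < q)
    (hr : 1 < r) (hg : GrowthConditions ψ p q r l) (hT : 0 < T) {M δ C₀ : ℝ} (hδ : 0 < δ)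
    (hC₀ : 0 < C₀) {μb : Mat3 → ℝ → ℝ} (hUb : IsStrongSolution ψ μb k T Ub)
    (hΓ : ∀ t ∈ Icc 0 T, ∀ x, Ub t x ∈ Gam M δ) :
    ∃ A, 0 ≤ A ∧ ∀ (μ : Mat3 → ℝ → ℝ) (U : ℝ → Pt → State) (μ₀ : ℝ), 0 < μ₀ →
      IsStrongSolution ψ μ k T U → ViscosityBound ψ μ T C₀ μ₀ U →
      ∀ t ∈ Icc 0 T, ∀ x ∈ Icc (0 : Pt) 1,
        viscousDensity μ U Ub t x ≤ A * μ₀ * (1 + relI ψ (U t x) (Ub t x)) := by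
  obtain ⟨N, hN0, hN⟩ := FieldC1.exists_bound hUb.regular hT
  obtain ⟨E, hE, he⟩ := hg.exists_abs_energy_le hψ hp hq hr (M := M) hδ
  refine ⟨C₀ * E * (9 * N ^ 2 / δ), by positivity, fun μ U μ₀ hμ₀ hU hv t ht x hx => ?_⟩
  have hθ := hU.temp_pos t ht x
  have hθb := hUb.temp_pos t ht x
  have h1 := he (projZ (U t x)) hθ (projZ (Ub t x)) (projZ_mem_box le_rfl (hΓ t ht x))
  rw [projZ_xi, projZ_th] at h1
  have h2 : relPsi ψ (projZ (U t x)) (projZ (Ub t x)) ≤ relI ψ (U t x) (Ub t x) := by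
    rw [hψ.relI_eq hθ hθb, ← projZ_apply, ← projZ_apply]
    have := sq_nonneg ‖(U t x).2.1 - (Ub t x).2.1‖
    linarith
  have h3 : μ (U t x).F (U t x).th * (U t x).th
      ≤ C₀ * μ₀ * (E * (1 + relI ψ (U t x) (Ub t x))) := by
    refine (le_abs_self _).trans ((hv t ht x).trans ?_)
    refine mul_le_mul_of_nonneg_left (h1.trans ?_) (by positivity)
    exact mul_le_mul_of_nonneg_left (by linarith) hE
  have h4 : gradVelSq Ub t x ≤ 9 * N ^ 2 := by
    have : ∀ i ∈ (Finset.univ : Finset (Fin 3)), ∀ α ∈ (Finset.univ : Finset (Fin 3)),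
        (pd α (fun y => (Ub t y).v i) x) ^ 2 ≤ N ^ 2 := fun i _ α _ => by
      rw [pd_v (hUb.contDiff_slice ht), ← sq_abs]
      refine pow_le_pow_left₀ (abs_nonneg _) ?_ 2
      exact (abs_coord_vec_le _ i).trans ((norm_fst_le _).trans ((norm_snd_le _).trans
        ((hN t ht x hx).1 α)))
    have s := Finset.sum_le_sum fun i hi => Finset.sum_le_sum (this i hi)
    simp only [Finset.sum_const, Finset.card_univ, Fintype.card_fin, nsmul_eq_mul,
      Nat.cast_ofNat] at s
    unfold gradVelSq
    linarith
  have h5 : gradVelSq Ub t x / (Ub t x).th ≤ 9 * N ^ 2 / δ :=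
    div_le_div₀ (by positivity) h4 hδ (hΓ t ht x).2.2.2.2.1
  have h6 : 0 ≤ 1 + relI ψ (U t x) (Ub t x) := by
    have := hψ.relI_nonneg hθ hθb
    linarith
  have h7 : 0 ≤ gradVelSq Ub t x / (Ub t x).th := div_nonneg (gradVelSq_nonneg _ _ _) hθb.le
  refine (mul_le_mul h3 h5 h7 (by positivity)).trans_eq ?_
  ring

theorem iSup_enorm_tendsto_zero {f : ℝ → ℝ → ℝ} {b : ℝ → ℝ} {L : Filter ℝ} {s : Set ℝ}
    (hb : Tendsto b L (𝓝 0)) (hf : ∀ᶠ m in L, ∀ t ∈ s, ‖f m t‖ ≤ b m) :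
    Tendsto (fun m => ⨆ t ∈ s, ‖f m t‖ₑ) L (𝓝 0) := by
  have hb' : Tendsto (fun m => ENNReal.ofReal (b m)) L (𝓝 0) := by
    simpa using ENNReal.tendsto_ofReal hb
  refine tendsto_of_tendsto_of_tendsto_of_le_of_le' tendsto_const_nhds hb'
    (Eventually.of_forall fun _ => zero_le) ?_
  filter_upwards [hf] with m hm
  refine iSup₂_le fun t ht => ?_
  rw [← ofReal_norm]
  exact ENNReal.ofReal_le_ofReal (hm t ht)

end Thermo

/-! ### Stability estimate and vanishing viscosity limit -/

theorem theorem5p1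
    (ψ : Thermo.Ext → ℝ → ℝ) (hψ : Thermo.StableFreeEnergy ψ)
    (p q r l : ℝ) (hp : 4 ≤ p) (hq : 1 < q) (hr : 1 < r) (hl : 1 < l)
    (hgrowth : Thermo.GrowthConditions ψ p q r l)
    (k : Thermo.Mat3 → ℝ → ℝ) (hk : Thermo.IsConductivity k)
    (T : ℝ) (hT : 0 < T) (M δ : ℝ) (hδ : 0 < δ)
    (δ₀ : ℝ) (hδ₀ : 0 < δ₀) (C₀ : ℝ) (hC₀ : 0 < C₀)
    (Ub : ℝ → Thermo.Pt → Thermo.State)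
    (hUb : Thermo.IsStrongSolution ψ (fun _ _ => 0) k T Ub)
    (hΓ : ∀ t ∈ Set.Icc 0 T, ∀ x, Ub t x ∈ Thermo.Gam M δ) :
    (∃ C : ℝ, 0 < C ∧
      ∀ (μ : Thermo.Mat3 → ℝ → ℝ) (U : ℝ → Thermo.Pt → Thermo.State),
        Thermo.IsViscosity μ → Thermo.IsStrongSolution ψ μ k T U →
        Thermo.ThermalBounds ψ k T δ₀ C₀ U →
        ∀ t ∈ Set.Icc 0 T, Thermo.totalRelI ψ U Ub t ≤
          C * (Thermo.totalRelI ψ U Ub 0 + Thermo.viscousError μ T U Ub)) ∧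
    (∀ (μ : ℝ → Thermo.Mat3 → ℝ → ℝ) (U : ℝ → ℝ → Thermo.Pt → Thermo.State),
      (∀ᶠ μ₀ in 𝓝[>] (0 : ℝ), Thermo.IsViscosity (μ μ₀) ∧
        Thermo.IsStrongSolution ψ (μ μ₀) k T (U μ₀) ∧
        Thermo.ThermalBounds ψ k T δ₀ C₀ (U μ₀) ∧
        Thermo.ViscosityBound ψ (μ μ₀) T C₀ μ₀ (U μ₀)) →
      Tendsto (fun μ₀ => Thermo.totalRelI ψ (U μ₀) Ub 0) (𝓝[>] 0) (𝓝 0) →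
      Tendsto (fun μ₀ => ⨆ t ∈ Set.Ico 0 T, ‖Thermo.totalRelI ψ (U μ₀) Ub t‖ₑ)
        (𝓝[>] 0) (𝓝 0)) := by
  obtain ⟨C, hC, h⟩ := Thermo.exists_relative_energy_inequality hψ hp hq hr hl hgrowth hk hT hδ
    hδ₀ hC₀ hUb hΓ
  have h0 : (0 : ℝ) ∈ Icc 0 T := left_mem_Icc.2 hT.le
  refine ⟨⟨Real.exp (C * T), Real.exp_pos _, fun μ U hμ hU hth t ht => ?_⟩, fun μ U hfam hinit => ?_⟩
  · obtain ⟨hy, hd⟩ := h μ U hμ hU hth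
    exact Thermo.gronwall_integral hT hC hy (Thermo.continuousOn_integral_cell hT.le
      (Thermo.continuousOn_viscousDensity hμ hU.regular hUb.regular hU.temp_pos hUb.temp_pos hT))
      (fun s hs => setIntegral_nonneg measurableSet_Icc fun x _ =>
        Thermo.viscousDensity_nonneg hμ (hU.temp_pos s hs x) (hUb.temp_pos s hs x))
      (Thermo.totalRelI_nonneg hψ hU hUb h0) hd t ht
  · obtain ⟨A, hA, hvd⟩ := Thermo.exists_viscousDensity_le hψ hp hq hr hgrowth hT hδ hC₀ hUb hΓ
    set V := volume.real (Icc (0 : Thermo.Pt) 1)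
    have hV : 0 ≤ V := measureReal_nonneg
    -- Grönwall's inequality is run again instead of quoting (i), because the viscous error itself
    -- contains I; its share of I raises the rate from C to C + A, and the rest contributes
    -- T·A·μ₀·V.
    refine Thermo.iSup_enorm_tendsto_zero (b := fun μ₀ => Real.exp ((C + A) * T)
      * (Thermo.totalRelI ψ (U μ₀) Ub 0 + T * (A * μ₀ * V))) ?_ ?_
    · have hid : Tendsto (fun μ₀ : ℝ => μ₀) (𝓝[>] 0) (𝓝 0) := nhdsWithin_le_nhds
      have := (hinit.add (((hid.const_mul A).mul_const V).const_mul T)).const_mul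
        (Real.exp ((C + A) * T))
      simpa using this
    · filter_upwards [hfam, Ioo_mem_nhdsGT (zero_lt_one (α := ℝ))] with μ₀ hμ₀ hμ₀1 t ht
      obtain ⟨hμ, hU, hth, hvb⟩ := hμ₀
      obtain ⟨hy, hd⟩ := h _ _ hμ hU hth
      have ht' : t ∈ Icc 0 T := Ico_subset_Icc_self ht
      have hnn := fun s hs => Thermo.totalRelI_nonneg (t := s) hψ hU hUb hs
      rw [Real.norm_of_nonneg (hnn t ht')]
      have hK : 0 ≤ A * μ₀ * V := by have := hμ₀1.1; positivity
      refine (Thermo.gronwall_integral (g := fun _ => A * μ₀ * V) hT (add_nonneg hC hA) hy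
        continuousOn_const (fun _ _ => hK) (hnn 0 h0) (fun s hs => ?_) t ht').trans_eq (by
          rw [intervalIntegral.integral_const, sub_zero, smul_eq_mul])
      obtain ⟨y', hy', hle⟩ := hd s hs
      have hs' := Ioo_subset_Icc_self hs
      refine ⟨y', hy', hle.trans ?_⟩
      have hIc := (Thermo.FieldC1.contDiff_slice (Thermo.FieldC1.relI hψ hU.regular hUb.regular
        hU.temp_pos hUb.temp_pos) hs').continuous
      have hvc : Continuous (Thermo.viscousDensity (μ μ₀) (U μ₀) Ub s) :=
        Thermo.continuous_slice (Thermo.continuousOn_viscousDensity hμ hU.regular hUb.regular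
          hU.temp_pos hUb.temp_pos hT) hs'
      have hint : ∫ x in Icc (0 : Thermo.Pt) 1, Thermo.viscousDensity (μ μ₀) (U μ₀) Ub s x
          ≤ A * μ₀ * (V + Thermo.totalRelI ψ (U μ₀) Ub s) := by
        have hic : IntegrableOn (fun x => A * μ₀ * (1 + Thermo.relI ψ (U μ₀ s x) (Ub s x)))
            (Icc (0 : Thermo.Pt) 1) :=
          Thermo.integrableOn_cell (continuous_const.mul (continuous_const.add hIc))
        refine (setIntegral_mono_on (Thermo.integrableOn_cell hvc) hic measurableSet_Icc
          fun x hx => hvd (μ μ₀) (U μ₀) μ₀ hμ₀1.1 hU hvb s hs' x hx).trans_eq ?_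
        rw [integral_const_mul, integral_add (Thermo.integrableOn_cell continuous_const)
          (Thermo.integrableOn_cell hIc)]
        simp [V, Thermo.totalRelI]
      -- Restricting to μ₀ < 1 keeps the Grönwall rate independent of μ₀.
      have hyA : A * μ₀ * Thermo.totalRelI ψ (U μ₀) Ub s ≤ A * Thermo.totalRelI ψ (U μ₀) Ub s :=
        mul_le_mul_of_nonneg_right (mul_le_of_le_one_right hA hμ₀1.2.le) (hnn s hs')
      linarith
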